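/- **Setting.** An Ising model on $n$ nodes with external field $(\theta_u)_u$ and symmetric edge parameters $(\theta_{uv})_{u\ne v}$ is the probability distribution $p(x)\propto\exp\big(\sum_u\theta_ux_u+\sum_{u<v}\theta_{uv}x_ux_v\big)$ on $\{\pm1\}^n$. It is in the high-temperature regime with margin $\eta>0$ if $\max_v\sum_{u\neq v}\tanh|\theta_{uv}|\le 1-\eta$. Let $\mathcal I_n$ be the set of product distributions on $\{\pm1\}^n$, $d_{\mathrm{SKL}}(p,q)=d_{\mathrm{KL}}(p\|q)+d_{\mathrm{KL}}(q\|p)\in[0,\infty]$, and $d_{\mathrm{SKL}}(p,\mathcal I_n)=\inf_{q\in\mathcal I_n}d_{\mathrm{SKL}}(p,q)$. **The learn-then-test algorithm** has inputs $n$, $\beta\ge0$, $\varepsilon>0$, a parameter $\tau$, and i.i.d. samples from $p$; it tosses independent fair coins. Every $O(\cdot)$ below stands for a constant that is a parameter of the algorithm. For a pair of nodes $e=\{u,v\}$ and $x,y\in\{\pm1\}^n$ put $D_e(x,y)=(x_u-y_u)(x_v-y_v)$. 1. *Localization.* From $O(n^{2\tau}\beta^2\log n/\varepsilon^2)$ samples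 compute the empirical covariances $\hat\lambda_{uv}=\hat\mu_{uv}-\hat\mu_u\hat\mu_v$. If $4\beta n^{\tau}|\hat\lambda_{uv}|\ge\varepsilon$ for some pair, answer "far". 2. *Weak learning.* For each $\ell=1,\dots,O(n^{2-\tau})$ draw $k=O(n^{2\tau}\beta^2/\varepsilon^2)$ fresh sample pairs $(X^{(i,1)},X^{(i,2)})$. For every $e$ let $\Gamma^{(\ell)}_e\in\{\pm1\}$ be the sign of $\sum_iZ_e^{(i)}$, where $Z_e^{(i)}=\frac14D_e(X^{(i,1)},X^{(i,2)})\in\{-1,0,1\}$, each value $0$ being replaced by a fair coin in $\{\pm1\}$; a zero sum is also decided by a fair coin. 3. *Testing.* On samples common to all $\ell$, for each $\ell$ take the majority vote of $O(\log(1/\delta))$ runs, where $\delta=O(1/n^{2-\tau})$, each using $O(\sigma^2n^{4-2\tau}\beta^2/\varepsilon^2)$ fresh sample pairs with $\sigma^2=n^2(1+\log n)^{O(1)}$. A run rejects if the average of $\sum_e\Gamma^{(\ell)}_eD_e(X^{(1)},X^{(2)})$ over its sample pairs, multiplied by $4\beta n^{2-\tau}$, exceeds $c\,\varepsilon$ for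 a constant $c>0$. If a majority rejects for some $\ell$, answer "far"; otherwise answer "independent". Sample sizes are rounded down; numbers of repetitions are rounded up. **Theorem.** For every $\eta>0$ there are positive constants in the description of the algorithm, and constants $C$ and $a\in\mathbb N$, all depending only on $\eta$, such that the following holds for the algorithm with $\tau=4/3$, for all $n$, $\beta\ge0$ and $\varepsilon>0$. * The number of samples taken is at most $C(1+\log n)^a\,n^{10/3}\beta^2/\varepsilon^2$ (that is, $\tilde O(n^{10/3}\beta^2/\varepsilon^2)$). * Let $p$ be any Ising model on $n$ nodes, with an arbitrary external field, in the high-temperature regime with margin $\eta$ and with $|\theta_{uv}|\le\beta$ for all $u\ne v$. If $p\in\mathcal I_n$, the algorithm answers "independent" with probability at least $9/10$. If $d_{\mathrm{SKL}}(p,\mathcal I_n)\ge\varepsilon$, it answers "far" with probability at least $9/10$. * For every Ising model $p$ on $n$ nodes in the high-temperature regime with margin $\eta$, all coefficients $c_e\in[-1,1]$, and independent $X^{(1)},X^{(2)}\sim p$, the two-sample centered statistic satisfies $\mathrm{Var}\big(\sum_ec_eD_e(X^{(1)},X^{(2)})\big)\le C(1+\log n)^a\,n^2$. (For $n=0$ read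 $\log 0$ as $0$.) -/

import Mathlib

open MeasureTheory ProbabilityTheory
open scoped ENNReal

noncomputable section

namespace IsingTesting

/-! ### Ising models -/

/-- Spin configurations `{±1}^n`; the two-point set `{±1}` is the group of units of `ℤ`. -/
abbrev Config (n : ℕ) : Type := Fin n → ℤˣ

/-- The real number `±1` carried by node `u` in the configuration `x`. -/
def spin {n : ℕ} (x : Config n) (u : Fin n) : ℝ := ((x u : ℤ) : ℝ)

/-- Unordered pairs of distinct nodes, written with the smaller node first. -/
abbrev Pair (n : ℕ) : Type := {e : Fin n × Fin n // e.1 < e.2}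

/-- Parameters of an Ising model on `n` nodes. A zero coupling means that the edge is absent, and
the diagonal of `coupling` is never used. -/
structure IsingParams (n : ℕ) where
  /-- The external field `θ_u`. -/
  field : Fin n → ℝ
  /-- The edge parameters `θ_{uv}`. -/
  coupling : Fin n → Fin n → ℝ
  symm : ∀ u v, coupling u v = coupling v u

/-- The exponent `∑_u θ_u x_u + ∑_{u < v} θ_{uv} x_u x_v`. -/
def IsingParams.exponent {n : ℕ} (θ : IsingParams n) (x : Config n) : ℝ :=
  ∑ u, θ.field u * spin x u +
    ∑ e : Pair n, θ.coupling e.1.1 e.1.2 * (spin x e.1.1 * spin x e.1.2)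

/-- The Ising model: the probability measure on `{±1}^n` whose mass at `x` is proportional to
`exp (θ.exponent x)`. -/
def IsingParams.law {n : ℕ} (θ : IsingParams n) : Measure (Config n) :=
  (Measure.count : Measure (Config n)).tilted θ.exponent

instance : MeasurableSingletonClass ℤˣ :=
  ⟨fun s => ⟨{(s : ℤ)}, measurableSet_singleton _, by
    ext t
    simp [Units.ext_iff]⟩⟩

instance {n : ℕ} (θ : IsingParams n) : IsProbabilityMeasure θ.law :=
  isProbabilityMeasure_tilted (Integrable.of_finite)

theorem IsingParams.law_singleton {n : ℕ} (θ : IsingParams n) (x : Config n) :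
    θ.law {x} =
      ENNReal.ofReal (Real.exp (θ.exponent x) / ∑ y, Real.exp (θ.exponent y)) := by
  rw [IsingParams.law, tilted_apply _ _ _]
  simp [integral_count, Measure.restrict_singleton]

/-- The high-temperature regime (Dobrushin's uniqueness condition) with margin `η`. -/
def IsingParams.HighTemperature {n : ℕ} (θ : IsingParams n) (η : ℝ) : Prop :=
  ∀ v, ∑ u ∈ Finset.univ.erase v, Real.tanh |θ.coupling u v| ≤ 1 - η

/-- `β` bounds every edge parameter in absolute value. -/
def IsingParams.CouplingsBoundedBy {n : ℕ} (θ : IsingParams n) (β : ℝ) : Prop :=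
  ∀ u v, u ≠ v → |θ.coupling u v| ≤ β

/-! ### Product distributions and symmetrized Kullback-Leibler divergence -/

/-- The set `I_n` of all product distributions on `{±1}^n`. -/
def productLaws (n : ℕ) : Set (Measure (Config n)) :=
  {q | ∃ ν : Fin n → Measure ℤˣ, (∀ u, IsProbabilityMeasure (ν u)) ∧ q = Measure.pi ν}

/-- Symmetrized Kullback-Leibler divergence, with values in `[0, ∞]`. -/
def dSKL {α : Type*} [MeasurableSpace α] (p q : Measure α) : ℝ≥0∞ :=
  InformationTheory.klDiv p q + InformationTheory.klDiv q p

/-- `d_SKL(p, I_n) = inf_{q ∈ I_n} d_SKL(p, q)`. -/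
def dSKLProduct {n : ℕ} (p : Measure (Config n)) : ℝ≥0∞ :=
  ⨅ q ∈ productLaws n, dSKL p q

/-! ### The two-sample centered statistic -/

/-- `(x_u - y_u) (x_v - y_v)` for the pair `e = {u, v}` and two configurations `x`, `y`. -/
def centeredProduct {n : ℕ} (e : Pair n) (x y : Config n) : ℝ :=
  (spin x e.1.1 - spin y e.1.1) * (spin x e.1.2 - spin y e.1.2)

/-- `∑_{uv} c_{uv} (x_u - y_u) (x_v - y_v)`, the sum being over unordered pairs. -/
def centeredStatistic {n : ℕ} (c : Pair n → ℝ) (x y : Config n) : ℝ :=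
  ∑ e, c e * centeredProduct e x y

/-! ### Stage 1: the localization test -/

/-- Average of `f` over the sample `X` (equal to `0` for an empty sample). -/
def sampleMean {α : Type*} {k : ℕ} (X : Fin k → α) (f : α → ℝ) : ℝ :=
  (∑ i, f (X i)) / k

/-- Empirical covariance `μ̂_{uv} - μ̂_u μ̂_v`. -/
def sampleCov {n k : ℕ} (X : Fin k → Config n) (e : Pair n) : ℝ :=
  sampleMean X (fun x => spin x e.1.1 * spin x e.1.2) -
    sampleMean X (fun x => spin x e.1.1) * sampleMean X (fun x => spin x e.1.2)

/-- The localization test with accuracy parameter `a` identifies an edge: some empirical covariance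
is at least `a / (4 β)` in absolute value. (Cleared of the denominator: for `β = 0` nothing is
identified.) -/
def LocalizationFinds {n k : ℕ} (β a : ℝ) (X : Fin k → Config n) : Prop :=
  ∃ e : Pair n, a ≤ 4 * β * |sampleCov X e|

/-! ### Stage 2: weak learning of the signs -/

/-- A sample of `±1` with the same mean as `Z = (x_u - y_u) (x_v - y_v) / 4`, which lies in
`{-1, 0, 1}`: it is `Z` itself, unless `Z = 0`, when it is the fair coin `b`. -/
def rademacherSample {n : ℕ} (e : Pair n) (x y : Config n) (b : ℤˣ) : ℝ :=
  if centeredProduct e x y = 0 then ((b : ℤ) : ℝ) else centeredProduct e x y / 4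

/-- The sign vector `Γ` of the empirical means. The coin `coins e (some i)` is used for the `i`-th
sample of the pair `e`, and the coin `coins e none` decides if the empirical mean is zero. -/
def weakLearn {n k : ℕ} (X : Fin k → Fin 2 → Config n) (coins : Pair n → Option (Fin k) → ℤˣ) :
    Pair n → ℝ := fun e =>
  let S : ℝ := ∑ i, rademacherSample e (X i 0) (X i 1) (coins e (some i))
  if S = 0 then ((coins e none : ℤ) : ℝ) else Real.sign S

/-! ### Stage 3: testing a learned sign vector -/

/-- One run of the Chebyshev test for the sign vector `Γ` speaks against independence: the average
of the centered statistic exceeds `c ε / (4 β s)`. (Cleared of the denominator.) -/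
def ChebyshevRejects {n k : ℕ} (c β ε s : ℝ) (Γ : Pair n → ℝ) (X : Fin k → Fin 2 → Config n) :
    Prop :=
  c * ε < 4 * β * s * sampleMean X (fun y => centeredStatistic Γ (y 0) (y 1))

/-- Majority vote over `R` runs of the Chebyshev test on separate samples. -/
def MajorityRejects {n k R : ℕ} (c β ε s : ℝ) (Γ : Pair n → ℝ)
    (X : Fin R → Fin k → Fin 2 → Config n) : Prop :=
  R < 2 * Set.ncard {r : Fin R | ChebyshevRejects c β ε s Γ (X r)}

/-! ### The learn-then-test algorithm -/

/-- The constants which the description of the algorithm leaves in `O(·)` notation. -/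
structure Tuning where
  /-- Constant in the number of samples of the localization test. -/
  loc : ℝ
  /-- Constant in the number of samples of one run of the weak learner. -/
  learn : ℝ
  /-- Constant in the number of runs of the weak learner. -/
  rounds : ℝ
  /-- Constant in the threshold of the Chebyshev test. -/
  thr : ℝ
  /-- Constant in the number of samples of the Chebyshev test. -/
  test : ℝ
  /-- Constant in the number of repetitions of the Chebyshev test. -/
  boost : ℝ
  /-- Constant in the failure probability asked of the boosted Chebyshev test. -/
  fail : ℝ
  /-- Exponent of the logarithm in the variance parameter `σ²`. -/
  logExp : ℕ
  loc_pos : 0 < loc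
  learn_pos : 0 < learn
  rounds_pos : 0 < rounds
  thr_pos : 0 < thr
  test_pos : 0 < test
  boost_pos : 0 < boost
  fail_pos : 0 < fail

namespace Tuning

variable (T : Tuning) (n : ℕ) (τ β ε : ℝ)

/-- `O(n^{2τ} β² log n / ε²)` samples for the localization test. -/
def locSize : ℕ := ⌊T.loc * (n : ℝ) ^ (2 * τ) * β ^ 2 * Real.log n / ε ^ 2⌋₊

/-- `O(n^{2-τ})` runs of the weak learner. -/
def numRounds : ℕ := ⌈T.rounds * (n : ℝ) ^ (2 - τ)⌉₊

/-- `O(n^{2τ} β² / ε²)` sample pairs for each run of the weak learner. -/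
def learnSize : ℕ := ⌊T.learn * (n : ℝ) ^ (2 * τ) * β ^ 2 / ε ^ 2⌋₊

/-- The variance parameter `σ² = Õ(n²)`. -/
def sigmaSq : ℝ := (n : ℝ) ^ 2 * (1 + Real.log n) ^ T.logExp

/-- `O(σ² n^{4-2τ} β² / ε²)` sample pairs for each run of the Chebyshev test. -/
def testSize : ℕ := ⌊T.test * T.sigmaSq n * (n : ℝ) ^ (4 - 2 * τ) * β ^ 2 / ε ^ 2⌋₊

/-- The failure probability `δ = O(1 / n^{2-τ})`. -/
def delta : ℝ := T.fail / (n : ℝ) ^ (2 - τ)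

/-- `O(log (1/δ))` runs of the Chebyshev test. -/
def numRuns : ℕ := ⌈T.boost * Real.log (1 / T.delta n τ)⌉₊

/-- The samples drawn by the algorithm: those of the localization test; for each run of the weak
learner, `learnSize` fresh pairs of samples; for each run of the Chebyshev test, `testSize` fresh
pairs of samples, which are shared by all the learned sign vectors. -/
abbrev SampleIdx : Type :=
  Fin (T.locSize n τ β ε) ⊕ (Fin (T.numRounds n τ) × Fin (T.learnSize n τ β ε) × Fin 2) ⊕
    (Fin (T.numRuns n τ) × Fin (T.testSize n τ β ε) × Fin 2)

/-- The fair coins tossed by the algorithm. -/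
abbrev CoinIdx : Type :=
  Fin (T.numRounds n τ) × Pair n × Option (Fin (T.learnSize n τ β ε))

/-- The number of samples which the algorithm takes. -/
def numSamples : ℕ := Fintype.card (T.SampleIdx n τ β ε)

variable {n}

/-- The learn-then-test algorithm with parameter `τ`, run on the samples `X` and the coins `ω`,
answers "far from independent". Otherwise it answers "independent". -/
def SaysFar (X : T.SampleIdx n τ β ε → Config n) (ω : T.CoinIdx n τ β ε → ℤˣ) : Prop :=
  LocalizationFinds β (ε / (n : ℝ) ^ τ) (fun i => X (Sum.inl i)) ∨
  ∃ l : Fin (T.numRounds n τ),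
    MajorityRejects T.thr β ε ((n : ℝ) ^ (2 - τ))
      (weakLearn (fun i j => X (Sum.inr (Sum.inl (l, i, j)))) (fun e o => ω (l, e, o)))
      (fun r i j => X (Sum.inr (Sum.inr (r, i, j))))

/-- The joint law of i.i.d. samples from `p` and of independent fair coins. -/
def runLaw (p : Measure (Config n)) :
    Measure ((T.SampleIdx n τ β ε → Config n) × (T.CoinIdx n τ β ε → ℤˣ)) :=
  (Measure.pi fun _ => p).prod (Measure.pi fun _ => (PMF.uniformOfFintype ℤˣ).toMeasure)

end Tuning

end IsingTesting

end

/-! Write λ_e for the covariance of the two spins of a pair e, and Λ for ∑ |λ_e|. An Ising law p is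
an exponential tilt of the product of its marginals, so their symmetrized divergence is exactly ∑
θ_e λ_e (`IsingParams.dSKL_pi_marginal`). Hence Λ ≥ ε/β if p is far from independent, while every
λ_e vanishes if p is a product. The statistic ∑ Γ_e D_e has mean 2 ∑ Γ_e λ_e, so Λ could be tested
if the signs of the λ_e were known.

High temperature enters through the Glauber dynamics, one step of which contracts oscillations by
the factor 1 - η/n (`OscLE.glauber`). This gives a Poincaré inequality (`IsingParams.variance_le`)
and the bound ∑_v |λ_uv| ≤ 2/η (`IsingParams.sum_abs_spinCov_le`). The derivative of the centered
statistic in one spin is linear in the spins, so two applications of Poincaré bound its variance by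
64 n²/η². The covariance bound gives Λ ≤ 2n/η, hence nβ/ε ≥ η/2 in the far case, which keeps the
rounded-down sample sizes positive.

The signs are learned weakly. If some |λ_e| exceeds a suitable multiple of ε/(β n^{4/3}),
localization detects it. Otherwise √k |λ_e| is bounded for k of order n^{8/3} β²/ε², and the
majority of k coins of mean λ_e/2 has a bias of order at least √k |λ_e| in the right direction
(`mul_integral_sign_signSum_ge`). By linearity alone, with no independence between pairs, ∑ Γ_e λ_e
has mean of order at least √k ∑ λ_e² ≥ √k Λ²/n², and it never exceeds Λ. A reverse Markov inequality
then gives a value of order at least ε/(β n^{2/3}) with probability of order at least n^{-2/3}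
(`learned_good_ge`).

So O(n^{2/3}) rounds contain a good sign vector with high probability. The rounds cost n^{2/3} ·
n^{8/3} = n^{10/3} and the Chebyshev test costs n² · n^{4/3} = n^{10/3}, both times β²/ε²: the
choice τ = 4/3 balances the two. -/

noncomputable section

namespace IsingTesting

/-! ### Quadratic forms in the spins -/

/-- The symmetric matrix with zero diagonal and entries `c e` off the diagonal. -/
def pairMatrix {n : ℕ} (c : Pair n → ℝ) (u v : Fin n) : ℝ :=
  if h : u < v then c ⟨(u, v), h⟩ else if h : v < u then c ⟨(v, u), h⟩ else 0

theorem pairMatrix_self {n : ℕ} (c : Pair n → ℝ) (u : Fin n) : pairMatrix c u u = 0 := by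
  simp [pairMatrix]

theorem pairMatrix_comm {n : ℕ} (c : Pair n → ℝ) (u v : Fin n) :
    pairMatrix c u v = pairMatrix c v u := by
  rcases lt_trichotomy u v with h | h | h
  · simp [pairMatrix, h, h.not_gt]
  · rw [h]
  · simp [pairMatrix, h, h.not_gt]

theorem abs_pairMatrix_le {n : ℕ} {c : Pair n → ℝ} (hc : ∀ e, |c e| ≤ 1) (u v : Fin n) :
    |pairMatrix c u v| ≤ 1 := by
  unfold pairMatrix
  split_ifs <;> simp [hc]

theorem two_mul_sum_pair {n : ℕ} (c : Pair n → ℝ) (g : Fin n → Fin n → ℝ)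
    (hg : ∀ u v, g u v = g v u) :
    2 * ∑ e : Pair n, c e * g e.1.1 e.1.2 = ∑ u, ∑ v, pairMatrix c u v * g u v := by
  have key : ∑ e : Pair n, c e * g e.1.1 e.1.2 =
      ∑ u, ∑ v, (if u < v then pairMatrix c u v * g u v else 0) := by
    rw [← Fintype.sum_prod_type' (f := fun u v => if u < v then pairMatrix c u v * g u v else 0),
      ← Finset.sum_filter]
    rw [Finset.sum_subtype (p := fun e : Fin n × Fin n => e.1 < e.2) _ (by simp)]
    refine Finset.sum_congr rfl fun e _ => ?_
    simp [pairMatrix, e.2]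
  have swap : ∑ u, ∑ v, (if u < v then pairMatrix c u v * g u v else 0) =
      ∑ u, ∑ v, (if v < u then pairMatrix c u v * g u v else 0) := by
    rw [Finset.sum_comm]
    refine Finset.sum_congr rfl fun u _ => Finset.sum_congr rfl fun v _ => ?_
    rw [pairMatrix_comm, hg]
  have split : ∑ u, ∑ v, pairMatrix c u v * g u v =
      ∑ u, ∑ v, (if u < v then pairMatrix c u v * g u v else 0) +
        ∑ u, ∑ v, (if v < u then pairMatrix c u v * g u v else 0) := by
    simp_rw [← Finset.sum_add_distrib]
    refine Finset.sum_congr rfl fun u _ => Finset.sum_congr rfl fun v _ => ?_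
    rcases lt_trichotomy u v with h | h | h
    · simp [h, h.not_gt]
    · simp [h, pairMatrix_self]
    · simp [h, h.not_gt]
  rw [split, ← swap, key, two_mul]

/-- The matrix has zero diagonal, so the increment has no term in s², and the row sum does not see
the entry that changes. -/
theorem sum_pair_update {n : ℕ} (c : Pair n → ℝ) (a b : Fin n → ℝ) (w : Fin n) (s : ℝ)
    (hb : ∀ u, b u = a u + if u = w then s else 0) :
    ∑ e : Pair n, c e * (b e.1.1 * b e.1.2) - ∑ e : Pair n, c e * (a e.1.1 * a e.1.2) =
      s * ∑ v, pairMatrix c w v * a v := by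
  have h1 := two_mul_sum_pair c (fun u v => b u * b v) (fun u v => mul_comm _ _)
  have h2 := two_mul_sum_pair c (fun u v => a u * a v) (fun u v => mul_comm _ _)
  have h3 : ∑ u, ∑ v, pairMatrix c u v * (b u * b v) =
      ∑ u, ∑ v, pairMatrix c u v * (a u * a v) + 2 * (s * ∑ v, pairMatrix c w v * a v) := by
    have : ∀ u v, pairMatrix c u v * (b u * b v) = pairMatrix c u v * (a u * a v) +
        ((if u = w then s * (pairMatrix c w v * a v) else 0) +
          (if v = w then s * (pairMatrix c w u * a u) else 0)) := by
      intro u v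
      rw [hb, hb]
      by_cases hu : u = w <;> by_cases hv : v = w
      · subst hu; subst hv; simp [pairMatrix_self]
      · subst hu; simp [hv]; ring
      · subst hv; simp [hu, pairMatrix_comm c u]; ring
      · simp [hu, hv]
    simp_rw [this, Finset.sum_add_distrib]
    congr 1
    rw [Finset.sum_comm, two_mul, Finset.mul_sum]
    simp
  linarith

theorem spin_eq_one_or {n : ℕ} (x : Config n) (u : Fin n) : spin x u = 1 ∨ spin x u = -1 := by
  rcases Int.units_eq_one_or (x u) with h | h <;> simp [spin, h]

theorem abs_spin {n : ℕ} (x : Config n) (u : Fin n) : |spin x u| = 1 := by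
  rcases spin_eq_one_or x u with h | h <;> simp [h]

theorem spin_update_one {n : ℕ} (x : Config n) (v u : Fin n) :
    spin (Function.update x v 1) u =
      spin (Function.update x v (-1)) u + if u = v then 2 else 0 := by
  by_cases h : u = v
  · subst h; simp [spin]; norm_num
  · simp [spin, h]

theorem spin_update_of_ne {n : ℕ} (x : Config n) {v u : Fin n} (h : u ≠ v) (s : ℤˣ) :
    spin (Function.update x v s) u = spin x u := by
  simp [spin, h]

/-- The difference of `f` in the direction of the spin `v`. -/
def spinDiff {n : ℕ} (v : Fin n) (f : Config n → ℝ) (x : Config n) : ℝ :=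
  f (Function.update x v 1) - f (Function.update x v (-1))

/-- The field acting on the spin `v` in the configuration `x`. -/
def IsingParams.localField {n : ℕ} (θ : IsingParams n) (v : Fin n) (x : Config n) : ℝ :=
  θ.field v + ∑ u, pairMatrix (fun e => θ.coupling e.1.1 e.1.2) v u * spin x u

theorem sum_pairMatrix_spin_update {n : ℕ} (c : Pair n → ℝ) (v : Fin n) (x : Config n) (s : ℤˣ) :
    ∑ u, pairMatrix c v u * spin (Function.update x v s) u = ∑ u, pairMatrix c v u * spin x u := by
  refine Finset.sum_congr rfl fun u _ => ?_
  by_cases h : u = v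
  · subst h; simp [pairMatrix_self]
  · rw [spin_update_of_ne x h]

theorem IsingParams.localField_update {n : ℕ} (θ : IsingParams n) (v : Fin n) (x : Config n)
    (s : ℤˣ) : θ.localField v (Function.update x v s) = θ.localField v x := by
  rw [IsingParams.localField, sum_pairMatrix_spin_update, IsingParams.localField]

theorem IsingParams.spinDiff_exponent {n : ℕ} (θ : IsingParams n) (v : Fin n) (x : Config n) :
    spinDiff v θ.exponent x = 2 * θ.localField v x := by
  have h := sum_pair_update (fun e => θ.coupling e.1.1 e.1.2)
    (spin (Function.update x v (-1))) (spin (Function.update x v 1)) v 2 (spin_update_one x v)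
  rw [sum_pairMatrix_spin_update] at h
  have h' : ∑ u, θ.field u * spin (Function.update x v 1) u =
      ∑ u, θ.field u * spin (Function.update x v (-1)) u + 2 * θ.field v := by
    simp_rw [spin_update_one, mul_add, Finset.sum_add_distrib]
    simp [mul_comm]
  simp only [spinDiff, IsingParams.exponent, IsingParams.localField]
  linarith

theorem IsingParams.localField_update_sub {n : ℕ} (θ : IsingParams n) {u v : Fin n} (h : u ≠ v)
    (x : Config n) : θ.localField v (Function.update x u 1) -
      θ.localField v (Function.update x u (-1)) = 2 * θ.coupling u v := by
  have h1 : pairMatrix (fun e => θ.coupling e.1.1 e.1.2) v u = θ.coupling u v := by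
    rcases lt_or_gt_of_ne h with h | h
    · simp [pairMatrix, h, h.not_gt]
    · simp [pairMatrix, h, θ.symm u v]
  simp only [IsingParams.localField]
  simp_rw [spin_update_one, mul_add, Finset.sum_add_distrib]
  simp [h1]; ring

/-- With a = h + d and b = h - d the difference is sinh(2d) / (cosh(h + d) cosh(h - d)). The
denominator equals cosh² h + sinh² d, hence is least at h = 0. Thus the external field can only
weaken the influence of one spin on another. -/
theorem tanh_sub_tanh_le (a b : ℝ) : |Real.tanh a - Real.tanh b| ≤ 2 * Real.tanh (|a - b| / 2) := by
  wlog hab : b ≤ a generalizing a b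
  · rw [abs_sub_comm, abs_sub_comm a]; exact this b a (by linarith)
  obtain ⟨h, d, rfl, rfl⟩ : ∃ h d, a = h + d ∧ b = h - d :=
    ⟨(a + b) / 2, (a - b) / 2, by ring, by ring⟩
  have hd : 0 ≤ d := by linarith
  have e1 : |h + d - (h - d)| / 2 = d := by
    rw [abs_of_nonneg (by linarith)]; ring
  have hc1 := Real.cosh_pos (h + d)
  have hc2 := Real.cosh_pos (h - d)
  have hcd := Real.cosh_pos d
  have hsd : 0 ≤ Real.sinh d := Real.sinh_nonneg_iff.2 hd
  have e2 : Real.tanh (h + d) - Real.tanh (h - d) =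
      2 * Real.sinh d * Real.cosh d / (Real.cosh (h + d) * Real.cosh (h - d)) := by
    rw [Real.tanh_eq_sinh_div_cosh, Real.tanh_eq_sinh_div_cosh]
    field_simp
    rw [Real.sinh_add, Real.sinh_sub, Real.cosh_add, Real.cosh_sub]
    linear_combination (2 * Real.sinh d * Real.cosh d) * Real.cosh_sq h
  have e3 : Real.cosh d ^ 2 ≤ Real.cosh (h + d) * Real.cosh (h - d) := by
    rw [Real.cosh_add, Real.cosh_sub]
    nlinarith [Real.cosh_sq h, Real.cosh_sq d, sq_nonneg (Real.sinh h), sq_nonneg (Real.sinh d)]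
  rw [e1, e2, abs_of_nonneg (by positivity), Real.tanh_eq_sinh_div_cosh, div_le_iff₀ (by positivity)]
  calc 2 * Real.sinh d * Real.cosh d = 2 * (Real.sinh d / Real.cosh d) * Real.cosh d ^ 2 := by
        field_simp
    _ ≤ _ := by gcongr

/-! ### Glauber dynamics -/

theorem update_cases {n : ℕ} (x : Config n) (v : Fin n) :
    x = Function.update x v 1 ∨ x = Function.update x v (-1) := by
  rcases Int.units_eq_one_or (x v) with h | h
  · left; rw [← h, Function.update_eq_self]
  · right; rw [← h, Function.update_eq_self]

theorem two_mul_sum_config {n : ℕ} (v : Fin n) (φ : Config n → ℝ) :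
    2 * ∑ x, φ x = ∑ x : Config n, (φ (Function.update x v 1) + φ (Function.update x v (-1))) := by
  have h1 : ∑ x : Config n, φ (Function.update x v (-x v)) = ∑ x, φ x := by
    have hi : Function.Involutive fun x : Config n => Function.update x v (-x v) := by
      intro x; simp
    exact Equiv.sum_comp hi.toPerm φ
  rw [two_mul]
  nth_rewrite 2 [← h1]
  rw [← Finset.sum_add_distrib]
  refine Finset.sum_congr rfl fun x _ => ?_
  rcases Int.units_eq_one_or (x v) with h | h
  · rw [h]; nth_rewrite 1 [← Function.update_eq_self v x]; rw [h]
  · rw [h, neg_neg, add_comm]; nth_rewrite 2 [← Function.update_eq_self v x]; rw [h]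

/-- Expectation of `f` after a resampling of the spin `v` given all other spins. -/
def IsingParams.resample {n : ℕ} (θ : IsingParams n) (v : Fin n) (f : Config n → ℝ)
    (x : Config n) : ℝ :=
  (f (Function.update x v 1) + f (Function.update x v (-1)) +
    Real.tanh (θ.localField v x) * spinDiff v f x) / 2

/-- One step of the Glauber dynamics with a uniformly random site. -/
def IsingParams.glauber {n : ℕ} (θ : IsingParams n) (f : Config n → ℝ) (x : Config n) : ℝ :=
  (∑ v, θ.resample v f x) / n

theorem IsingParams.integral_law {n : ℕ} (θ : IsingParams n) (f : Config n → ℝ) :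
    ∫ x, f x ∂θ.law = (∑ x, Real.exp (θ.exponent x) * f x) / ∑ y, Real.exp (θ.exponent y) := by
  rw [integral_fintype (Integrable.of_finite), Finset.sum_div]
  refine Finset.sum_congr rfl fun x _ => ?_
  rw [Measure.real, θ.law_singleton, ENNReal.toReal_ofReal (by positivity), smul_eq_mul]
  ring

theorem IsingParams.sum_exp_pos {n : ℕ} (θ : IsingParams n) :
    0 < ∑ y, Real.exp (θ.exponent y) :=
  Finset.sum_pos (fun _ _ => Real.exp_pos _) Finset.univ_nonempty

/-- Given the other spins, the spin v has mean tanh of its local field. This is the reversibility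
that makes `resample` self-adjoint. -/
theorem IsingParams.detailed_balance {n : ℕ} (θ : IsingParams n) (v : Fin n) (x : Config n) :
    Real.exp (θ.exponent (Function.update x v 1)) * (1 - Real.tanh (θ.localField v x)) =
      Real.exp (θ.exponent (Function.update x v (-1))) * (1 + Real.tanh (θ.localField v x)) := by
  have h : θ.exponent (Function.update x v 1) =
      θ.exponent (Function.update x v (-1)) + θ.localField v x + θ.localField v x := by
    have := θ.spinDiff_exponent v x
    simp only [spinDiff] at this
    linarith
  set h' := θ.localField v x
  have hc := Real.cosh_pos h'
  rw [h, Real.exp_add, Real.exp_add, Real.tanh_eq_sinh_div_cosh]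
  have e1 : 1 - Real.sinh h' / Real.cosh h' = Real.exp (-h') / Real.cosh h' := by
    rw [← Real.cosh_sub_sinh]; field_simp
  have e2 : 1 + Real.sinh h' / Real.cosh h' = Real.exp h' / Real.cosh h' := by
    rw [← Real.cosh_add_sinh]; field_simp
  rw [e1, e2]
  have : Real.exp h' * Real.exp (-h') = 1 := by rw [← Real.exp_add]; simp
  field_simp
  linear_combination this

theorem abs_tanh_le_one (a : ℝ) : |Real.tanh a| ≤ 1 := (Real.abs_tanh_lt_one a).le

theorem IsingParams.resample_update {n : ℕ} (θ : IsingParams n) (v : Fin n) (f : Config n → ℝ)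
    (x : Config n) (s : ℤˣ) : θ.resample v f (Function.update x v s) = θ.resample v f x := by
  simp [IsingParams.resample, spinDiff, θ.localField_update]

theorem IsingParams.integral_mul_resample {n : ℕ} (θ : IsingParams n) (v : Fin n)
    (f g : Config n → ℝ) :
    ∫ x, g x * θ.resample v f x ∂θ.law = ∫ x, f x * θ.resample v g x ∂θ.law := by
  rw [θ.integral_law, θ.integral_law]
  congr 1
  have key := fun φ : Config n → ℝ => two_mul_sum_config v φ
  have : (2 : ℝ) ≠ 0 := two_ne_zero
  apply mul_left_cancel₀ this
  rw [key, key]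
  refine Finset.sum_congr rfl fun x _ => ?_
  simp only [θ.resample_update]
  have hb := θ.detailed_balance v x
  simp only [IsingParams.resample, spinDiff]
  linear_combination ((g (Function.update x v 1) * f (Function.update x v (-1)) -
    f (Function.update x v 1) * g (Function.update x v (-1))) / 2) * hb

theorem IsingParams.integral_mul_sub_resample_le {n : ℕ} (θ : IsingParams n) (v : Fin n)
    (f : Config n → ℝ) :
    ∫ x, f x * (f x - θ.resample v f x) ∂θ.law ≤ ∫ x, spinDiff v f x ^ 2 ∂θ.law := by
  rw [θ.integral_law, θ.integral_law]
  have := θ.sum_exp_pos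
  gcongr ?_ / _
  have key := fun φ : Config n → ℝ => two_mul_sum_config v φ
  refine le_of_mul_le_mul_left ?_ (two_pos (α := ℝ))
  rw [key, key]
  refine Finset.sum_le_sum fun x _ => ?_
  simp only [θ.resample_update]
  have hb := θ.detailed_balance v x
  have h1 := (abs_le.1 (abs_tanh_le_one (θ.localField v x)))
  have hs : ∀ s, spinDiff v f (Function.update x v s) = spinDiff v f x := by simp [spinDiff]
  rw [hs, hs]
  simp only [IsingParams.resample]
  have e : spinDiff v f x = f (Function.update x v 1) - f (Function.update x v (-1)) := rfl
  have p1 := Real.exp_pos (θ.exponent (Function.update x v 1))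
  have p2 := Real.exp_pos (θ.exponent (Function.update x v (-1)))
  rw [e]
  set t := Real.tanh (θ.localField v x)
  set a := f (Function.update x v 1)
  set b := f (Function.update x v (-1))
  set p := Real.exp (θ.exponent (Function.update x v 1))
  set q := Real.exp (θ.exponent (Function.update x v (-1)))
  -- Detailed balance collapses the contribution of two configurations that differ at v to a single
  -- square; its weight p (1 - t) / 2 is at most p + q.
  have : p * (a * (a - (a + b + t * (a - b)) / 2)) + q * (b * (b - (a + b + t * (a - b)) / 2)) =
      p * (1 - t) / 2 * (a - b) ^ 2 := by
    linear_combination (b * (a - b) / 2) * hb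
  rw [this, ← add_mul]
  gcongr
  nlinarith [h1.1]

/-- All differences of `f` are bounded by `D`. -/
def OscLE {n : ℕ} (f : Config n → ℝ) (D : ℝ) : Prop := ∀ v x, |spinDiff v f x| ≤ D

theorem OscLE.abs_sub_le {n : ℕ} {f : Config n → ℝ} {D : ℝ} (hf : OscLE f D) (x y : Config n) :
    |f x - f y| ≤ n * D := by
  have hone : ∀ (x : Config n) v s, |f x - f (Function.update x v s)| ≤ D := by
    intro x v s
    have h := hf v x
    have hD : 0 ≤ D := (abs_nonneg _).trans h
    unfold spinDiff at h
    rcases update_cases x v with hx | hx <;> rcases Int.units_eq_one_or s with rfl | rfl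
    · rw [← hx]; simpa using hD
    · nth_rewrite 1 [hx]; exact h
    · nth_rewrite 1 [hx]; rw [abs_sub_comm]; exact h
    · rw [← hx]; simpa using hD
  have main : ∀ (s : Finset (Fin n)) (x : Config n), (∀ i, i ∉ s → x i = y i) →
      |f x - f y| ≤ s.card * D := by
    intro s
    induction s using Finset.induction_on with
    | empty =>
      intro x hx
      have : x = y := funext fun i => hx i (by simp)
      simp [this]
    | insert a s ha ih =>
      intro x hx
      have h1 := ih (Function.update x a (y a)) (by
        intro i hi
        by_cases h : i = a
        · subst h; simp
        · rw [Function.update_of_ne h]; exact hx i (by simp [h, hi]))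
      have h2 := hone x a (y a)
      rw [Finset.card_insert_of_notMem ha]
      push_cast
      calc |f x - f y| ≤ |f x - f (Function.update x a (y a))| +
            |f (Function.update x a (y a)) - f y| := _root_.abs_sub_le _ _ _
        _ ≤ _ := by linarith
  simpa using main Finset.univ x (by simp)

theorem OscLE.abs_sub_resample_le {n : ℕ} {θ : IsingParams n} {f : Config n → ℝ} {D : ℝ}
    (hf : OscLE f D) (v : Fin n) (x : Config n) : |f x - θ.resample v f x| ≤ D := by
  have h := hf v x
  have hD : 0 ≤ D := (abs_nonneg _).trans h
  have ht := abs_le.1 (abs_tanh_le_one (θ.localField v x))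
  rcases update_cases x v with hx | hx
  · have : f x - θ.resample v f x = (1 - Real.tanh (θ.localField v x)) / 2 * spinDiff v f x := by
      nth_rewrite 1 [hx]; simp only [IsingParams.resample, spinDiff]; ring
    rw [this, abs_mul, abs_of_nonneg (by linarith)]
    calc _ ≤ 1 * D := by gcongr; linarith
      _ = D := one_mul D
  · have : f x - θ.resample v f x = -((1 + Real.tanh (θ.localField v x)) / 2 * spinDiff v f x) := by
      nth_rewrite 1 [hx]; simp only [IsingParams.resample, spinDiff]; ring
    rw [this, abs_neg, abs_mul, abs_of_nonneg (by linarith)]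
    calc _ ≤ 1 * D := by gcongr; linarith
      _ = D := one_mul D

/-- Flipping u acts on the resampled function in two ways: through f itself, a convex combination of
differences and so at most D, and through the law of the new spin v, which moves by at most tanh
|θ_uv| and is weighted by a difference of f in the direction v. -/
theorem OscLE.spinDiff_resample_le {n : ℕ} {θ : IsingParams n} {f : Config n → ℝ} {D : ℝ}
    (hf : OscLE f D) {u v : Fin n} (huv : u ≠ v) (x : Config n) :
    |spinDiff u (θ.resample v f) x| ≤ D * (1 + Real.tanh |θ.coupling u v|) := by
  have hD : 0 ≤ D := (abs_nonneg _).trans (hf v x)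
  have ht1 := abs_le.1 (abs_tanh_le_one (θ.localField v (Function.update x u 1)))
  have htt : |Real.tanh (θ.localField v (Function.update x u 1)) -
      Real.tanh (θ.localField v (Function.update x u (-1)))| ≤
      2 * Real.tanh |θ.coupling u v| := by
    refine (tanh_sub_tanh_le _ _).trans_eq ?_
    rw [θ.localField_update_sub huv, abs_mul]
    norm_num
  have hp := hf u (Function.update x v 1)
  have hm := hf u (Function.update x v (-1))
  have hv := hf v (Function.update x u (-1))
  simp only [IsingParams.resample, spinDiff] at hp hm hv ⊢
  rw [Function.update_comm huv.symm, Function.update_comm huv.symm] at hp hm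
  set t := Real.tanh (θ.localField v (Function.update x u 1))
  set t' := Real.tanh (θ.localField v (Function.update x u (-1)))
  set a := f (Function.update (Function.update x u 1) v 1)
  set b := f (Function.update (Function.update x u 1) v (-1))
  set a' := f (Function.update (Function.update x u (-1)) v 1)
  set b' := f (Function.update (Function.update x u (-1)) v (-1))
  have ht0 : 0 ≤ Real.tanh |θ.coupling u v| := by linarith [abs_nonneg (t - t')]
  have e : (a + b + t * (a - b)) / 2 - (a' + b' + t' * (a' - b')) / 2 =
      (1 + t) / 2 * (a - a') + (1 - t) / 2 * (b - b') + (t - t') / 2 * (a' - b') := by ring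
  rw [e]
  have k1 : |(1 + t) / 2 * (a - a')| ≤ (1 + t) / 2 * D := by
    rw [abs_mul, abs_of_nonneg (by linarith)]; gcongr; linarith
  have k2 : |(1 - t) / 2 * (b - b')| ≤ (1 - t) / 2 * D := by
    rw [abs_mul, abs_of_nonneg (by linarith)]; gcongr; linarith
  have k3 : |(t - t') / 2 * (a' - b')| ≤ Real.tanh |θ.coupling u v| * D := by
    rw [abs_mul, abs_div, abs_two]; gcongr; linarith
  calc _ ≤ (1 + t) / 2 * D + (1 - t) / 2 * D + Real.tanh |θ.coupling u v| * D :=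
        (abs_add_le _ _).trans (add_le_add ((abs_add_le _ _).trans (add_le_add k1 k2)) k3)
    _ = _ := by ring

theorem OscLE.glauber {n : ℕ} {θ : IsingParams n} {η : ℝ} (hθ : θ.HighTemperature η)
    {f : Config n → ℝ} {D : ℝ} (hf : OscLE f D) : OscLE (θ.glauber f) ((1 - η / n) * D) := by
  intro u x
  have hn : 0 < (n : ℝ) := by exact_mod_cast u.pos
  have hD : 0 ≤ D := (abs_nonneg _).trans (hf u x)
  have e : spinDiff u (θ.glauber f) x = (∑ v, spinDiff u (θ.resample v f) x) / n := by
    simp only [spinDiff, IsingParams.glauber, Finset.sum_sub_distrib, sub_div]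
  rw [e, abs_div, abs_of_pos hn, div_le_iff₀ hn]
  -- Resampling u erases the dependence on u. The other n - 1 sites contribute D (1 + tanh |θ_uv|)
  -- each, so the total is at most D (n - 1 + 1 - η).
  have hself : spinDiff u (θ.resample u f) x = 0 := by simp [spinDiff, θ.resample_update]
  have hsplit := Finset.add_sum_erase Finset.univ (fun v => spinDiff u (θ.resample v f) x)
    (Finset.mem_univ u)
  rw [hself, zero_add] at hsplit
  rw [← hsplit]
  calc |∑ v ∈ Finset.univ.erase u, spinDiff u (θ.resample v f) x|
      ≤ ∑ v ∈ Finset.univ.erase u, |spinDiff u (θ.resample v f) x| := Finset.abs_sum_le_sum_abs _ _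
    _ ≤ ∑ v ∈ Finset.univ.erase u, D * (1 + Real.tanh |θ.coupling v u|) := by
        refine Finset.sum_le_sum fun v hv => ?_
        rw [θ.symm v u]
        exact hf.spinDiff_resample_le (Finset.ne_of_mem_erase hv).symm x
    _ = D * ((n - 1) + ∑ v ∈ Finset.univ.erase u, Real.tanh |θ.coupling v u|) := by
        rw [← Finset.mul_sum, Finset.sum_add_distrib]
        simp [Nat.cast_pred u.pos]
    _ ≤ D * ((n - 1) + (1 - η)) := by gcongr; exact hθ u
    _ = _ := by field_simp; ring

/-! ### The Poincaré inequality in the high-temperature regime -/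

/-- This replaces the spectral theorem. Log-convexity makes the ratios of consecutive terms
nondecreasing, so the first ratio is a lower bound for the exponential growth rate, and that rate is
at most r whatever the constant K. -/
theorem first_le_of_logConvex {b : ℕ → ℝ} {K r : ℝ} (h0 : ∀ k, 0 ≤ b k)
    (hb : ∀ k, b (k + 1) ^ 2 ≤ b k * b (k + 2)) (hr : 0 ≤ r) (hK : ∀ k, b k ≤ K * r ^ k) :
    b 1 ≤ r * b 0 := by
  by_contra! hlt
  have hb1 : 0 < b 1 := lt_of_le_of_lt (mul_nonneg hr (h0 0)) hlt
  have hb0 : 0 < b 0 := by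
    refine (h0 0).lt_of_ne' fun h => ?_
    have := hb 0
    rw [h, zero_mul] at this
    nlinarith
  have hrpos : 0 < r := by
    refine hr.lt_of_ne' fun h => ?_
    have := hK 1
    rw [h] at this
    simp at this
    linarith
  have key : ∀ k, 0 < b k ∧ b 1 / b 0 * b k ≤ b (k + 1) := by
    intro k
    induction k with
    | zero => exact ⟨hb0, by rw [div_mul_cancel₀ _ hb0.ne']⟩
    | succ k ih =>
      obtain ⟨h1, h2⟩ := ih
      have hq : 0 < b 1 / b 0 := by positivity
      have h3 : 0 < b (k + 1) := lt_of_lt_of_le (by positivity) h2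
      refine ⟨h3, le_of_mul_le_mul_left ?_ h1⟩
      calc b k * (b 1 / b 0 * b (k + 1)) = (b 1 / b 0 * b k) * b (k + 1) := by ring
        _ ≤ b (k + 1) * b (k + 1) := by gcongr
        _ ≤ _ := by rw [← sq]; exact hb k
  have hge : ∀ k, (b 1 / b 0) ^ k * b 0 ≤ b k := by
    intro k
    induction k with
    | zero => simp
    | succ k ih =>
      have hq : 0 < b 1 / b 0 := by positivity
      calc (b 1 / b 0) ^ (k + 1) * b 0 = b 1 / b 0 * ((b 1 / b 0) ^ k * b 0) := by ring
        _ ≤ b 1 / b 0 * b k := by gcongr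
        _ ≤ _ := (key k).2
  have hq : 1 < b 1 / b 0 / r := by
    rw [lt_div_iff₀ hrpos, one_mul, lt_div_iff₀ hb0]; exact hlt
  obtain ⟨k, hk⟩ := pow_unbounded_of_one_lt (K / b 0) hq
  have := (hge k).trans (hK k)
  rw [div_pow, div_lt_div_iff₀ hb0 (by positivity)] at hk
  linarith

theorem exists_oscLE {n : ℕ} (f : Config n → ℝ) : ∃ D, 0 ≤ D ∧ OscLE f D := by
  refine ⟨∑ v, ∑ x, |spinDiff v f x|, by positivity, fun v x => ?_⟩
  exact (Finset.single_le_sum (f := fun x => |spinDiff v f x|) (fun _ _ => abs_nonneg _)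
    (Finset.mem_univ x)).trans (Finset.single_le_sum (f := fun v => ∑ x, |spinDiff v f x|)
      (fun _ _ => by positivity) (Finset.mem_univ v))

theorem IsingParams.integral_mul_glauber_comm {n : ℕ} (θ : IsingParams n) (f g : Config n → ℝ) :
    ∫ x, g x * θ.glauber f x ∂θ.law = ∫ x, f x * θ.glauber g x ∂θ.law := by
  simp only [IsingParams.glauber, mul_div_assoc', Finset.mul_sum]
  rw [integral_div, integral_div, integral_finsetSum _ fun _ _ => .of_finite,
    integral_finsetSum _ fun _ _ => .of_finite]
  simp_rw [θ.integral_mul_resample]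

theorem IsingParams.integral_glauber {n : ℕ} (hn : 0 < n) (θ : IsingParams n) (f : Config n → ℝ) :
    ∫ x, θ.glauber f x ∂θ.law = ∫ x, f x ∂θ.law := by
  have h := θ.integral_mul_glauber_comm f fun _ => 1
  have h1 : θ.glauber (fun _ => 1) = fun _ => 1 := by
    funext x
    have : (n : ℝ) ≠ 0 := by exact_mod_cast hn.ne'
    simp [IsingParams.glauber, IsingParams.resample, spinDiff, this]
  simpa [h1] using h

theorem OscLE.abs_le_of_integral_eq_zero {n : ℕ} {θ : IsingParams n} {f : Config n → ℝ} {D : ℝ}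
    (hf : OscLE f D) (h0 : ∫ x, f x ∂θ.law = 0) (x : Config n) : |f x| ≤ n * D := by
  have h : f x = ∫ y, (f x - f y) ∂θ.law := by
    rw [integral_sub .of_finite .of_finite, h0]; simp
  rw [h]
  have := norm_integral_le_of_norm_le_const (μ := θ.law) (f := fun y => f x - f y) (C := n * D)
    (.of_forall fun y => hf.abs_sub_le x y)
  simpa using this

theorem OscLE.glauber_iterate {n : ℕ} {θ : IsingParams n} {η : ℝ} (hθ : θ.HighTemperature η)
    {f : Config n → ℝ} {D : ℝ} (hf : OscLE f D) (k : ℕ) :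
    OscLE (θ.glauber^[k] f) ((1 - η / n) ^ k * D) := by
  induction k with
  | zero => simpa using hf
  | succ k ih =>
    rw [Function.iterate_succ_apply', pow_succ', mul_assoc]
    exact ih.glauber hθ

theorem integral_mul_sq_le {α : Type*} [MeasurableSpace α] [MeasurableSingletonClass α] [Finite α]
    (μ : Measure α) [IsFiniteMeasure μ] (f g : α → ℝ) :
    (∫ x, f x * g x ∂μ) ^ 2 ≤ (∫ x, f x ^ 2 ∂μ) * ∫ x, g x ^ 2 ∂μ := by
  have h : ∀ t : ℝ, 0 ≤ (∫ x, g x ^ 2 ∂μ) * (t * t) + (2 * ∫ x, f x * g x ∂μ) * t +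
      ∫ x, f x ^ 2 ∂μ := by
    intro t
    have : 0 ≤ ∫ x, (g x * t + f x) ^ 2 ∂μ := integral_nonneg fun _ => sq_nonneg _
    have e : ∀ x, (g x * t + f x) ^ 2 = g x ^ 2 * (t * t) + f x * g x * (2 * t) + f x ^ 2 :=
      fun x => by ring
    simp_rw [e] at this
    rw [integral_add .of_finite .of_finite, integral_add .of_finite .of_finite,
      integral_mul_const, integral_mul_const] at this
    linarith
  have := discrim_le_zero h
  rw [discrim] at this
  linarith

/-- The squared norms of the Glauber iterates of f are log-convex by self-adjointness and
Cauchy–Schwarz. The contraction of oscillations gives their decay rate with a poor constant, which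
log-convexity then removes. -/
theorem IsingParams.integral_glauber_sq_le {n : ℕ} (hn : 0 < n) {θ : IsingParams n} {η : ℝ}
    (hθ : θ.HighTemperature η) (f : Config n → ℝ) (h0 : ∫ x, f x ∂θ.law = 0) :
    ∫ x, θ.glauber f x ^ 2 ∂θ.law ≤ (1 - η / n) ^ 2 * ∫ x, f x ^ 2 ∂θ.law := by
  obtain ⟨D, hD, hf⟩ := exists_oscLE f
  have hzero : ∀ k, ∫ x, θ.glauber^[k] f x ∂θ.law = 0 := by
    intro k
    induction k with
    | zero => simpa using h0
    | succ k ih => simp_rw [Function.iterate_succ_apply', θ.integral_glauber hn]; exact ih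
  refine first_le_of_logConvex (b := fun k => ∫ x, θ.glauber^[k] f x ^ 2 ∂θ.law)
    (K := (n * D) ^ 2) (fun k => integral_nonneg fun _ => sq_nonneg _) ?_ (sq_nonneg _) ?_
  · intro k
    have e : ∫ x, θ.glauber^[k + 1] f x ^ 2 ∂θ.law =
        ∫ x, θ.glauber^[k] f x * θ.glauber^[k + 2] f x ∂θ.law := by
      simp_rw [sq]
      rw [Function.iterate_succ_apply' θ.glauber (k + 1), Function.iterate_succ_apply' θ.glauber k,
        θ.integral_mul_glauber_comm (θ.glauber (θ.glauber^[k] f))]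
    simp only [e]
    exact integral_mul_sq_le _ _ _
  · intro k
    have hk := hf.glauber_iterate hθ k
    have hb := fun x => hk.abs_le_of_integral_eq_zero (hzero k) x
    calc ∫ x, θ.glauber^[k] f x ^ 2 ∂θ.law ≤ ∫ _, (n * ((1 - η / n) ^ k * D)) ^ 2 ∂θ.law := by
          refine integral_mono .of_finite .of_finite fun x => ?_
          exact sq_le_sq' (by linarith [(abs_le.1 (hb x)).1]) (abs_le.1 (hb x)).2
      _ = _ := by rw [← pow_mul, mul_comm 2 k, pow_mul]; simp; ring

theorem one_sub_div_nonneg {n : ℕ} (hn : 0 < n) {η : ℝ} (hη : η ≤ 1) : 0 ≤ 1 - η / n := by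
  have : (1 : ℝ) ≤ n := by exact_mod_cast hn
  rw [sub_nonneg, div_le_one (by linarith)]
  linarith

theorem IsingParams.integral_mul_glauber_le {n : ℕ} (hn : 0 < n) {θ : IsingParams n} {η : ℝ}
    (hη : η ≤ 1) (hθ : θ.HighTemperature η) (f : Config n → ℝ) (h0 : ∫ x, f x ∂θ.law = 0) :
    ∫ x, f x * θ.glauber f x ∂θ.law ≤ (1 - η / n) * ∫ x, f x ^ 2 ∂θ.law := by
  have h1 := θ.integral_glauber_sq_le hn hθ f h0
  have h2 := integral_mul_sq_le θ.law f (θ.glauber f)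
  have hf : 0 ≤ ∫ x, f x ^ 2 ∂θ.law := integral_nonneg fun _ => sq_nonneg _
  have hρ := one_sub_div_nonneg hn hη
  refine abs_le_of_sq_le_sq' ?_ (by positivity) |>.2
  calc _ ≤ _ := h2
    _ ≤ (∫ x, f x ^ 2 ∂θ.law) * ((1 - η / n) ^ 2 * ∫ x, f x ^ 2 ∂θ.law) := by gcongr
    _ = _ := by ring

/-- The Poincaré inequality. -/
theorem IsingParams.variance_le {n : ℕ} {θ : IsingParams n} {η : ℝ} (hη0 : 0 < η)
    (hη : η ≤ 1) (hθ : θ.HighTemperature η) (f : Config n → ℝ) :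
    variance f θ.law ≤ (∑ v, ∫ x, spinDiff v f x ^ 2 ∂θ.law) / η := by
  rcases Nat.eq_zero_or_pos n with rfl | hn
  · have : f = fun _ => f 1 := by funext x; rw [Subsingleton.elim x 1]
    rw [this, variance_eq_integral (by fun_prop)]
    simp
  rw [variance_eq_integral (measurable_of_finite f).aemeasurable]
  set g : Config n → ℝ := fun x => f x - ∫ y, f y ∂θ.law with hg
  have hd : ∀ v, spinDiff v f = spinDiff v g := by intro v; funext x; simp [spinDiff, hg]
  have h0 : ∫ x, g x ∂θ.law = 0 := by
    rw [hg, integral_sub .of_finite .of_finite]; simp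
  have hgap := θ.integral_mul_glauber_le hn hη hθ g h0
  have hn' : (0 : ℝ) < n := by exact_mod_cast hn
  -- The sum of the single-site Dirichlet forms is n times that of the averaged chain, whose gap η/n
  -- thus becomes η.
  have hsum : ∑ v, ∫ x, g x * (g x - θ.resample v g x) ∂θ.law =
      n * (∫ x, g x ^ 2 ∂θ.law - ∫ x, g x * θ.glauber g x ∂θ.law) := by
    rw [← integral_sub .of_finite .of_finite, ← integral_const_mul,
      ← integral_finsetSum _ fun _ _ => .of_finite]
    congr 1
    funext x
    rw [← Finset.mul_sum, Finset.sum_sub_distrib, IsingParams.glauber]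
    simp
    field_simp
  have hle : ∑ v, ∫ x, g x * (g x - θ.resample v g x) ∂θ.law ≤
      ∑ v, ∫ x, spinDiff v g x ^ 2 ∂θ.law :=
    Finset.sum_le_sum fun v _ => θ.integral_mul_sub_resample_le v g
  simp_rw [hd]
  rw [le_div_iff₀ hη0]
  refine le_trans ?_ hle
  rw [hsum]
  have e : (n : ℝ) * ((1 - η / n) * ∫ x, g x ^ 2 ∂θ.law) =
      (n - η) * ∫ x, g x ^ 2 ∂θ.law := by field_simp
  nlinarith [mul_le_mul_of_nonneg_left hgap hn'.le]

/-! ### Summability of correlations -/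

/-- Telescope f along the Glauber iterates. In f minus its Glauber average only the resampling at u
correlates with the spin u, so a step costs at most 1/n times the current oscillation; the geometric
series of these costs sums to D/η. -/
theorem OscLE.abs_integral_mul_spin_le {n : ℕ} {θ : IsingParams n} {η : ℝ} (hη0 : 0 < η)
    (hη : η ≤ 1) (hθ : θ.HighTemperature η) {f : Config n → ℝ} {D : ℝ} (hD : 0 ≤ D)
    (hf : OscLE f D) (h0 : ∫ x, f x ∂θ.law = 0) (u : Fin n) :
    |∫ x, f x * spin x u ∂θ.law| ≤ D / η := by
  have hn := u.pos
  have hn' : (0 : ℝ) < n := by exact_mod_cast hn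
  have hρ := one_sub_div_nonneg hn hη
  have step : ∀ (f : Config n → ℝ) (D : ℝ), OscLE f D →
      |∫ x, f x * spin x u ∂θ.law - ∫ x, θ.glauber f x * spin x u ∂θ.law| ≤ D / n := by
    intro f D hf
    have hz : ∀ v, v ≠ u → ∫ x, (f x - θ.resample v f x) * spin x u ∂θ.law = 0 := by
      intro v hv
      have h1 : θ.resample v (fun x => spin x u) = fun x => spin x u := by
        funext x
        simp only [IsingParams.resample, spinDiff]
        rw [spin_update_of_ne x hv.symm, spin_update_of_ne x hv.symm]; ring
      have h2 := θ.integral_mul_resample v f fun x => spin x u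
      rw [h1] at h2
      simp_rw [sub_mul]
      rw [integral_sub .of_finite .of_finite, sub_eq_zero, ← h2]
      simp_rw [mul_comm]
    have e : ∫ x, f x * spin x u ∂θ.law - ∫ x, θ.glauber f x * spin x u ∂θ.law =
        (∑ v, ∫ x, (f x - θ.resample v f x) * spin x u ∂θ.law) / n := by
      rw [← integral_sub .of_finite .of_finite, ← integral_finsetSum _ fun _ _ => .of_finite,
        ← integral_div]
      congr 1
      funext x
      rw [← Finset.sum_mul, Finset.sum_sub_distrib, IsingParams.glauber]
      simp
      field_simp
    rw [e, Finset.sum_eq_single u (fun v _ hv => hz v hv) (by simp), abs_div, abs_of_pos hn']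
    gcongr
    have := norm_integral_le_of_norm_le_const (μ := θ.law)
      (f := fun x => (f x - θ.resample u f x) * spin x u) (C := D)
      (.of_forall fun x => by
        rw [Real.norm_eq_abs, abs_mul, abs_spin, mul_one]; exact hf.abs_sub_resample_le u x)
    simpa using this
  have main : ∀ (k : ℕ) (f : Config n → ℝ) (D : ℝ), 0 ≤ D → OscLE f D → ∫ x, f x ∂θ.law = 0 →
      |∫ x, f x * spin x u ∂θ.law| ≤ D / η + (1 - η / n) ^ k * (n * D) := by
    intro k
    induction k with
    | zero =>
      intro f D hD hf h0
      have := norm_integral_le_of_norm_le_const (μ := θ.law) (f := fun x => f x * spin x u)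
        (C := n * D) (.of_forall fun x => by
          rw [Real.norm_eq_abs, abs_mul, abs_spin, mul_one]
          exact hf.abs_le_of_integral_eq_zero h0 x)
      simp at this
      have : 0 ≤ D / η := by positivity
      simp
      linarith
    | succ k ih =>
      intro f D hD hf h0
      have h1 := ih (θ.glauber f) ((1 - η / n) * D) (by positivity) (hf.glauber hθ)
        (by rw [θ.integral_glauber hn, h0])
      have h2 := step f D hf
      have h3 := abs_sub_abs_le_abs_sub (∫ x, f x * spin x u ∂θ.law)
        (∫ x, θ.glauber f x * spin x u ∂θ.law)
      -- The value D/η is the fixed point of the recursion s = D/n + (1 - η/n) s. The remainder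
      -- vanishes as k → ∞.
      have e : D / n + ((1 - η / n) * D / η + (1 - η / n) ^ k * (n * ((1 - η / n) * D))) =
          D / η + (1 - η / n) ^ (k + 1) * (n * D) := by
        rw [pow_succ]; field_simp; ring
      linarith
  have hlt : 1 - η / n < 1 := by
    have : 0 < η / n := by positivity
    linarith
  have hlim := ((tendsto_pow_atTop_nhds_zero_of_lt_one hρ hlt).mul_const (n * D)).const_add (D / η)
  rw [zero_mul, add_zero] at hlim
  exact ge_of_tendsto' hlim fun k => main k f D hD hf h0

/-- The covariance of the spins `u` and `v`. -/
def spinCov {n : ℕ} (p : Measure (Config n)) (u v : Fin n) : ℝ :=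
  ∫ x, spin x u * spin x v ∂p - (∫ x, spin x u ∂p) * ∫ x, spin x v ∂p

/-- Duality: the sum is the covariance of the spin u with the combination of spins whose
coefficients are the signs of the covariances, and this combination has oscillation at most 2. -/
theorem IsingParams.sum_abs_spinCov_le {n : ℕ} {θ : IsingParams n} {η : ℝ} (hη0 : 0 < η)
    (hη : η ≤ 1) (hθ : θ.HighTemperature η) (u : Fin n) :
    ∑ v, |spinCov θ.law u v| ≤ 2 / η := by
  set s : Fin n → ℝ := fun v => SignType.sign (spinCov θ.law u v)
  set f : Config n → ℝ := fun x => ∑ v, s v * (spin x v - ∫ y, spin y v ∂θ.law)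
  have hs : ∀ v, |s v| ≤ 1 := by
    intro v
    rcases lt_trichotomy (spinCov θ.law u v) 0 with h | h | h <;> simp [s, h]
  have hf : OscLE f 2 := by
    intro v x
    have : spinDiff v f x = 2 * s v := by
      simp only [spinDiff, f]
      rw [← Finset.sum_sub_distrib, Finset.sum_eq_single v]
      · rw [spin_update_one]; simp; ring
      · intro w _ hw; rw [spin_update_one]; simp [hw]
      · simp
    rw [this, abs_mul, abs_two]
    linarith [hs v]
  have h0 : ∫ x, f x ∂θ.law = 0 := by
    simp only [f]
    rw [integral_finsetSum _ fun _ _ => .of_finite]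
    refine Finset.sum_eq_zero fun v _ => ?_
    rw [integral_const_mul, integral_sub .of_finite .of_finite]; simp
  have h := hf.abs_integral_mul_spin_le hη0 hη hθ (by norm_num) h0 u
  refine le_trans (le_of_eq ?_) ((le_abs_self _).trans h)
  simp only [f, Finset.sum_mul]
  rw [integral_finsetSum _ fun _ _ => .of_finite]
  refine Finset.sum_congr rfl fun v _ => ?_
  have : ∀ x : Config n, s v * (spin x v - ∫ y, spin y v ∂θ.law) * spin x u =
      s v * (spin x u * spin x v) - s v * (∫ y, spin y v ∂θ.law) * spin x u := fun x => by ring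
  simp_rw [this]
  rw [integral_sub .of_finite .of_finite, integral_const_mul, integral_const_mul]
  have : |spinCov θ.law u v| = s v * spinCov θ.law u v := (sign_mul_self _).symm
  rw [this, spinCov]
  ring

theorem IsingParams.sum_pair_abs_spinCov_le {n : ℕ} {θ : IsingParams n} {η : ℝ} (hη0 : 0 < η)
    (hη : η ≤ 1) (hθ : θ.HighTemperature η) :
    ∑ e : Pair n, |spinCov θ.law e.1.1 e.1.2| ≤ 2 * n / η := by
  have h1 : ∑ e : Pair n, |spinCov θ.law e.1.1 e.1.2| ≤
      ∑ e : Fin n × Fin n, |spinCov θ.law e.1 e.2| := by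
    rw [← Finset.sum_subtype (p := fun e : Fin n × Fin n => e.1 < e.2)
      (Finset.univ.filter fun e => e.1 < e.2) (by simp)
      (fun e : Fin n × Fin n => |spinCov θ.law e.1 e.2|)]
    exact Finset.sum_le_sum_of_subset_of_nonneg (Finset.filter_subset _ _)
      fun _ _ _ => abs_nonneg _
  refine h1.trans ?_
  rw [Fintype.sum_prod_type]
  calc _ ≤ ∑ _ : Fin n, 2 / η := Finset.sum_le_sum fun u _ => θ.sum_abs_spinCov_le hη0 hη hθ u
    _ = _ := by simp; ring

/-! ### The variance of the two-sample centered statistic -/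

theorem variance_eq_sub_of_finite {α : Type*} [MeasurableSpace α] [MeasurableSingletonClass α]
    [Finite α] (μ : Measure α) [IsProbabilityMeasure μ] (f : α → ℝ) :
    variance f μ = ∫ x, f x ^ 2 ∂μ - (∫ x, f x ∂μ) ^ 2 := by
  have hm : MemLp f 2 μ :=
    (memLp_two_iff_integrable_sq (measurable_of_finite f).aestronglyMeasurable).2 .of_finite
  rw [variance_eq_sub hm]
  rfl

/-- The Efron–Stein inequality for two variables. The variance is the mean of the conditional
variance in x plus the variance of the conditional mean; by Jensen the latter is at most the mean of
the conditional variance in y. -/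
theorem variance_prod_le {α : Type*} [MeasurableSpace α] [MeasurableSingletonClass α]
    [Finite α] (μ : Measure α) [IsProbabilityMeasure μ] (F : α → α → ℝ) :
    variance (fun z : α × α => F z.1 z.2) (μ.prod μ) ≤
      ∫ y, variance (fun x => F x y) μ ∂μ + ∫ x, variance (fun y => F x y) μ ∂μ := by
  simp_rw [variance_eq_sub_of_finite]
  rw [integral_sub .of_finite .of_finite, integral_sub .of_finite .of_finite,
    integral_prod_symm (f := fun z : α × α => F z.1 z.2 ^ 2) .of_finite,
    integral_prod_symm (f := fun z : α × α => F z.1 z.2) .of_finite]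
  set G : α → ℝ := fun y => ∫ x, F x y ∂μ
  set H : α → ℝ := fun x => ∫ y, F x y ∂μ
  have hswap : ∫ y, G y ∂μ = ∫ x, H x ∂μ := integral_integral_swap (.of_finite)
  have hswap2 : ∫ y, ∫ x, F x y ^ 2 ∂μ ∂μ = ∫ x, ∫ y, F x y ^ 2 ∂μ ∂μ :=
    integral_integral_swap (f := fun y x => F x y ^ 2) (.of_finite)
  set m := ∫ y, G y ∂μ
  have h1 : ∫ y, (G y - m) ^ 2 ∂μ ≤ ∫ x, ∫ y, (F x y - H x) ^ 2 ∂μ ∂μ := by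
    rw [← integral_integral_swap (f := fun y x => (F x y - H x) ^ 2) .of_finite]
    refine integral_mono .of_finite .of_finite fun y => ?_
    have h := integral_mul_sq_le μ (fun _ => 1) fun x => F x y - H x
    simp only [one_mul, one_pow, integral_const, probReal_univ, smul_eq_mul] at h
    rwa [integral_sub .of_finite .of_finite, ← hswap] at h
  have e1 : ∫ y, (G y - m) ^ 2 ∂μ = ∫ y, G y ^ 2 ∂μ - m ^ 2 := by
    have : ∀ y, (G y - m) ^ 2 = G y ^ 2 - G y * (2 * m) + m ^ 2 := fun y => by ring
    simp_rw [this]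
    rw [integral_add .of_finite .of_finite, integral_sub .of_finite .of_finite, integral_mul_const]
    simp
    change _ - m * _ + _ = _
    ring
  have e2 : ∀ x, ∫ y, (F x y - H x) ^ 2 ∂μ = ∫ y, F x y ^ 2 ∂μ - H x ^ 2 := by
    intro x
    have : ∀ y, (F x y - H x) ^ 2 = F x y ^ 2 - F x y * (2 * H x) + H x ^ 2 := fun y => by ring
    simp_rw [this]
    rw [integral_add .of_finite .of_finite, integral_sub .of_finite .of_finite, integral_mul_const]
    simp
    change _ - H x * _ + _ = _
    ring
  simp_rw [e2] at h1
  rw [e1, integral_sub .of_finite .of_finite] at h1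
  rw [hswap2]
  linarith

theorem spinDiff_centeredStatistic {n : ℕ} (c : Pair n → ℝ) (u : Fin n) (x y : Config n) :
    spinDiff u (fun x => centeredStatistic c x y) x =
      2 * ∑ v, pairMatrix c u v * (spin x v - spin y v) := by
  simp only [spinDiff, centeredStatistic, centeredProduct]
  rw [sum_pair_update c (fun v => spin (Function.update x u (-1)) v - spin y v)
    (fun v => spin (Function.update x u 1) v - spin y v) u 2
    (fun v => by rw [spin_update_one]; ring)]
  simp only [mul_sub, Finset.sum_sub_distrib, sum_pairMatrix_spin_update]

theorem centeredStatistic_comm {n : ℕ} (c : Pair n → ℝ) (x y : Config n) :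
    centeredStatistic c x y = centeredStatistic c y x := by
  simp only [centeredStatistic, centeredProduct]
  exact Finset.sum_congr rfl fun e _ => by ring

theorem IsingParams.variance_linear_le {n : ℕ} {θ : IsingParams n} {η : ℝ} (hη0 : 0 < η)
    (hη : η ≤ 1) (hθ : θ.HighTemperature η) (c : Fin n → ℝ) (hc : ∀ v, |c v| ≤ 1) :
    variance (fun x => ∑ v, c v * spin x v) θ.law ≤ 4 * n / η := by
  refine (θ.variance_le hη0 hη hθ _).trans ?_
  gcongr
  have hd : ∀ v x, spinDiff v (fun x => ∑ v, c v * spin x v) x = 2 * c v := by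
    intro v x
    simp only [spinDiff]
    simp_rw [spin_update_one, mul_add, Finset.sum_add_distrib]
    simp [mul_comm]
  simp_rw [hd]
  calc _ ≤ ∑ v : Fin n, (4 : ℝ) := by
        refine Finset.sum_le_sum fun v _ => ?_
        simp only [integral_const, probReal_univ, one_smul]
        have := abs_le.1 (hc v)
        nlinarith
    _ = _ := by simp; ring

theorem integral_integral_sub_sq {α : Type*} [MeasurableSpace α] [MeasurableSingletonClass α]
    [Finite α] (μ : Measure α) [IsProbabilityMeasure μ] (f : α → ℝ) :
    ∫ y, ∫ x, (f x - f y) ^ 2 ∂μ ∂μ = 2 * variance f μ := by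
  have : ∀ x y, (f x - f y) ^ 2 = f x ^ 2 - f x * (2 * f y) + f y ^ 2 := fun x y => by ring
  simp_rw [this]
  have h : ∀ y, ∫ x, (f x ^ 2 - f x * (2 * f y) + f y ^ 2) ∂μ =
      ∫ x, f x ^ 2 ∂μ - (∫ x, f x ∂μ) * 2 * f y + f y ^ 2 := by
    intro y
    rw [integral_add .of_finite .of_finite, integral_sub .of_finite .of_finite, integral_mul_const]
    simp; ring
  simp_rw [h]
  rw [integral_add .of_finite .of_finite, integral_sub .of_finite .of_finite, integral_const_mul,
    variance_eq_sub_of_finite]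
  simp; ring

/-- Freeze one sample and apply Poincaré to the other. The derivative in the spin u is a linear form
in the differences of the two samples; its mean square is a multiple of the variance of a linear
form in the spins, to which Poincaré applies again. Each application costs a factor n/η. -/
theorem IsingParams.variance_centeredStatistic_le {n : ℕ} {θ : IsingParams n} {η : ℝ}
    (hη0 : 0 < η) (hη : η ≤ 1) (hθ : θ.HighTemperature η) (c : Pair n → ℝ)
    (hc : ∀ e, |c e| ≤ 1) :
    variance (fun z : Config n × Config n => centeredStatistic c z.1 z.2) (θ.law.prod θ.law) ≤
      64 * n ^ 2 / η ^ 2 := by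
  refine (variance_prod_le θ.law (centeredStatistic c)).trans ?_
  have hsymm : ∫ x, variance (fun y => centeredStatistic c x y) θ.law ∂θ.law =
      ∫ y, variance (fun x => centeredStatistic c x y) θ.law ∂θ.law := by
    simp_rw [centeredStatistic_comm c]
  rw [hsymm]
  have key : ∫ y, variance (fun x => centeredStatistic c x y) θ.law ∂θ.law ≤
      32 * n ^ 2 / η ^ 2 := by
    calc ∫ y, variance (fun x => centeredStatistic c x y) θ.law ∂θ.law
        ≤ ∫ y, (∑ u, ∫ x, (2 * ∑ v, pairMatrix c u v * (spin x v - spin y v)) ^ 2 ∂θ.law) / η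
            ∂θ.law := by
          refine integral_mono .of_finite .of_finite fun y => ?_
          refine (θ.variance_le hη0 hη hθ _).trans_eq ?_
          simp_rw [spinDiff_centeredStatistic]
      _ = (∑ u, 4 * (2 * variance (fun x => ∑ v, pairMatrix c u v * spin x v) θ.law)) / η := by
          rw [integral_div, integral_finsetSum _ fun _ _ => .of_finite]
          congr 1
          refine Finset.sum_congr rfl fun u _ => ?_
          rw [← integral_integral_sub_sq, ← integral_const_mul]
          congr 1
          funext y
          rw [← integral_const_mul]
          congr 1
          funext x
          rw [← Finset.sum_sub_distrib]
          simp_rw [mul_sub]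
          ring
      _ ≤ (∑ u : Fin n, 4 * (2 * (4 * n / η))) / η := by
          gcongr with u
          exact θ.variance_linear_le hη0 hη hθ _ fun v => abs_pairMatrix_le hc u v
      _ = _ := by simp; field_simp; ring
  calc _ ≤ 32 * n ^ 2 / η ^ 2 + 32 * n ^ 2 / η ^ 2 := add_le_add key key
    _ = _ := by ring

/-! ### Divergence from product distributions -/

/-- The log-density is f - c with c the log-normalizer, and c cancels between the two divergences.
-/
theorem dSKL_tilted {α : Type*} [MeasurableSpace α] [MeasurableSingletonClass α] [Finite α]
    (q : Measure α) [IsProbabilityMeasure q] (f : α → ℝ) :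
    dSKL (q.tilted f) q = ENNReal.ofReal (∫ x, f x ∂(q.tilted f) - ∫ x, f x ∂q) := by
  have hint : Integrable (fun x => Real.exp (f x)) q := .of_finite
  have : IsProbabilityMeasure (q.tilted f) := isProbabilityMeasure_tilted hint
  set p := q.tilted f
  have hpq : p ≪ q := tilted_absolutelyContinuous q f
  have hqp : q ≪ p := absolutelyContinuous_tilted hint
  set c := Real.log (∫ x, Real.exp (f x) ∂q)
  have hllr : llr p q =ᵐ[q] fun x => f x - c := log_rnDeriv_tilted_left_self hint
  have h1 : (InformationTheory.klDiv p q).toReal = ∫ x, f x ∂p - c := by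
    rw [InformationTheory.toReal_klDiv_of_measure_eq hpq (by simp),
      integral_congr_ae (hpq.ae_le hllr), integral_sub .of_finite .of_finite]
    simp
  have h2 : (InformationTheory.klDiv q p).toReal = c - ∫ x, f x ∂q := by
    rw [InformationTheory.toReal_klDiv_of_measure_eq hqp (by simp)]
    have : llr q p =ᵐ[q] fun x => c - f x := by
      filter_upwards [neg_llr hqp, hllr] with x hx hx'
      simp only [Pi.neg_apply] at hx
      linarith
    rw [integral_congr_ae this, integral_sub .of_finite .of_finite]
    simp
  have n1 : InformationTheory.klDiv p q ≠ ∞ := InformationTheory.klDiv_ne_top hpq .of_finite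
  have n2 : InformationTheory.klDiv q p ≠ ∞ := InformationTheory.klDiv_ne_top hqp .of_finite
  rw [dSKL, ← ENNReal.ofReal_toReal (ENNReal.add_ne_top.2 ⟨n1, n2⟩), ENNReal.toReal_add n1 n2, h1,
    h2]
  congr 1
  ring

theorem integral_spin_mul_spin_pi {n : ℕ} (ν : Fin n → Measure ℤˣ)
    [∀ u, IsProbabilityMeasure (ν u)] {u v : Fin n} (huv : u ≠ v) :
    ∫ x : Config n, spin x u * spin x v ∂(Measure.pi ν) =
      (∫ x : Config n, spin x u ∂(Measure.pi ν)) * ∫ x : Config n, spin x v ∂(Measure.pi ν) := by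
  have h : iIndepFun (fun (u : Fin n) (x : Config n) => spin x u) (Measure.pi ν) :=
    iIndepFun_pi (X := fun _ (s : ℤˣ) => ((s : ℤ) : ℝ))
      fun i => (measurable_of_finite _).aemeasurable
  exact (h.indepFun huv).integral_mul_eq_mul_integral
    (measurable_of_finite _).aestronglyMeasurable (measurable_of_finite _).aestronglyMeasurable

theorem spinCov_eq_zero_of_mem_productLaws {n : ℕ} {p : Measure (Config n)}
    (hp : p ∈ productLaws n) {u v : Fin n} (huv : u ≠ v) : spinCov p u v = 0 := by
  obtain ⟨ν, hν, rfl⟩ := hp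
  rw [spinCov, integral_spin_mul_spin_pi ν huv, sub_self]

/-- The distribution of the spin `u`. -/
def IsingParams.marginal {n : ℕ} (θ : IsingParams n) (u : Fin n) : Measure ℤˣ :=
  θ.law.map fun x => x u

instance {n : ℕ} (θ : IsingParams n) (u : Fin n) : IsProbabilityMeasure (θ.marginal u) :=
  Measure.isProbabilityMeasure_map (measurable_of_finite _).aemeasurable

theorem IsingParams.marginal_real_pos {n : ℕ} (θ : IsingParams n) (u : Fin n) (s : ℤˣ) :
    0 < (θ.marginal u).real {s} := by
  rw [IsingParams.marginal, map_measureReal_apply (measurable_of_finite _) (.of_discrete)]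
  have h : θ.law.real {Function.update (1 : Config n) u s} ≤ θ.law.real ((fun x => x u) ⁻¹' {s}) :=
    measureReal_mono (by simp)
  refine lt_of_lt_of_le ?_ h
  rw [Measure.real, θ.law_singleton, ENNReal.toReal_ofReal (by positivity)]
  have := θ.sum_exp_pos
  positivity

theorem IsingParams.pi_marginal_eq_tilted {n : ℕ} (θ : IsingParams n) :
    Measure.pi θ.marginal =
      (Measure.count : Measure (Config n)).tilted
        fun x => ∑ u, Real.log ((θ.marginal u).real {x u}) := by
  have hexp : ∀ x : Config n, Real.exp (∑ u, Real.log ((θ.marginal u).real {x u})) =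
      (Measure.pi θ.marginal).real {x} := by
    intro x
    rw [Real.exp_sum, Measure.real, Measure.pi_singleton, ENNReal.toReal_prod]
    exact Finset.prod_congr rfl fun u _ => Real.exp_log (θ.marginal_real_pos u _)
  refine Measure.ext_of_singleton fun x => ?_
  rw [tilted_apply _ _ _]
  simp only [hexp, integral_count, sum_measureReal_singleton]
  simp [Measure.restrict_singleton]
  rw [Measure.real, ENNReal.ofReal_toReal (measure_ne_top _ _), Measure.pi_singleton]

theorem IsingParams.law_eq_tilted {n : ℕ} (θ : IsingParams n) :
    θ.law = (Measure.pi θ.marginal).tilted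
      fun x => θ.exponent x - ∑ u, Real.log ((θ.marginal u).real {x u}) := by
  nth_rewrite 1 [θ.pi_marginal_eq_tilted]
  rw [tilted_tilted .of_finite, IsingParams.law]
  congr 1
  funext x
  simp

theorem IsingParams.integral_marginal {n : ℕ} (θ : IsingParams n) (u : Fin n) (g : ℤˣ → ℝ) :
    ∫ x : Config n, g (x u) ∂(Measure.pi θ.marginal) = ∫ x, g (x u) ∂θ.law := by
  have h1 := integral_map (μ := Measure.pi θ.marginal) (φ := fun x : Config n => x u)
    (measurable_of_finite _).aemeasurable (measurable_of_finite g).aestronglyMeasurable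
  have h2 := integral_map (μ := θ.law) (φ := fun x : Config n => x u)
    (measurable_of_finite _).aemeasurable (measurable_of_finite g).aestronglyMeasurable
  rw [← h1, ← h2]
  congr 1
  exact (measurePreserving_eval θ.marginal u).map_eq

/-- The log-density is the exponent minus a sum of functions of single spins. Single-spin terms have
the same mean under both laws, so only the interaction remains, and under the product law a pair of
spins has the product of its means. -/
theorem IsingParams.dSKL_pi_marginal {n : ℕ} (θ : IsingParams n) :
    dSKL θ.law (Measure.pi θ.marginal) = ENNReal.ofReal
      (∑ e : Pair n, θ.coupling e.1.1 e.1.2 * spinCov θ.law e.1.1 e.1.2) := by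
  have h := dSKL_tilted (Measure.pi θ.marginal)
    fun x => θ.exponent x - ∑ u, Real.log ((θ.marginal u).real {x u})
  rw [← θ.law_eq_tilted] at h
  rw [h]
  congr 1
  have hspin : ∀ u, ∫ x : Config n, spin x u ∂(Measure.pi θ.marginal) = ∫ x, spin x u ∂θ.law :=
    fun u => θ.integral_marginal u fun s => ((s : ℤ) : ℝ)
  have hlog := fun u => θ.integral_marginal u fun s => Real.log ((θ.marginal u).real {s})
  simp only [IsingParams.exponent]
  rw [integral_sub .of_finite .of_finite, integral_sub .of_finite .of_finite,
    integral_add .of_finite .of_finite, integral_add .of_finite .of_finite]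
  simp_rw [integral_finsetSum _ fun _ _ => Integrable.of_finite, hlog, integral_const_mul, hspin]
  have hcov : ∀ e : Pair n, spinCov θ.law e.1.1 e.1.2 =
      ∫ x, spin x e.1.1 * spin x e.1.2 ∂θ.law -
        ∫ x : Config n, spin x e.1.1 * spin x e.1.2 ∂(Measure.pi θ.marginal) := by
    intro e
    rw [integral_spin_mul_spin_pi _ e.2.ne, hspin, hspin, spinCov]
  simp_rw [hcov, mul_sub, Finset.sum_sub_distrib]
  ring

theorem IsingParams.le_mul_sum_abs_spinCov {n : ℕ} {θ : IsingParams n} {β ε : ℝ}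
    (hβ : θ.CouplingsBoundedBy β) (hε : 0 < ε)
    (h : ENNReal.ofReal ε ≤ dSKLProduct θ.law) :
    ε ≤ β * ∑ e : Pair n, |spinCov θ.law e.1.1 e.1.2| := by
  have h1 : dSKLProduct θ.law ≤ dSKL θ.law (Measure.pi θ.marginal) :=
    iInf₂_le _ ⟨θ.marginal, fun _ => inferInstance, rfl⟩
  rw [θ.dSKL_pi_marginal] at h1
  have h2 := (ENNReal.ofReal_le_ofReal_iff' .. |>.1 (h.trans h1)).resolve_right (not_le.2 hε)
  refine h2.trans ?_
  rw [Finset.mul_sum]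
  refine Finset.sum_le_sum fun e _ => ?_
  calc _ ≤ |θ.coupling e.1.1 e.1.2| * |spinCov θ.law e.1.1 e.1.2| := by
        rw [← abs_mul]; exact le_abs_self _
    _ ≤ _ := by gcongr; exact hβ _ _ e.2.ne

/-! ### Concentration of sample means -/

theorem sampleMean_sub {α : Type*} {k : ℕ} (hk : 0 < k) (X : Fin k → α) (f : α → ℝ) (c : ℝ) :
    (k : ℝ) * (sampleMean X f - c) = ∑ i, (f (X i) - c) := by
  have : (k : ℝ) ≠ 0 := by exact_mod_cast hk.ne'
  rw [sampleMean, Finset.sum_sub_distrib]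
  simp
  field_simp

section Concentration

variable {α : Type*} [MeasurableSpace α] [MeasurableSingletonClass α] [Finite α]
  (μ : Measure α) [IsProbabilityMeasure μ]

theorem hoeffding_pi (k : ℕ) (f : α → ℝ) {a b t : ℝ} (hf : ∀ x, f x ∈ Set.Icc a b)
    (ht : 0 ≤ t) :
    (Measure.pi fun _ : Fin k => μ).real {X | k * t ≤ ∑ i, (f (X i) - ∫ x, f x ∂μ)} ≤
      Real.exp (-(2 * k * t ^ 2 / (b - a) ^ 2)) := by
  have hind : iIndepFun (fun (i : Fin k) (X : Fin k → α) => f (X i) - ∫ x, f x ∂μ)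
      (Measure.pi fun _ : Fin k => μ) :=
    iIndepFun_pi (X := fun _ x => f x - ∫ x, f x ∂μ)
      fun i => (measurable_of_finite _).aemeasurable
  have hsub : ∀ i ∈ (Finset.univ : Finset (Fin k)), HasSubgaussianMGF
      (fun X : Fin k → α => f (X i) - ∫ x, f x ∂μ) ((‖b - a‖₊ / 2) ^ 2)
      (Measure.pi fun _ : Fin k => μ) := by
    intro i _
    have h1 := hasSubgaussianMGF_of_mem_Icc (μ := μ) (X := f) (measurable_of_finite f).aemeasurable
      (.of_forall hf)
    rw [← (measurePreserving_eval (fun _ : Fin k => μ) i).map_eq] at h1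
    have h2 := HasSubgaussianMGF.of_map (Y := fun X : Fin k → α => X i)
      (measurable_of_finite _).aemeasurable h1
    rw [(measurePreserving_eval (fun _ : Fin k => μ) i).map_eq] at h2
    exact h2
  refine (HasSubgaussianMGF.measure_sum_ge_le_of_iIndepFun hind hsub
    (by positivity : 0 ≤ (k : ℝ) * t)).trans_eq ?_
  congr 1
  push_cast
  simp only [Finset.sum_const, Finset.card_univ, Fintype.card_fin, nsmul_eq_mul,
    Real.norm_eq_abs, div_pow, sq_abs]
  rcases Nat.eq_zero_or_pos k with rfl | hk
  · simp
  · have : (0 : ℝ) < k := by exact_mod_cast hk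
    rcases eq_or_ne (b - a) 0 with h | h
    · simp [h]
    · field_simp

theorem measure_abs_sampleMean_sub_gt_le {k : ℕ} (hk : 0 < k) (f : α → ℝ) (hf : ∀ x, |f x| ≤ 1)
    {t : ℝ} (ht : 0 ≤ t) :
    (Measure.pi fun _ : Fin k => μ).real {X | t < |sampleMean X f - ∫ x, f x ∂μ|} ≤
      2 * Real.exp (-(k * t ^ 2 / 2)) := by
  have hk' : (0 : ℝ) < k := by exact_mod_cast hk
  have h1 := hoeffding_pi μ k f (a := -1) (b := 1) (fun x => abs_le.1 (hf x)) ht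
  have h2 := hoeffding_pi μ k (fun x => -f x) (a := -1) (b := 1)
    (fun x => abs_le.1 (by rw [abs_neg]; exact hf x)) ht
  have e : -(2 * k * t ^ 2 / (1 - -1) ^ 2) = -(k * t ^ 2 / 2) := by ring
  rw [e] at h1 h2
  have hsub : {X : Fin k → α | t < |sampleMean X f - ∫ x, f x ∂μ|} ⊆
      {X | k * t ≤ ∑ i, (f (X i) - ∫ x, f x ∂μ)} ∪
        {X | k * t ≤ ∑ i, (-f (X i) - ∫ x, -f x ∂μ)} := by
    intro X hX
    rcases lt_abs.1 (Set.mem_ofPred.1 hX) with h | h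
    · left
      rw [Set.mem_ofPred, ← sampleMean_sub hk]
      gcongr
    · right
      have : ∑ i, (-f (X i) - ∫ x, -f x ∂μ) = -∑ i, (f (X i) - ∫ x, f x ∂μ) := by
        rw [integral_neg, ← Finset.sum_neg_distrib]
        exact Finset.sum_congr rfl fun i _ => by ring
      rw [Set.mem_ofPred, this, ← sampleMean_sub hk, ← mul_neg]
      gcongr
  linarith [(measureReal_mono (μ := Measure.pi fun _ : Fin k => μ) hsub).trans
    (measureReal_union_le _ _)]

/-- Hoeffding with deviation 1/4. A tie is included in the event, so the bound serves for a wrong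
majority in either direction. -/
theorem measure_le_two_mul_ncard_le (R : ℕ) (B : Set α) (hB : μ.real B ≤ 1 / 4) :
    (Measure.pi fun _ : Fin R => μ).real {X | R ≤ 2 * Set.ncard {r | X r ∈ B}} ≤
      Real.exp (-(R / 8)) := by
  classical
  have h := hoeffding_pi μ R (B.indicator fun _ => (1 : ℝ)) (a := 0) (b := 1) (t := 1 / 4)
    (fun x => by by_cases hx : x ∈ B <;> simp [hx]) (by norm_num)
  have e : -(2 * (R : ℝ) * (1 / 4) ^ 2 / (1 - 0) ^ 2) = -(R / 8) := by ring
  rw [e] at h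
  refine (measureReal_mono fun X hX => ?_).trans h
  have h1 : ∫ x, B.indicator (fun _ => (1 : ℝ)) x ∂μ = μ.real B := by
    rw [integral_indicator (.of_discrete)]; simp
  have h2 : ∑ i, B.indicator (fun _ => (1 : ℝ)) (X i) = Set.ncard {r | X r ∈ B} := by
    rw [Set.ncard_eq_toFinset_card', Set.toFinset_ofPred]
    simp [Set.indicator_apply]
  have h3 : (R : ℝ) ≤ 2 * Set.ncard {r | X r ∈ B} := by exact_mod_cast hX
  rw [Set.mem_ofPred, Finset.sum_sub_distrib, h1, h2]
  simp only [Finset.sum_const, Finset.card_univ, Fintype.card_fin, nsmul_eq_mul]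
  nlinarith [mul_le_mul_of_nonneg_left hB (Nat.cast_nonneg (α := ℝ) R)]

theorem memLp_two_of_finite (f : α → ℝ) : MemLp f 2 μ :=
  (memLp_two_iff_integrable_sq (measurable_of_finite f).aestronglyMeasurable).2 .of_finite

theorem measure_le_abs_sampleMean_sub_le {k : ℕ} (hk : 0 < k) (f : α → ℝ) {h : ℝ} (hh : 0 < h) :
    (Measure.pi fun _ : Fin k => μ).real {X | h ≤ |sampleMean X f - ∫ x, f x ∂μ|} ≤
      variance f μ / (k * h ^ 2) := by
  have hk' : (0 : ℝ) < k := by exact_mod_cast hk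
  set P := Measure.pi fun _ : Fin k => μ
  have hvar : variance (fun X : Fin k → α => ∑ i, f (X i)) P = k * variance f μ := by
    have := variance_sum_pi (μ := fun _ : Fin k => μ) (X := fun _ => f)
      fun i => memLp_two_of_finite μ f
    simp only [Finset.sum_const, Finset.card_univ, Fintype.card_fin, nsmul_eq_mul] at this
    rw [← this]
    congr 1
    funext X
    simp
  have hmean : ∫ X : Fin k → α, ∑ i, f (X i) ∂P = k * ∫ x, f x ∂μ := by
    rw [integral_finsetSum _ fun _ _ => .of_finite]
    have : ∀ i : Fin k, ∫ X : Fin k → α, f (X i) ∂P = ∫ x, f x ∂μ := by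
      intro i
      rw [← (measurePreserving_eval (fun _ : Fin k => μ) i).map_eq,
        integral_map (measurable_of_finite _).aemeasurable
          (measurable_of_finite f).aestronglyMeasurable]
    simp [this]
  have hc := meas_ge_le_variance_div_sq (memLp_two_of_finite P fun X => ∑ i, f (X i))
    (mul_pos hk' hh)
  rw [hvar, hmean] at hc
  have hset : {X : Fin k → α | h ≤ |sampleMean X f - ∫ x, f x ∂μ|} =
      {X | k * h ≤ |∑ i, f (X i) - k * ∫ x, f x ∂μ|} := by
    ext X
    have : ∑ i, f (X i) - k * ∫ x, f x ∂μ = k * (sampleMean X f - ∫ x, f x ∂μ) := by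
      rw [sampleMean_sub hk, Finset.sum_sub_distrib]; simp
    rw [Set.mem_ofPred, Set.mem_ofPred, this, abs_mul, abs_of_pos hk',
      mul_le_mul_iff_of_pos_left hk']
  rw [hset]
  have := ENNReal.toReal_mono ENNReal.ofReal_ne_top hc
  rw [ENNReal.toReal_ofReal (by have := variance_nonneg f μ; positivity)] at this
  refine this.trans_eq ?_
  field_simp

end Concentration

/-! ### The localization test -/

theorem abs_sampleMean_le {α : Type*} {k : ℕ} (X : Fin k → α) (f : α → ℝ) (hf : ∀ x, |f x| ≤ 1) :
    |sampleMean X f| ≤ 1 := by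
  rw [sampleMean, abs_div, Nat.abs_cast]
  refine div_le_one_of_le₀ ?_ (Nat.cast_nonneg k)
  refine (Finset.abs_sum_le_sum_abs _ _).trans ?_
  calc _ ≤ ∑ _ : Fin k, (1 : ℝ) := Finset.sum_le_sum fun i _ => hf _
    _ = k := by simp

theorem abs_integral_spin_le {n : ℕ} (p : Measure (Config n)) [IsProbabilityMeasure p]
    (u : Fin n) : |∫ x, spin x u ∂p| ≤ 1 := by
  have := norm_integral_le_of_norm_le_const (μ := p) (f := fun x => spin x u) (C := 1)
    (.of_forall fun x => (abs_spin x u).le)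
  simpa using this

theorem abs_sampleCov_sub_le {n k : ℕ} (p : Measure (Config n)) [IsProbabilityMeasure p]
    (X : Fin k → Config n) (e : Pair n) {t : ℝ}
    (h1 : |sampleMean X (fun x => spin x e.1.1 * spin x e.1.2) -
      ∫ x, spin x e.1.1 * spin x e.1.2 ∂p| ≤ t)
    (h2 : |sampleMean X (fun x => spin x e.1.1) - ∫ x, spin x e.1.1 ∂p| ≤ t)
    (h3 : |sampleMean X (fun x => spin x e.1.2) - ∫ x, spin x e.1.2 ∂p| ≤ t) :
    |sampleCov X e - spinCov p e.1.1 e.1.2| ≤ 3 * t := by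
  have ha := abs_sampleMean_le X (fun x => spin x e.1.1) fun x => (abs_spin x _).le
  have hb := abs_integral_spin_le p e.1.2
  rw [sampleCov, spinCov]
  set a := sampleMean X fun x => spin x e.1.1
  set b := sampleMean X fun x => spin x e.1.2
  set A := ∫ x, spin x e.1.1 ∂p
  set B := ∫ x, spin x e.1.2 ∂p
  set c := sampleMean X fun x => spin x e.1.1 * spin x e.1.2
  set C := ∫ x, spin x e.1.1 * spin x e.1.2 ∂p
  have e1 : c - a * b - (C - A * B) = (c - C) - (a * (b - B) + (a - A) * B) := by ring
  rw [e1]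
  have k1 : |a * (b - B)| ≤ t := by
    rw [abs_mul]; nlinarith [abs_nonneg (b - B), abs_nonneg a]
  have k2 : |(a - A) * B| ≤ t := by
    rw [abs_mul]; nlinarith [abs_nonneg (a - A), abs_nonneg B]
  linarith [abs_sub (c - C) (a * (b - B) + (a - A) * B), abs_add_le (a * (b - B)) ((a - A) * B)]

theorem card_pair_le (n : ℕ) : (Fintype.card (Pair n) : ℝ) ≤ n ^ 2 := by
  have := Fintype.card_subtype_le fun e : Fin n × Fin n => e.1 < e.2
  rw [Fintype.card_prod, Fintype.card_fin] at this
  rw [sq]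
  exact_mod_cast this

theorem measure_sampleCov_far_le {n k : ℕ} (hk : 0 < k) (p : Measure (Config n))
    [IsProbabilityMeasure p] {t : ℝ} (ht : 0 ≤ t) :
    (Measure.pi fun _ : Fin k => p).real
        {X | ∃ e : Pair n, 3 * t < |sampleCov X e - spinCov p e.1.1 e.1.2|} ≤
      6 * n ^ 2 * Real.exp (-(k * t ^ 2 / 2)) := by
  set P := Measure.pi fun _ : Fin k => p
  have hone : ∀ e : Pair n, P.real {X | 3 * t < |sampleCov X e - spinCov p e.1.1 e.1.2|} ≤
      -- Three empirical means enter a covariance, each with a two-sided bound.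
      6 * Real.exp (-(k * t ^ 2 / 2)) := by
    intro e
    have b1 := measure_abs_sampleMean_sub_gt_le p hk (fun x => spin x e.1.1 * spin x e.1.2)
      (fun x => by rw [abs_mul, abs_spin, abs_spin, one_mul]) ht
    have b2 := measure_abs_sampleMean_sub_gt_le p hk (fun x => spin x e.1.1)
      (fun x => (abs_spin x _).le) ht
    have b3 := measure_abs_sampleMean_sub_gt_le p hk (fun x => spin x e.1.2)
      (fun x => (abs_spin x _).le) ht
    have hsub : {X : Fin k → Config n | 3 * t < |sampleCov X e - spinCov p e.1.1 e.1.2|} ⊆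
        {X | t < |sampleMean X (fun x => spin x e.1.1 * spin x e.1.2) -
          ∫ x, spin x e.1.1 * spin x e.1.2 ∂p|} ∪
        ({X | t < |sampleMean X (fun x => spin x e.1.1) - ∫ x, spin x e.1.1 ∂p|} ∪
        {X | t < |sampleMean X (fun x => spin x e.1.2) - ∫ x, spin x e.1.2 ∂p|}) := by
      intro X hX
      by_contra hcon
      simp only [Set.mem_union, Set.mem_ofPred, not_or, not_lt] at hcon hX
      exact absurd (abs_sampleCov_sub_le p X e hcon.1 hcon.2.1 hcon.2.2) (not_le.2 hX)
    have h1 := (measureReal_mono (μ := P) hsub).trans (measureReal_union_le _ _)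
    have h2 := measureReal_union_le (μ := P)
      {X | t < |sampleMean X (fun x => spin x e.1.1) - ∫ x, spin x e.1.1 ∂p|}
      {X | t < |sampleMean X (fun x => spin x e.1.2) - ∫ x, spin x e.1.2 ∂p|}
    linarith
  rw [Set.ofPred_exists]
  refine (measureReal_iUnion_fintype_le _).trans ?_
  calc _ ≤ ∑ _ : Pair n, 6 * Real.exp (-(k * t ^ 2 / 2)) := Finset.sum_le_sum fun e _ => hone e
    _ = Fintype.card (Pair n) * (6 * Real.exp (-(k * t ^ 2 / 2))) := by simp
    _ ≤ n ^ 2 * (6 * Real.exp (-(k * t ^ 2 / 2))) := by gcongr; exact card_pair_le n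
    _ = _ := by ring

/-! ### The sign of a sum of biased coins -/

theorem tanh_ge_div {z : ℝ} (hz : 0 ≤ z) : z / (1 + z) ≤ Real.tanh z := by
  have h1 := Real.add_one_le_exp (2 * z)
  have he : Real.exp (2 * z) = Real.exp z * Real.exp z := by rw [← Real.exp_add]; ring_nf
  have hz' : 0 < Real.exp z := Real.exp_pos z
  have e : Real.tanh z = (Real.exp (2 * z) - 1) / (Real.exp (2 * z) + 1) := by
    rw [Real.tanh_eq_sinh_div_cosh, Real.sinh_eq, Real.cosh_eq, he, Real.exp_neg]
    field_simp
  rw [e, div_le_div_iff₀ (by linarith) (by positivity)]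
  nlinarith

theorem tanh_le_self {z : ℝ} (hz : 0 ≤ z) : Real.tanh z ≤ z := by
  have hmono : MonotoneOn (fun z => z * Real.cosh z - Real.sinh z) (Set.Ici 0) := by
    refine monotoneOn_of_hasDerivWithinAt_nonneg (f' := fun z => z * Real.sinh z) (convex_Ici 0)
      (by fun_prop) (fun x _ => ?_) fun x hx => ?_
    · have h := ((hasDerivAt_id x).mul (Real.hasDerivAt_cosh x)).sub (Real.hasDerivAt_sinh x)
      refine (h.congr_deriv ?_).hasDerivWithinAt
      simp
    · rw [interior_Ici, Set.mem_Ioi] at hx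
      exact mul_nonneg hx.le (Real.sinh_nonneg_iff.2 hx.le)
  have h := hmono Set.self_mem_Ici hz hz
  simp only [zero_mul, Real.sinh_zero, sub_zero, sub_nonneg] at h
  rwa [Real.tanh_eq_sinh_div_cosh, div_le_iff₀ (Real.cosh_pos z)]

theorem abs_tanh (z : ℝ) : |Real.tanh z| = Real.tanh |z| := by
  rw [Real.tanh_eq_sinh_div_cosh, Real.tanh_eq_sinh_div_cosh, abs_div, Real.abs_sinh,
    Real.cosh_abs, abs_of_pos (Real.cosh_pos z)]

section BiasedCoins

variable (μ : Measure ℤˣ) [IsProbabilityMeasure μ]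

theorem units_univ : (Finset.univ : Finset ℤˣ) = {1, -1} := rfl

theorem integral_units (g : ℤˣ → ℝ) : ∫ s, g s ∂μ = μ.real {1} * g 1 + μ.real {-1} * g (-1) := by
  rw [integral_fintype .of_finite, units_univ, Finset.sum_pair (by decide)]
  simp

theorem real_units_singleton (s : ℤˣ) :
    μ.real {s} = (1 + (∫ t, ((t : ℤ) : ℝ) ∂μ) * ((s : ℤ) : ℝ)) / 2 := by
  have h1 : ∫ _, (1 : ℝ) ∂μ = 1 := by simp
  rw [integral_units] at h1
  rw [integral_units]
  rcases Int.units_eq_one_or s with rfl | rfl <;> push_cast <;> linarith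

variable {k : ℕ}

/-- The sum of `k` signs. -/
def signSum (x : Fin k → ℤˣ) : ℝ := ∑ i, ((x i : ℤ) : ℝ)

theorem signSum_neg (x : Fin k → ℤˣ) : signSum (-x) = -signSum x := by
  simp [signSum]

/-- With α = artanh m the law of k biased coins is the uniform law tilted by exp(α S), where S is
the sum; global negation therefore changes the weights only through the sign of S. -/
theorem pi_real_singleton_eq_exp {m : ℝ} (hm : ∫ t, ((t : ℤ) : ℝ) ∂μ = m) (hm1 : |m| < 1)
    (x : Fin k → ℤˣ) : (Measure.pi fun _ : Fin k => μ).real {x} =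
      (√(1 - m ^ 2) / 2) ^ k * Real.exp (Real.artanh m * signSum x) := by
  have hmem : m ∈ Set.Ioo (-1) 1 := abs_lt.1 hm1
  have hpos : 0 < √(1 - m ^ 2) := Real.sqrt_pos.2 (by nlinarith [hmem.1, hmem.2])
  have hone : ∀ s : ℤˣ, μ.real {s} =
      √(1 - m ^ 2) / 2 * Real.exp (Real.artanh m * ((s : ℤ) : ℝ)) := by
    intro s
    rw [real_units_singleton, hm]
    rcases Int.units_eq_one_or s with rfl | rfl
    · push_cast
      rw [mul_one, mul_one, ← Real.cosh_add_sinh, Real.cosh_artanh hmem, Real.sinh_artanh hmem]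
      field_simp
    · push_cast
      rw [mul_neg_one, mul_neg_one, ← Real.cosh_sub_sinh, Real.cosh_artanh hmem,
        Real.sinh_artanh hmem]
      field_simp
      ring
  rw [Measure.real, Measure.pi_singleton, ENNReal.toReal_prod, signSum, Finset.mul_sum,
    Real.exp_sum]
  calc _ = ∏ i, (√(1 - m ^ 2) / 2 * Real.exp (Real.artanh m * ((x i : ℤ) : ℝ))) :=
        Finset.prod_congr rfl fun i _ => hone _
    _ = _ := by
        rw [Finset.prod_mul_distrib, Finset.prod_const, Finset.card_univ, Fintype.card_fin]

/-- An exact identity from the symmetry x ↦ -x: conditionally on {x, -x} the sign of the sum has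
mean tanh(α |S|). The integrand on the right has the sign of m everywhere, so it can be bounded
pointwise. -/
theorem integral_sign_signSum {m : ℝ} (hm : ∫ t, ((t : ℤ) : ℝ) ∂μ = m) (hm1 : |m| < 1) :
    ∫ x, Real.sign (signSum x) ∂(Measure.pi fun _ : Fin k => μ) =
      ∫ x, Real.tanh (Real.artanh m * signSum x) * Real.sign (signSum x)
        ∂(Measure.pi fun _ : Fin k => μ) := by
  rw [← sub_eq_zero, ← integral_sub .of_finite .of_finite, integral_fintype .of_finite]
  set α := Real.artanh m
  have hodd : ∀ φ : (Fin k → ℤˣ) → ℝ, (∀ x, φ (-x) = -φ x) → ∑ x, φ x = 0 := by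
    intro φ hφ
    have := Equiv.sum_comp (Equiv.neg (Fin k → ℤˣ)) φ
    simp only [Equiv.neg_apply, hφ, Finset.sum_neg_distrib] at this
    linarith
  apply hodd
  intro x
  simp only [pi_real_singleton_eq_exp μ hm hm1, signSum_neg, Real.sign_neg, mul_neg, Real.tanh_neg,
    smul_eq_mul]
  set z := α * signSum x
  have hc := Real.cosh_pos z
  have hexp : Real.exp (-z) * (1 + Real.tanh z) = Real.exp z * (1 - Real.tanh z) := by
    rw [Real.tanh_eq_sinh_div_cosh, ← Real.cosh_sub_sinh, ← Real.cosh_add_sinh]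
    field_simp
  linear_combination (-(√(1 - m ^ 2) / 2) ^ k * Real.sign (signSum x)) * hexp

theorem integral_signSum_sq_ge (hk : 0 < k) {m : ℝ} (hm : ∫ t, ((t : ℤ) : ℝ) ∂μ = m) :
    (k : ℝ) ≤ ∫ x, signSum x ^ 2 ∂(Measure.pi fun _ : Fin k => μ) := by
  set P := Measure.pi fun _ : Fin k => μ
  have hmean : ∫ x, signSum x ∂P = k * m := by
    simp only [signSum]
    rw [integral_finsetSum _ fun _ _ => .of_finite]
    have : ∀ i : Fin k, ∫ X : Fin k → ℤˣ, ((X i : ℤ) : ℝ) ∂P = m := by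
      intro i
      rw [← hm, ← (measurePreserving_eval (fun _ : Fin k => μ) i).map_eq,
        integral_map (measurable_of_finite _).aemeasurable
          (measurable_of_finite _).aestronglyMeasurable]
    simp [this]
  have hv1 : variance (fun t : ℤˣ => ((t : ℤ) : ℝ)) μ = 1 - m ^ 2 := by
    rw [variance_eq_sub_of_finite, hm]
    congr 1
    have : ∀ t : ℤˣ, ((t : ℤ) : ℝ) ^ 2 = 1 := by
      intro t; rcases Int.units_eq_one_or t with rfl | rfl <;> simp
    simp [this]
  have hvar : variance (fun x : Fin k → ℤˣ => signSum x) P = k * (1 - m ^ 2) := by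
    have := variance_sum_pi (μ := fun _ : Fin k => μ) (X := fun _ (t : ℤˣ) => ((t : ℤ) : ℝ))
      fun i => memLp_two_of_finite μ _
    simp only [Finset.sum_const, Finset.card_univ, Fintype.card_fin, nsmul_eq_mul, hv1] at this
    rw [← this]
    congr 1
    funext x
    simp [signSum]
  rw [variance_eq_sub_of_finite, hmean] at hvar
  have h1 : (1 : ℝ) ≤ k := by exact_mod_cast hk
  -- The second moment equals k + k (k - 1) m².
  nlinarith [mul_nonneg (mul_nonneg (by linarith : (0 : ℝ) ≤ k) (sub_nonneg.2 h1)) (sq_nonneg m)]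

theorem integral_exp_signSum_le {m : ℝ} (hm : ∫ t, ((t : ℤ) : ℝ) ∂μ = m) (t : ℝ) :
    ∫ x, Real.exp (t * signSum x) ∂(Measure.pi fun _ : Fin k => μ) ≤
      Real.exp (k * (t ^ 2 / 2 + |m| * |t|)) := by
  have e : ∀ x : Fin k → ℤˣ, Real.exp (t * signSum x) =
      ∏ i, Real.exp (t * ((x i : ℤ) : ℝ)) := by
    intro x; rw [signSum, Finset.mul_sum, Real.exp_sum]
  simp_rw [e]
  rw [integral_fintype_prod_eq_prod (f := fun _ (s : ℤˣ) => Real.exp (t * ((s : ℤ) : ℝ)))]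
  simp only [Finset.prod_const, Finset.card_univ, Fintype.card_fin]
  rw [Real.exp_nat_mul]
  refine pow_le_pow_left₀ (integral_nonneg fun _ => (Real.exp_pos _).le) ?_ k
  have h1 : ∫ s : ℤˣ, Real.exp (t * ((s : ℤ) : ℝ)) ∂μ = Real.cosh t + m * Real.sinh t := by
    rw [integral_units, real_units_singleton, real_units_singleton, hm, Real.cosh_eq, Real.sinh_eq]
    push_cast
    ring_nf
  have h2 : |Real.sinh t| ≤ |t| * Real.cosh t := by
    rw [← Real.cosh_abs t, Real.abs_sinh]
    have h := tanh_le_self (abs_nonneg t)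
    rwa [Real.tanh_eq_sinh_div_cosh, div_le_iff₀ (Real.cosh_pos _)] at h
  have h3 : m * Real.sinh t ≤ |m| * |t| * Real.cosh t := by
    calc _ ≤ |m * Real.sinh t| := le_abs_self _
      _ = |m| * |Real.sinh t| := abs_mul _ _
      _ ≤ |m| * (|t| * Real.cosh t) := by gcongr
      _ = _ := by ring
  rw [h1, Real.exp_add]
  have h4 := Real.add_one_le_exp (|m| * |t|)
  calc Real.cosh t + m * Real.sinh t ≤ Real.cosh t * (|m| * |t| + 1) := by linarith
    _ ≤ _ := mul_le_mul (Real.cosh_le_exp_half_sq t) h4 (by positivity) (by positivity)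

/-- A fourth moment is dominated by exponential moments, here at t = ±1/√k. The drift contributes
only √k |m| to the exponent, which is where the a priori bound B enters. -/
theorem integral_signSum_pow_four_le (hk : 0 < k) {m : ℝ} (hm : ∫ t, ((t : ℤ) : ℝ) ∂μ = m)
    {B : ℝ} (hB : √k * |m| ≤ B) :
    ∫ x, (signSum x / √k) ^ 4 ∂(Measure.pi fun _ : Fin k => μ) ≤ 48 * Real.exp (1 / 2 + B) := by
  have hk' : (0 : ℝ) < k := by exact_mod_cast hk
  have hs : 0 < √(k : ℝ) := Real.sqrt_pos.2 hk'
  have hss : √(k : ℝ) * √k = k := Real.mul_self_sqrt hk'.le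
  have hexp : ∀ t : ℝ, |t| = 1 / √k →
      ∫ x, Real.exp (t * signSum x) ∂(Measure.pi fun _ : Fin k => μ) ≤ Real.exp (1 / 2 + B) := by
    intro t ht
    refine (integral_exp_signSum_le μ hm t).trans (Real.exp_le_exp.2 ?_)
    have e : (k : ℝ) * (t ^ 2 / 2 + |m| * |t|) = 1 / 2 + √k * |m| := by
      rw [← sq_abs t, ht, div_pow, one_pow, Real.sq_sqrt hk'.le]
      field_simp
      linear_combination (-2 * |m|) * hss
    rw [e]; linarith
  have hp : ∀ y : ℝ, y ^ 4 ≤ 24 * (Real.exp y + Real.exp (-y)) := by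
    intro y
    have h1 := Real.pow_div_factorial_le_exp |y| (abs_nonneg y) 4
    have h2 : |y| ^ 4 = y ^ 4 := by rw [← abs_pow, abs_of_nonneg (by positivity)]
    have h3 : Real.exp |y| ≤ Real.exp y + Real.exp (-y) := by
      rcases abs_choice y with h | h <;> rw [h] <;> linarith [Real.exp_pos y, Real.exp_pos (-y)]
    rw [h2, show (Nat.factorial 4 : ℝ) = 24 by norm_num [Nat.factorial]] at h1
    linarith
  calc _ ≤ ∫ x, 24 * (Real.exp (1 / √k * signSum x) + Real.exp (-(1 / √k) * signSum x))
        ∂(Measure.pi fun _ : Fin k => μ) := by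
        refine integral_mono .of_finite .of_finite fun x => ?_
        refine (hp _).trans_eq ?_
        ring_nf
    _ ≤ 24 * (Real.exp (1 / 2 + B) + Real.exp (1 / 2 + B)) := by
        rw [integral_const_mul, integral_add .of_finite .of_finite]
        gcongr
        · exact hexp _ (abs_of_pos (by positivity))
        · exact hexp _ (by rw [abs_neg]; exact abs_of_pos (by positivity))
    _ = _ := by ring

/-- The constant in the advantage of the weak learner. -/
def advantage (B : ℝ) : ℝ :=
  1 / (2 * (√(96 * Real.exp (1 / 2 + B)) * (1 + B * √(96 * Real.exp (1 / 2 + B)))))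

theorem advantage_pos {B : ℝ} (hB : 0 ≤ B) : 0 < advantage B := by
  unfold advantage; positivity

/-- The sign of a sum of `k` biased coins with mean `m` has mean at least of order `√k m`, in the
direction of `m`. -/
theorem mul_integral_sign_signSum_ge (hk : 0 < k) {m : ℝ} (hm : ∫ t, ((t : ℤ) : ℝ) ∂μ = m)
    (hm1 : |m| < 1) {B : ℝ} (hB : √k * |m| ≤ B) :
    advantage B * √k * m ^ 2 ≤
      m * ∫ x, Real.sign (signSum x) ∂(Measure.pi fun _ : Fin k => μ) := by
  have hk' : (0 : ℝ) < k := by exact_mod_cast hk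
  have hs : 0 < √(k : ℝ) := Real.sqrt_pos.2 hk'
  have hB0 : 0 ≤ B := le_trans (by positivity) hB
  set P := Measure.pi fun _ : Fin k => μ
  -- Q² is twice the fourth-moment bound. Since y = |S|/√k has second moment at least 1, the mean of
  -- y² - y⁴/Q² is at least 1/2.
  set Q := √(96 * Real.exp (1 / 2 + B)) with hQdef
  have hQ : 0 < Q := by positivity
  have hQ2 : Q ^ 2 = 96 * Real.exp (1 / 2 + B) := Real.sq_sqrt (by positivity)
  have hαm : |m| ≤ |Real.artanh m| := by
    have h := tanh_le_self (abs_nonneg (Real.artanh m))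
    rwa [← abs_tanh, Real.tanh_artanh (abs_lt.1 hm1)] at h
  have hsgn : (0 ≤ m ∧ 0 ≤ Real.artanh m) ∨ (m ≤ 0 ∧ Real.artanh m ≤ 0) := by
    rcases le_total 0 m with h | h
    · have := (Real.artanh_le_artanh_iff (x := 0) (y := m) (by simp) (abs_lt.1 hm1)).2 h
      exact Or.inl ⟨h, by simpa using this⟩
    · have := (Real.artanh_le_artanh_iff (y := 0) (x := m) (abs_lt.1 hm1) (by simp)).2 h
      exact Or.inr ⟨h, by simpa using this⟩
  -- A minorant by moments of order two and four: for y ≤ Q the numerator is at most y Q, and for y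
  -- ≥ Q it is nonpositive.
  have hpoly : ∀ y : ℝ, 0 ≤ y → (y ^ 2 - y ^ 4 / Q ^ 2) / (Q * (1 + B * Q)) ≤ y / (1 + B * y) := by
    intro y hy
    rw [div_le_div_iff₀ (by positivity) (by positivity)]
    rcases le_total y Q with h | h
    · have h1 : y ^ 2 - y ^ 4 / Q ^ 2 ≤ y * Q := by
        have : 0 ≤ y ^ 4 / Q ^ 2 := by positivity
        nlinarith
      calc _ ≤ (y * Q) * (1 + B * y) := by gcongr
        _ ≤ (y * Q) * (1 + B * Q) := by gcongr
        _ = _ := by ring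
    · have h1 : y ^ 2 - y ^ 4 / Q ^ 2 ≤ 0 := by
        rw [sub_nonpos, le_div_iff₀ (by positivity)]
        nlinarith [pow_le_pow_left₀ hQ.le h 2, sq_nonneg y]
      exact (mul_nonpos_of_nonpos_of_nonneg h1 (by positivity)).trans (by positivity)
  have hpt : ∀ x : Fin k → ℤˣ,
      m ^ 2 * √k * (((signSum x / √k) ^ 2 - (signSum x / √k) ^ 4 / Q ^ 2) / (Q * (1 + B * Q))) ≤
      m * (Real.tanh (Real.artanh m * signSum x) * Real.sign (signSum x)) := by
    intro x
    set S := signSum x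
    have e1 : m * (Real.tanh (Real.artanh m * S) * Real.sign S) =
        |m| * Real.tanh (|Real.artanh m| * |S|) := by
      have h1 : Real.tanh (Real.artanh m * S) * Real.sign S = Real.tanh (Real.artanh m * |S|) := by
        rcases lt_trichotomy S 0 with h | h | h
        · rw [Real.sign_of_neg h, abs_of_neg h, mul_neg, mul_neg, Real.tanh_neg, mul_one]
        · simp [h]
        · rw [Real.sign_of_pos h, abs_of_pos h, mul_one]
      rw [h1]
      rcases hsgn with ⟨h, h'⟩ | ⟨h, h'⟩
      · rw [abs_of_nonneg h, abs_of_nonneg h']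
      · rw [abs_of_nonpos h, abs_of_nonpos h', neg_mul, neg_mul, Real.tanh_neg, mul_neg, neg_neg]
    rw [e1]
    set y := |S| / √k with hy
    have hy0 : 0 ≤ y := by positivity
    have e2 : (S / √k) ^ 2 = y ^ 2 := by rw [hy, div_pow, div_pow, sq_abs]
    have e4 : (S / √k) ^ 4 = y ^ 4 := by
      rw [show (4 : ℕ) = 2 * 2 from rfl, pow_mul, pow_mul, e2]
    rw [e2, e4]
    -- Here tanh z ≥ z/(1 + z), together with |artanh m| ≥ |m| and √k |m| ≤ B.
    have h1 : |m| * √k * (y / (1 + B * y)) ≤ Real.tanh (|Real.artanh m| * |S|) := by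
      refine le_trans ?_ (tanh_ge_div (by positivity))
      have hz : |m| * √k * y ≤ |Real.artanh m| * |S| := by
        have : √k * y = |S| := by rw [hy]; field_simp
        rw [mul_assoc, this]; gcongr
      have hz0 : 0 ≤ |m| * √k * y := by positivity
      calc |m| * √k * (y / (1 + B * y)) = (|m| * √k * y) / (1 + B * y) := by ring
        _ ≤ (|m| * √k * y) / (1 + |m| * √k * y) := by
            gcongr; linarith
        _ ≤ _ := by
            rw [div_le_div_iff₀ (by positivity) (by positivity)]
            nlinarith
    calc _ ≤ m ^ 2 * √k * (y / (1 + B * y)) := by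
          exact mul_le_mul_of_nonneg_left (hpoly y hy0) (by positivity)
      _ = |m| * (|m| * √k * (y / (1 + B * y))) := by rw [← sq_abs m]; ring
      _ ≤ _ := by gcongr
  rw [integral_sign_signSum μ hm hm1, ← integral_const_mul]
  refine le_trans ?_ (integral_mono .of_finite .of_finite hpt)
  rw [integral_const_mul, integral_div, integral_sub .of_finite .of_finite, integral_div]
  have m2 : 1 ≤ ∫ x, (signSum x / √k) ^ 2 ∂P := by
    simp_rw [div_pow]
    rw [integral_div, Real.sq_sqrt hk'.le, le_div_iff₀ hk', one_mul]
    exact integral_signSum_sq_ge μ hk hm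
  have m4 : (∫ x, (signSum x / √k) ^ 4 ∂P) / Q ^ 2 ≤ 1 / 2 := by
    rw [hQ2, div_le_iff₀ (by positivity)]
    refine (integral_signSum_pow_four_le μ hk hm hB).trans_eq ?_
    ring
  calc advantage B * √k * m ^ 2 = m ^ 2 * √k * ((1 - 1 / 2) / (Q * (1 + B * Q))) := by
        rw [advantage, ← hQdef]; field_simp; norm_num
    _ ≤ _ := by gcongr

end BiasedCoins

/-! ### Rearrangements of finite product measures -/

theorem integral_comp_measurePreserving {α β : Type*} [MeasurableSpace α] [MeasurableSpace β]
    [MeasurableSingletonClass β] [Finite β] {μ : Measure α} {ν : Measure β} {φ : α → β}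
    (h : MeasurePreserving φ μ ν) (g : β → ℝ) : ∫ a, g (φ a) ∂μ = ∫ b, g b ∂ν := by
  rw [← h.map_eq, integral_map h.measurable.aemeasurable
    (measurable_of_finite g).aestronglyMeasurable]

section Rearrange

variable {α β : Type*} [MeasurableSpace α] [MeasurableSingletonClass α] [Finite α]
  [MeasurableSpace β] [MeasurableSingletonClass β] [Finite β]

theorem measurePreserving_equiv_of_singleton {μ : Measure α} {ν : Measure β} (e : α ≃ β)
    (h : ∀ a, μ {a} = ν {e a}) : MeasurePreserving e μ ν := by
  refine ⟨measurable_of_finite _, Measure.ext_of_singleton fun b => ?_⟩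
  rw [Measure.map_apply (measurable_of_finite _) (measurableSet_singleton _)]
  have : e ⁻¹' {b} = {e.symm b} := by
    ext a
    simp [Equiv.eq_symm_apply]
  rw [this, h, Equiv.apply_symm_apply]

variable {ι κ : Type*} [Fintype ι] [Fintype κ]

theorem measurePreserving_pi_curry (μ : Measure α) [IsProbabilityMeasure μ] :
    MeasurePreserving (fun (x : ι × κ → α) i j => x (i, j)) (Measure.pi fun _ => μ)
      (Measure.pi fun _ => Measure.pi fun _ => μ) :=
  measurePreserving_equiv_of_singleton (Equiv.curry ι κ α) fun a => by
    simp [Measure.pi_singleton, Fintype.prod_prod_type, Equiv.curry]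

theorem measurePreserving_pi_prod (μ : Measure α) [IsProbabilityMeasure μ] (ν : Measure β)
    [IsProbabilityMeasure ν] :
    MeasurePreserving (fun x : ι → α × β => (fun i => (x i).1, fun i => (x i).2))
      (Measure.pi fun _ => μ.prod ν) ((Measure.pi fun _ => μ).prod (Measure.pi fun _ => ν)) :=
  measurePreserving_equiv_of_singleton (Equiv.arrowProdEquivProdArrow ι (fun _ => α) (fun _ => β)) fun a => by
    rw [← Set.singleton_prod_singleton, Measure.prod_prod]
    simp only [Measure.pi_singleton]
    rw [← Finset.prod_mul_distrib]
    refine Finset.prod_congr rfl fun i _ => ?_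
    rw [← Prod.mk.eta (p := a i), ← Set.singleton_prod_singleton, Measure.prod_prod]
    rfl

theorem measurePreserving_pi_option (μ : Measure α) [IsProbabilityMeasure μ] :
    MeasurePreserving (fun x : Option ι → α => (fun i => x (some i), x none))
      (Measure.pi fun _ => μ) ((Measure.pi fun _ => μ).prod μ) :=
  measurePreserving_equiv_of_singleton
    ⟨fun x : Option ι → α => (fun i => x (some i), x none), fun z o => o.elim z.2 z.1,
      fun x => by funext o; cases o <;> rfl, fun z => rfl⟩ fun a => by
    change _ = ((Measure.pi fun _ : ι => μ).prod μ) {((fun i => a (some i)), a none)}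
    rw [← Set.singleton_prod_singleton, Measure.prod_prod]
    simp [Measure.pi_singleton, Fintype.prod_option, mul_comm]

end Rearrange

/-! ### The weak learner -/

/-- The law of a fair coin. -/
abbrev fairCoin : Measure ℤˣ := (PMF.uniformOfFintype ℤˣ).toMeasure

theorem integral_fairCoin : ∫ s : ℤˣ, ((s : ℤ) : ℝ) ∂fairCoin = 0 := by
  rw [integral_units, Measure.real, Measure.real, PMF.toMeasure_apply_singleton _ _ (by simp),
    PMF.toMeasure_apply_singleton _ _ (by simp)]
  simp

/-- The law of a pair of independent samples. -/
abbrev pairLaw {n : ℕ} (p : Measure (Config n)) : Measure (Fin 2 → Config n) :=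
  Measure.pi fun _ => p

theorem measurePreserving_pairLaw {n : ℕ} (p : Measure (Config n)) [IsProbabilityMeasure p] :
    MeasurePreserving (fun y : Fin 2 → Config n => (y 0, y 1)) (pairLaw p) (p.prod p) :=
  measurePreserving_finTwoArrow p

theorem integral_centeredProduct {n : ℕ} (p : Measure (Config n)) [IsProbabilityMeasure p]
    (e : Pair n) :
    ∫ y, centeredProduct e (y 0) (y 1) ∂(pairLaw p) = 2 * spinCov p e.1.1 e.1.2 := by
  rw [integral_comp_measurePreserving (measurePreserving_pairLaw p)
    (fun z => centeredProduct e z.1 z.2), integral_prod _ .of_finite]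
  have : ∀ x y : Config n, centeredProduct e x y =
      spin x e.1.1 * spin x e.1.2 - spin x e.1.1 * spin y e.1.2 - spin x e.1.2 * spin y e.1.1 +
        spin y e.1.1 * spin y e.1.2 := fun x y => by rw [centeredProduct]; ring
  simp_rw [this]
  have h : ∀ x : Config n, ∫ y, (spin x e.1.1 * spin x e.1.2 - spin x e.1.1 * spin y e.1.2 -
      spin x e.1.2 * spin y e.1.1 + spin y e.1.1 * spin y e.1.2) ∂p =
      spin x e.1.1 * spin x e.1.2 - spin x e.1.1 * (∫ y, spin y e.1.2 ∂p) -
      spin x e.1.2 * (∫ y, spin y e.1.1 ∂p) + ∫ y, spin y e.1.1 * spin y e.1.2 ∂p := by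
    intro x
    rw [integral_add .of_finite .of_finite, integral_sub .of_finite .of_finite,
      integral_sub .of_finite .of_finite, integral_const_mul, integral_const_mul]
    simp [integral_const_mul]
  simp_rw [h]
  rw [integral_add .of_finite .of_finite, integral_sub .of_finite .of_finite,
    integral_sub .of_finite .of_finite, integral_mul_const, integral_mul_const, spinCov]
  simp
  ring

theorem integral_centeredStatistic {n : ℕ} (p : Measure (Config n)) [IsProbabilityMeasure p]
    (c : Pair n → ℝ) :
    ∫ y, centeredStatistic c (y 0) (y 1) ∂(pairLaw p) =
      2 * ∑ e, c e * spinCov p e.1.1 e.1.2 := by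
  simp only [centeredStatistic]
  rw [integral_finsetSum _ fun _ _ => .of_finite, Finset.mul_sum]
  refine Finset.sum_congr rfl fun e _ => ?_
  rw [integral_const_mul, integral_centeredProduct]
  ring

theorem variance_centeredStatistic_pairLaw {n : ℕ} (p : Measure (Config n))
    [IsProbabilityMeasure p] (c : Pair n → ℝ) :
    variance (fun y => centeredStatistic c (y 0) (y 1)) (pairLaw p) =
      variance (fun z : Config n × Config n => centeredStatistic c z.1 z.2) (p.prod p) := by
  rw [variance_eq_sub_of_finite, variance_eq_sub_of_finite,
    integral_comp_measurePreserving (measurePreserving_pairLaw p)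
      (fun z => centeredStatistic c z.1 z.2),
    integral_comp_measurePreserving (measurePreserving_pairLaw p)
      (fun z => centeredStatistic c z.1 z.2 ^ 2)]

theorem centeredProduct_cases {n : ℕ} (e : Pair n) (x y : Config n) :
    centeredProduct e x y = 0 ∨ centeredProduct e x y = 4 ∨ centeredProduct e x y = -4 := by
  unfold centeredProduct
  rcases spin_eq_one_or x e.1.1 with h1 | h1 <;> rcases spin_eq_one_or x e.1.2 with h2 | h2 <;>
    rcases spin_eq_one_or y e.1.1 with h3 | h3 <;> rcases spin_eq_one_or y e.1.2 with h4 | h4 <;>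
    rw [h1, h2, h3, h4] <;> norm_num

/-- The sign `rademacherSample` as an element of `{±1}`. -/
def rademacherSign {n : ℕ} (e : Pair n) (z : (Fin 2 → Config n) × ℤˣ) : ℤˣ :=
  if centeredProduct e (z.1 0) (z.1 1) = 0 then z.2
  else if centeredProduct e (z.1 0) (z.1 1) = 4 then 1 else -1

theorem cast_rademacherSign {n : ℕ} (e : Pair n) (z : (Fin 2 → Config n) × ℤˣ) :
    ((rademacherSign e z : ℤ) : ℝ) = rademacherSample e (z.1 0) (z.1 1) z.2 := by
  unfold rademacherSign rademacherSample
  rcases centeredProduct_cases e (z.1 0) (z.1 1) with h | h | h <;> rw [h] <;> norm_num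

/-- The law of one Rademacher sample of the weak learner. -/
def rademacherLaw {n : ℕ} (p : Measure (Config n)) (e : Pair n) : Measure ℤˣ :=
  ((pairLaw p).prod fairCoin).map (rademacherSign e)

instance {n : ℕ} (p : Measure (Config n)) [IsProbabilityMeasure p] (e : Pair n) :
    IsProbabilityMeasure (rademacherLaw p e) :=
  Measure.isProbabilityMeasure_map (measurable_of_finite _).aemeasurable

/-- Replacing zeros by fair coins keeps the mean, and the centered product has mean twice the
covariance. The resulting mean is at most 1/2 in absolute value, as the use of artanh requires it to
be less than 1. -/
theorem integral_rademacherLaw {n : ℕ} (p : Measure (Config n)) [IsProbabilityMeasure p]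
    (e : Pair n) :
    ∫ s, ((s : ℤ) : ℝ) ∂(rademacherLaw p e) = spinCov p e.1.1 e.1.2 / 2 := by
  rw [rademacherLaw, integral_map (measurable_of_finite _).aemeasurable
    (measurable_of_finite _).aestronglyMeasurable, integral_prod _ .of_finite]
  have : ∀ y : Fin 2 → Config n, ∫ b, ((rademacherSign e (y, b) : ℤ) : ℝ) ∂fairCoin =
      centeredProduct e (y 0) (y 1) / 4 := by
    intro y
    simp_rw [cast_rademacherSign, rademacherSample]
    by_cases h : centeredProduct e (y 0) (y 1) = 0
    · simp [h, integral_fairCoin]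
    · simp [h]
  simp_rw [this]
  rw [integral_div, integral_centeredProduct]
  ring

/-- The law of the samples and of the coins of one run of the weak learner. -/
abbrev learnLaw {n : ℕ} (p : Measure (Config n)) (k : ℕ) :
    Measure ((Fin k → Fin 2 → Config n) × (Pair n × Option (Fin k) → ℤˣ)) :=
  (Measure.pi fun _ => pairLaw p).prod (Measure.pi fun _ => fairCoin)

/-- The sign vector found by one run of the weak learner. -/
def learned {n k : ℕ} (z : (Fin k → Fin 2 → Config n) × (Pair n × Option (Fin k) → ℤˣ)) :
    Pair n → ℝ :=
  weakLearn z.1 fun e o => z.2 (e, o)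

theorem abs_learned {n k : ℕ}
    (z : (Fin k → Fin 2 → Config n) × (Pair n × Option (Fin k) → ℤˣ)) (e : Pair n) :
    |learned z e| = 1 := by
  simp only [learned, weakLearn]
  split_ifs with h
  · rcases Int.units_eq_one_or (z.2 (e, none)) with h' | h' <;> simp [h']
  · rcases Real.sign_apply_eq_of_ne_zero _ h with h' | h' <;> rw [h'] <;> simp

/-- The tie-breaking coin has mean zero, so in expectation it agrees with the convention that the
sign of 0 is 0. -/
theorem integral_learned {n k : ℕ} (p : Measure (Config n)) [IsProbabilityMeasure p]
    (e : Pair n) :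
    ∫ z, learned z e ∂(learnLaw p k) =
      ∫ x, Real.sign (signSum x) ∂(Measure.pi fun _ : Fin k => rademacherLaw p e) := by
  set G : (Fin k → Fin 2 → Config n) → (Fin k → ℤˣ) → ℤˣ → ℝ := fun X b s =>
    if ∑ i, rademacherSample e (X i 0) (X i 1) (b i) = 0 then ((s : ℤ) : ℝ)
    else Real.sign (∑ i, rademacherSample e (X i 0) (X i 1) (b i)) with hG
  have hcoin : ∀ X, ∫ ω, learned (X, ω) e
      ∂(Measure.pi fun _ : Pair n × Option (Fin k) => fairCoin) =
      ∫ b, Real.sign (∑ i, rademacherSample e (X i 0) (X i 1) (b i))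
        ∂(Measure.pi fun _ : Fin k => fairCoin) := by
    intro X
    have hmp : MeasurePreserving
        (fun ω : Pair n × Option (Fin k) → ℤˣ => (fun i => ω (e, some i), ω (e, none)))
        (Measure.pi fun _ => fairCoin) ((Measure.pi fun _ => fairCoin).prod fairCoin) :=
      (measurePreserving_pi_option (ι := Fin k) fairCoin).comp
        ((measurePreserving_eval (fun _ : Pair n => Measure.pi fun _ : Option (Fin k) => fairCoin)
          e).comp (measurePreserving_pi_curry fairCoin))
    have h := integral_comp_measurePreserving hmp fun z => G X z.1 z.2
    refine h.trans ?_
    rw [integral_prod _ .of_finite]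
    congr 1
    funext b
    simp only [hG]
    split_ifs with h0
    · rw [integral_fairCoin, h0, Real.sign_zero]
    · simp
  rw [integral_prod _ .of_finite]
  simp_rw [hcoin]
  have h1 := integral_comp_measurePreserving
    (measurePreserving_pi_prod (ι := Fin k) (pairLaw p) fairCoin)
    fun z => Real.sign (∑ i, rademacherSample e (z.1 i 0) (z.1 i 1) (z.2 i))
  rw [integral_prod _ .of_finite] at h1
  refine h1.symm.trans ?_
  have h2 : MeasurePreserving
      (fun (z : Fin k → (Fin 2 → Config n) × ℤˣ) i => rademacherSign e (z i))
      (Measure.pi fun _ => (pairLaw p).prod fairCoin) (Measure.pi fun _ => rademacherLaw p e) :=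
    measurePreserving_pi _ _ fun _ => ⟨measurable_of_finite _, rfl⟩
  rw [← integral_comp_measurePreserving h2]
  simp only [signSum, cast_rademacherSign]

theorem abs_spinCov_le {n : ℕ} (p : Measure (Config n)) [IsProbabilityMeasure p] (e : Pair n) :
    |spinCov p e.1.1 e.1.2| ≤ 1 := by
  have hvar : ∀ u, ∫ x, (spin x u - ∫ y, spin y u ∂p) ^ 2 ∂p ≤ 1 := by
    intro u
    have h : variance (fun x => spin x u) p = ∫ x, (spin x u - ∫ y, spin y u ∂p) ^ 2 ∂p :=
      variance_eq_integral (measurable_of_finite _).aemeasurable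
    rw [← h, variance_eq_sub_of_finite]
    have h2 : ∀ x : Config n, spin x u ^ 2 = 1 := fun x => by
      rw [← sq_abs, abs_spin, one_pow]
    simp_rw [h2]
    simp [sq_nonneg]
  have hcov : spinCov p e.1.1 e.1.2 = ∫ x, (spin x e.1.1 - ∫ y, spin y e.1.1 ∂p) *
      (spin x e.1.2 - ∫ y, spin y e.1.2 ∂p) ∂p := by
    simp_rw [sub_mul, mul_sub]
    rw [integral_sub .of_finite .of_finite, integral_sub .of_finite .of_finite,
      integral_sub .of_finite .of_finite, integral_mul_const, integral_const_mul, spinCov]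
    simp
  have h := integral_mul_sq_le p (fun x => spin x e.1.1 - ∫ y, spin y e.1.1 ∂p)
    (fun x => spin x e.1.2 - ∫ y, spin y e.1.2 ∂p)
  rw [← hcov] at h
  rw [← sq_le_one_iff_abs_le_one]
  exact h.trans (mul_le_one₀ (hvar _) (integral_nonneg fun _ => sq_nonneg _) (hvar _))

theorem spinCov_mul_integral_learned_ge {n k : ℕ} (hk : 0 < k) (p : Measure (Config n))
    [IsProbabilityMeasure p] (e : Pair n) {B : ℝ} (hB : √k * |spinCov p e.1.1 e.1.2| ≤ B) :
    advantage B * √k * spinCov p e.1.1 e.1.2 ^ 2 / 2 ≤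
      spinCov p e.1.1 e.1.2 * ∫ z, learned z e ∂(learnLaw p k) := by
  have hm := integral_rademacherLaw p e
  have h0 : |spinCov p e.1.1 e.1.2 / 2| = |spinCov p e.1.1 e.1.2| / 2 := by
    rw [abs_div, abs_two]
  have h1 : |spinCov p e.1.1 e.1.2 / 2| < 1 := by
    rw [h0]; linarith [abs_spinCov_le p e]
  have h2 : √k * |spinCov p e.1.1 e.1.2 / 2| ≤ B := by
    rw [h0]
    have : 0 ≤ √k * |spinCov p e.1.1 e.1.2| := by positivity
    linarith
  have h := mul_integral_sign_signSum_ge (rademacherLaw p e) hk hm h1 h2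
  rw [integral_learned]
  linarith

/-! ### The stages of the algorithm -/

theorem measureReal_prod_le {α β : Type*} [MeasurableSpace α] [MeasurableSingletonClass α]
    [Finite α] [MeasurableSpace β] [MeasurableSingletonClass β] [Finite β]
    (μ : Measure α) [IsProbabilityMeasure μ] (ν : Measure β) [IsProbabilityMeasure ν]
    (S : α → β → Prop) {c : ℝ} (h : ∀ a, ν.real {b | S a b} ≤ c) :
    (μ.prod ν).real {z | S z.1 z.2} ≤ c := by
  classical
  have e : (μ.prod ν).real {z | S z.1 z.2} =
      ∫ z, Set.indicator {z : α × β | S z.1 z.2} (fun _ => (1 : ℝ)) z ∂(μ.prod ν) := by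
    rw [integral_indicator (.of_discrete)]; simp
  rw [e, integral_prod _ .of_finite]
  calc _ = ∫ a, ν.real {b | S a b} ∂μ := by
        congr 1
        funext a
        have : ∀ b, Set.indicator {z : α × β | S z.1 z.2} (fun _ => (1 : ℝ)) (a, b) =
            Set.indicator {b | S a b} (fun _ => (1 : ℝ)) b := fun b => by
          simp [Set.indicator_apply]
        simp_rw [this]
        rw [integral_indicator (.of_discrete)]; simp
    _ ≤ ∫ _, c ∂μ := integral_mono .of_finite .of_finite h
    _ = c := by simp

theorem measureReal_prod_fst {α β : Type*} [MeasurableSpace α] [MeasurableSpace β]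
    (μ : Measure α) (ν : Measure β) [SFinite ν] [IsProbabilityMeasure ν] (A : Set α) :
    (μ.prod ν).real {z | z.1 ∈ A} = μ.real A := by
  have : {z : α × β | z.1 ∈ A} = A ×ˢ Set.univ := by ext; simp
  rw [this, Measure.real, Measure.prod_prod]
  simp [Measure.real]

theorem measureReal_prod_snd {α β : Type*} [MeasurableSpace α] [MeasurableSpace β]
    (μ : Measure α) (ν : Measure β) [SFinite ν] [IsProbabilityMeasure μ] (A : Set β) :
    (μ.prod ν).real {z | z.2 ∈ A} = ν.real A := by
  have : {z : α × β | z.2 ∈ A} = Set.univ ×ˢ A := by ext; simp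
  rw [this, Measure.real, Measure.prod_prod]
  simp [Measure.real]

/-- If `f ≤ b` has mean at least `a`, then `f ≥ a / 2` has probability at least `a / (2 b)`. -/
theorem le_measureReal_half_le {α : Type*} [MeasurableSpace α] [MeasurableSingletonClass α]
    [Finite α] (μ : Measure α) [IsProbabilityMeasure μ] (f : α → ℝ) {a b : ℝ} (hb : 0 < b)
    (hf : ∀ x, f x ≤ b) (ha : 0 ≤ a) (hmean : a ≤ ∫ x, f x ∂μ) :
    a / (2 * b) ≤ μ.real {x | a / 2 ≤ f x} := by
  have h : ∫ x, f x ∂μ ≤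
      ∫ x, (a / 2 + b * Set.indicator {x | a / 2 ≤ f x} (fun _ => (1 : ℝ)) x) ∂μ := by
    refine integral_mono .of_finite .of_finite fun x => ?_
    by_cases hx : a / 2 ≤ f x
    · simp [hx]; linarith [hf x]
    · simp [hx]; linarith
  rw [integral_add .of_finite .of_finite, integral_const_mul,
    integral_indicator (.of_discrete)] at h
  simp at h
  rw [div_le_iff₀ (by positivity)]
  linarith

section Stages

variable {A B C : Type*} [MeasurableSpace A] [MeasurableSpace B]
  [Finite B] [MeasurableSpace C]
  [Finite C] (μ : Measure A) [IsProbabilityMeasure μ]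
  (ν : Measure B) [IsProbabilityMeasure ν] (ξ : Measure C) [IsProbabilityMeasure ξ] (L : ℕ)

theorem measureReal_not_or_exists_le_fst (P : A → Prop) (M : B → C → Prop) :
    (μ.prod ((Measure.pi fun _ : Fin L => ν).prod ξ)).real
      {z | ¬ (P z.1 ∨ ∃ l, M (z.2.1 l) z.2.2)} ≤ μ.real {x | ¬ P x} :=
  (measureReal_mono (by intro z hz hl; exact hz (Or.inl hl))).trans
    (measureReal_prod_fst _ _ {x | ¬ P x}).le

variable [MeasurableSingletonClass B] [MeasurableSingletonClass C]

/-- The tests share their samples but are independent of the learned vectors. With these fixed, a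
union bound over the rounds applies. -/
theorem measureReal_or_exists_le (P : A → Prop) (M : B → C → Prop) {a b : ℝ}
    (ha : μ.real {x | P x} ≤ a) (hb : ∀ y, ξ.real {z | M y z} ≤ b) :
    (μ.prod ((Measure.pi fun _ : Fin L => ν).prod ξ)).real
      {z | P z.1 ∨ ∃ l, M (z.2.1 l) z.2.2} ≤ a + L * b := by
  rw [Set.ofPred_or]
  refine (measureReal_union_le _ _).trans (add_le_add ?_ ?_)
  · exact (measureReal_prod_fst _ _ {x | P x}).le.trans ha
  · refine (measureReal_prod_snd _ _ {z : (Fin L → B) × C | ∃ l, M (z.1 l) z.2}).le.trans ?_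
    refine measureReal_prod_le _ _ (fun (y : Fin L → B) z => ∃ l, M (y l) z) fun y => ?_
    rw [Set.ofPred_exists]
    refine (measureReal_iUnion_fintype_le _).trans ?_
    calc _ ≤ ∑ _ : Fin L, b := Finset.sum_le_sum fun l _ => hb _
      _ = _ := by simp

/-- Either all L independent rounds miss G, or some learned vector lies in G. In the second case,
once the vectors are fixed, only the test of one good vector has to succeed, so no union bound is
paid. -/
theorem measureReal_not_or_exists_le (P : A → Prop) (M : B → C → Prop) (G : Set B) {b : ℝ}
    (hb : ∀ y ∈ G, ξ.real {z | ¬ M y z} ≤ b) (hb0 : 0 ≤ b) :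
    (μ.prod ((Measure.pi fun _ : Fin L => ν).prod ξ)).real
      {z | ¬ (P z.1 ∨ ∃ l, M (z.2.1 l) z.2.2)} ≤ ν.real Gᶜ ^ L + b := by
  have hsub : {z : A × (Fin L → B) × C | ¬ (P z.1 ∨ ∃ l, M (z.2.1 l) z.2.2)} ⊆
      {z | z.2 ∈ {w : (Fin L → B) × C | (∀ l, w.1 l ∉ G) ∨
        ((∃ l, w.1 l ∈ G) ∧ ∀ l, ¬ M (w.1 l) w.2)}} := by
    intro z hz
    by_cases h : ∀ l, z.2.1 l ∉ G
    · exact Or.inl h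
    · push Not at h
      exact Or.inr ⟨h, fun l hl => hz (Or.inr ⟨l, hl⟩)⟩
  refine (measureReal_mono hsub).trans ?_
  rw [measureReal_prod_snd, Set.ofPred_or]
  refine (measureReal_union_le _ _).trans (add_le_add ?_ ?_)
  · refine (measureReal_prod_fst _ _ {y : Fin L → B | ∀ l, y l ∉ G}).le.trans ?_
    have : {y : Fin L → B | ∀ l, y l ∉ G} = Set.univ.pi fun _ => Gᶜ := by
      ext; simp
    rw [this, Measure.real, Measure.pi_pi, ENNReal.toReal_prod]
    simp [Measure.real]
  · refine measureReal_prod_le _ _ (fun (y : Fin L → B) z => (∃ l, y l ∈ G) ∧ ∀ l, ¬ M (y l) z)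
      fun y => ?_
    by_cases h : ∃ l, y l ∈ G
    · obtain ⟨l, hl⟩ := h
      exact (measureReal_mono fun z hz => hz.2 l).trans (hb _ hl)
    · simp [h, hb0]

end Stages

/-! ### The Chebyshev test and its majority vote -/

section Majority

variable {n k R : ℕ} {p : Measure (Config n)} [IsProbabilityMeasure p] {c β ε s : ℝ}
  {Γ : Pair n → ℝ}

theorem measure_majorityRejects_le
    (h : (Measure.pi fun _ : Fin k => pairLaw p).real {X | ChebyshevRejects c β ε s Γ X} ≤ 1 / 4) :
    (Measure.pi fun _ : Fin R => Measure.pi fun _ : Fin k => pairLaw p).real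
      {X | MajorityRejects c β ε s Γ X} ≤ Real.exp (-(R / 8)) := by
  refine (measureReal_mono fun X hX => ?_).trans (measure_le_two_mul_ncard_le _ R _ h)
  exact le_of_lt (Set.mem_ofPred.1 hX)

theorem measure_not_majorityRejects_le
    (h : (Measure.pi fun _ : Fin k => pairLaw p).real
      {X | ¬ ChebyshevRejects c β ε s Γ X} ≤ 1 / 4) :
    (Measure.pi fun _ : Fin R => Measure.pi fun _ : Fin k => pairLaw p).real
      {X | ¬ MajorityRejects c β ε s Γ X} ≤ Real.exp (-(R / 8)) := by
  refine (measureReal_mono fun X hX => ?_).trans (measure_le_two_mul_ncard_le _ R _ h)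
  have h1 := Set.ncard_add_ncard_compl {r : Fin R | ChebyshevRejects c β ε s Γ (X r)}
  rw [Nat.card_eq_fintype_card, Fintype.card_fin] at h1
  have h2 : {r : Fin R | ChebyshevRejects c β ε s Γ (X r)}ᶜ =
      {r | X r ∈ {X | ¬ ChebyshevRejects c β ε s Γ X}} := by
    ext; simp
  rw [h2] at h1
  have h3 := Set.mem_ofPred.1 hX
  rw [MajorityRejects] at h3
  rw [Set.mem_ofPred]
  omega

theorem chebyshevRejects_iff (hβ : 0 < β) (hs : 0 < s) (X : Fin k → Fin 2 → Config n) :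
    ChebyshevRejects c β ε s Γ X ↔
      c * ε / (4 * β * s) < sampleMean X fun y => centeredStatistic Γ (y 0) (y 1) := by
  rw [ChebyshevRejects, div_lt_iff₀ (by positivity), mul_comm (sampleMean _ _)]

theorem measure_chebyshevRejects_le (hβ : 0 < β) (hs : 0 < s) (hc : 0 < c) (hε : 0 < ε)
    (hmean : ∑ e, Γ e * spinCov p e.1.1 e.1.2 = 0)
    (hvar : 0 < k → 4 * variance (fun z : Config n × Config n => centeredStatistic Γ z.1 z.2)
      (p.prod p) ≤ k * (c * ε / (4 * β * s)) ^ 2) :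
    (Measure.pi fun _ : Fin k => pairLaw p).real {X | ChebyshevRejects c β ε s Γ X} ≤ 1 / 4 := by
  have hh : 0 < c * ε / (4 * β * s) := by positivity
  -- An empty sample has mean 0, below the positive threshold, so it never rejects.
  rcases Nat.eq_zero_or_pos k with rfl | hk
  · have : {X : Fin 0 → Fin 2 → Config n | ChebyshevRejects c β ε s Γ X} = ∅ := by
      ext X
      simp only [Set.mem_ofPred, chebyshevRejects_iff hβ hs]
      simp [sampleMean, hh.le]
    rw [this]; simp
  have hk' : (0 : ℝ) < k := by exact_mod_cast hk
  have h := measure_le_abs_sampleMean_sub_le (pairLaw p) hk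
    (fun y => centeredStatistic Γ (y 0) (y 1)) hh
  rw [integral_centeredStatistic, hmean, variance_centeredStatistic_pairLaw] at h
  refine (measureReal_mono fun X hX => ?_).trans (h.trans ?_)
  · rw [Set.mem_ofPred, chebyshevRejects_iff hβ hs] at hX
    rw [Set.mem_ofPred, mul_zero, sub_zero]
    exact hX.le.trans (le_abs_self _)
  · rw [div_le_iff₀ (by positivity)]
    linarith [hvar hk]

/-- The mean is at least twice the threshold h, so a failure to reject is a deviation of at least h,
just as a rejection is when the mean is 0. -/
theorem measure_not_chebyshevRejects_le (hβ : 0 < β) (hs : 0 < s) (hc : 0 < c) (hε : 0 < ε)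
    (hk : 0 < k)
    (hmean : 2 * (c * ε / (4 * β * s)) ≤ 2 * ∑ e, Γ e * spinCov p e.1.1 e.1.2)
    (hvar : 4 * variance (fun z : Config n × Config n => centeredStatistic Γ z.1 z.2)
      (p.prod p) ≤ k * (c * ε / (4 * β * s)) ^ 2) :
    (Measure.pi fun _ : Fin k => pairLaw p).real {X | ¬ ChebyshevRejects c β ε s Γ X} ≤ 1 / 4 := by
  have hh : 0 < c * ε / (4 * β * s) := by positivity
  have hk' : (0 : ℝ) < k := by exact_mod_cast hk
  have h := measure_le_abs_sampleMean_sub_le (pairLaw p) hk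
    (fun y => centeredStatistic Γ (y 0) (y 1)) hh
  rw [integral_centeredStatistic, variance_centeredStatistic_pairLaw] at h
  refine (measureReal_mono fun X hX => ?_).trans (h.trans ?_)
  · rw [Set.mem_ofPred, chebyshevRejects_iff hβ hs, not_lt] at hX
    rw [Set.mem_ofPred, abs_sub_comm]
    exact le_trans (by linarith) (le_abs_self _)
  · rw [div_le_iff₀ (by positivity)]
    linarith

end Majority

/-! ### Factorization of the law of a run over its stages -/

section Run

/-- The samples and coins of a run, sorted by stages. -/
def stages {κ ι J N A B : Type*} {k l : Type*}
    (run : (κ ⊕ (ι × k × Fin 2) ⊕ (N × l × Fin 2) → A) × (ι × J → B)) :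
    (κ → A) × (ι → (k → Fin 2 → A) × (J → B)) × (N → l → Fin 2 → A) :=
  (fun i => run.1 (Sum.inl i),
    fun r => (fun i j => run.1 (Sum.inr (Sum.inl (r, i, j))), fun o => run.2 (r, o)),
    fun r i j => run.1 (Sum.inr (Sum.inr (r, i, j))))

/-- Sorting a run by stages loses nothing. -/
def stagesEquiv {κ ι J N A B : Type*} {k l : Type*} :
    ((κ ⊕ (ι × k × Fin 2) ⊕ (N × l × Fin 2) → A) × (ι × J → B)) ≃
      (κ → A) × (ι → (k → Fin 2 → A) × (J → B)) × (N → l → Fin 2 → A) where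
  toFun := stages
  invFun z := (Sum.elim z.1 (Sum.elim (fun a => (z.2.1 a.1).1 a.2.1 a.2.2)
    fun a => z.2.2 a.1 a.2.1 a.2.2), fun a => (z.2.1 a.1).2 a.2)
  left_inv run := by
    refine Prod.ext (funext fun a => ?_) (funext fun a => rfl)
    rcases a with a | a | a <;> rfl
  right_inv z := rfl

theorem measurePreserving_stages {κ ι J N A B : Type*} {k l : Type*} [Fintype κ] [Fintype ι]
    [Fintype J] [Fintype N] [Fintype k] [Fintype l] [Finite A] [Finite B] [MeasurableSpace A]
    [MeasurableSingletonClass A] [MeasurableSpace B] [MeasurableSingletonClass B]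
    (p : Measure A) [IsProbabilityMeasure p] (q : Measure B) [IsProbabilityMeasure q] :
    MeasurePreserving (stages (κ := κ) (ι := ι) (J := J) (N := N) (k := k) (l := l))
      ((Measure.pi fun _ => p).prod (Measure.pi fun _ => q))
      ((Measure.pi fun _ => p).prod ((Measure.pi fun _ =>
        (Measure.pi fun _ => Measure.pi fun _ => p).prod (Measure.pi fun _ => q)).prod
          (Measure.pi fun _ => Measure.pi fun _ => Measure.pi fun _ => p))) := by
  refine measurePreserving_equiv_of_singleton stagesEquiv fun a => ?_
  obtain ⟨X, ω⟩ := a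
  have e : stagesEquiv (X, ω) = stages (X, ω) := rfl
  rw [e, stages]
  simp only [← Set.singleton_prod_singleton, Measure.prod_prod, Measure.pi_singleton,
    Fintype.prod_sum_type, Fintype.prod_prod_type, Finset.prod_mul_distrib]
  ring

variable (T : Tuning) {n : ℕ} (τ β ε : ℝ) (p : Measure (Config n)) [IsProbabilityMeasure p]

/-- The joint law of the samples of the Chebyshev tests. -/
abbrev testLaw (R k : ℕ) : Measure (Fin R → Fin k → Fin 2 → Config n) :=
  Measure.pi fun _ => Measure.pi fun _ => pairLaw p

theorem runLaw_real_stages (S : (Fin (T.locSize n τ β ε) → Config n) →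
      (Fin (T.numRounds n τ) → (Fin (T.learnSize n τ β ε) → Fin 2 → Config n) ×
        (Pair n × Option (Fin (T.learnSize n τ β ε)) → ℤˣ)) →
      (Fin (T.numRuns n τ) → Fin (T.testSize n τ β ε) → Fin 2 → Config n) → Prop) :
    (T.runLaw τ β ε p).real {run | S (stages run).1 (stages run).2.1 (stages run).2.2} =
      ((Measure.pi fun _ => p).prod ((Measure.pi fun _ => learnLaw p _).prod
        (testLaw p _ _))).real {z | S z.1 z.2.1 z.2.2} := by
  have h := measurePreserving_stages (κ := Fin (T.locSize n τ β ε)) (ι := Fin (T.numRounds n τ))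
    (J := Pair n × Option (Fin (T.learnSize n τ β ε))) (N := Fin (T.numRuns n τ))
    (k := Fin (T.learnSize n τ β ε)) (l := Fin (T.testSize n τ β ε)) p fairCoin
  exact h.measureReal_preimage (s := {z | S z.1 z.2.1 z.2.2})
    (Set.toFinite _).measurableSet.nullMeasurableSet

theorem runLaw_saysFar_le {a b : ℝ}
    (ha : (Measure.pi fun _ : Fin (T.locSize n τ β ε) => p).real
      {X | LocalizationFinds β (ε / (n : ℝ) ^ τ) X} ≤ a)
    (hb : ∀ Γ : Pair n → ℝ, (∀ e, |Γ e| ≤ 1) →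
      (testLaw p (T.numRuns n τ) (T.testSize n τ β ε)).real
        {X | MajorityRejects T.thr β ε ((n : ℝ) ^ (2 - τ)) Γ X} ≤ b) :
    (T.runLaw τ β ε p).real {run | T.SaysFar τ β ε run.1 run.2} ≤ a + T.numRounds n τ * b :=
  (runLaw_real_stages T τ β ε p fun x y z => LocalizationFinds β (ε / (n : ℝ) ^ τ) x ∨
    ∃ l, MajorityRejects T.thr β ε ((n : ℝ) ^ (2 - τ)) (learned (y l)) z).le.trans
  (measureReal_or_exists_le _ _ _ _ (fun x => LocalizationFinds β (ε / (n : ℝ) ^ τ) x)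
    (fun y z => MajorityRejects T.thr β ε ((n : ℝ) ^ (2 - τ)) (learned y) z) ha
    fun y => hb _ fun e => (abs_learned y e).le)

theorem runLaw_not_saysFar_le_localization :
    (T.runLaw τ β ε p).real {run | ¬ T.SaysFar τ β ε run.1 run.2} ≤
      (Measure.pi fun _ : Fin (T.locSize n τ β ε) => p).real
        {X | ¬ LocalizationFinds β (ε / (n : ℝ) ^ τ) X} :=
  (runLaw_real_stages T τ β ε p fun x y z => ¬ (LocalizationFinds β (ε / (n : ℝ) ^ τ) x ∨
    ∃ l, MajorityRejects T.thr β ε ((n : ℝ) ^ (2 - τ)) (learned (y l)) z)).le.trans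
  (measureReal_not_or_exists_le_fst _ _ _ _ (fun x => LocalizationFinds β (ε / (n : ℝ) ^ τ) x)
    fun y z => MajorityRejects T.thr β ε ((n : ℝ) ^ (2 - τ)) (learned y) z)

theorem runLaw_not_saysFar_le (G : Set (Pair n → ℝ)) {b : ℝ}
    (hb : ∀ Γ ∈ G, (∀ e, |Γ e| ≤ 1) →
      (testLaw p (T.numRuns n τ) (T.testSize n τ β ε)).real
        {X | ¬ MajorityRejects T.thr β ε ((n : ℝ) ^ (2 - τ)) Γ X} ≤ b) (hb0 : 0 ≤ b) :
    (T.runLaw τ β ε p).real {run | ¬ T.SaysFar τ β ε run.1 run.2} ≤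
      (learnLaw p (T.learnSize n τ β ε)).real {z | learned z ∈ G}ᶜ ^ T.numRounds n τ + b :=
  (runLaw_real_stages T τ β ε p fun x y z => ¬ (LocalizationFinds β (ε / (n : ℝ) ^ τ) x ∨
    ∃ l, MajorityRejects T.thr β ε ((n : ℝ) ^ (2 - τ)) (learned (y l)) z)).le.trans
  (measureReal_not_or_exists_le _ _ _ _ (fun x => LocalizationFinds β (ε / (n : ℝ) ^ τ) x)
    (fun y z => MajorityRejects T.thr β ε ((n : ℝ) ^ (2 - τ)) (learned y) z)
    {z | learned z ∈ G} (fun y hy => hb _ hy fun e => (abs_learned y e).le) hb0)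

end Run

/-! ### The choice of the constants -/

/-- The constant in the threshold. -/
def thresholdConst (η : ℝ) : ℝ := advantage (3 / (4 * η)) * (√2 / η)

theorem thresholdConst_pos {η : ℝ} (hη : 0 < η) : 0 < thresholdConst η :=
  mul_pos (advantage_pos (by positivity)) (by positivity)

/-- Constants for which the algorithm works in the high-temperature regime with margin `η`. -/
def tuning {η : ℝ} (hη : 0 < η) : Tuning where
  -- 27648 = 12 · 2304, where 2304 = 24² · 4 collects the accuracy ε/(24 β n^{4/3}), the halving in
  -- Hoeffding and the halving by the floor; the exponent is then at least 12 log n.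
  loc := 27648 / η ^ 2
  -- Since nβ/ε ≥ η/2 in the far case, 4/η² is what makes the rounded sample size at least 1.
  learn := 4 / η ^ 2
  -- A round succeeds with probability at least κ/(4 n^{2/3}), κ being the threshold constant, so
  -- all rounds fail with probability at most exp(-4).
  rounds := 16 / thresholdConst η
  thr := thresholdConst η
  -- 8192 = 4 · 64 · 32: Chebyshev at level 1/4, the variance bound, and the factor 4² · 2 from
  -- threshold and floor. The summand 1 keeps the size positive without an upper bound on the
  -- threshold constant.
  test := 8192 * (1 + 1 / thresholdConst η ^ 2) / η ^ 2
  boost := 8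
  -- The union bound over at most (16/κ + 1) n^{2/3} rounds totals 1/20.
  fail := 1 / (20 * (16 / thresholdConst η + 1))
  logExp := 0
  loc_pos := by positivity
  learn_pos := by positivity
  rounds_pos := div_pos (by norm_num) (thresholdConst_pos hη)
  thr_pos := thresholdConst_pos hη
  test_pos := by have := thresholdConst_pos hη; positivity
  boost_pos := by norm_num
  fail_pos := by have := thresholdConst_pos hη; positivity

/-- The cube root of `n`. -/
def cbrt (n : ℕ) : ℝ := (n : ℝ) ^ (1 / 3 : ℝ)

theorem cbrt_pow (n k : ℕ) : cbrt n ^ k = (n : ℝ) ^ (k / 3 : ℝ) := by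
  rw [cbrt, ← Real.rpow_mul_natCast (Nat.cast_nonneg n)]
  ring_nf

theorem cbrt_pow_three (n : ℕ) : cbrt n ^ 3 = n := by
  rw [cbrt_pow]; norm_num

theorem one_le_cbrt {n : ℕ} (hn : 0 < n) : 1 ≤ cbrt n :=
  Real.one_le_rpow (by exact_mod_cast hn) (by norm_num)

theorem half_le_floor {x : ℝ} (hx : 1 ≤ x) : x / 2 ≤ ⌊x⌋₊ := by
  have h1 := Nat.lt_floor_add_one x
  have h2 : (1 : ℝ) ≤ ⌊x⌋₊ := by exact_mod_cast Nat.one_le_floor_iff x |>.2 hx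
  linarith

theorem half_le_floor_of_pos {x : ℝ} (hx : 0 < ⌊x⌋₊) : x / 2 ≤ ⌊x⌋₊ :=
  half_le_floor (Nat.floor_pos.1 hx)

/-! ### The sizes at τ = 4/3 as powers of the cube root of n -/

section Sizes

variable (T : Tuning) (n : ℕ) (β ε : ℝ)

theorem locSize_eq : T.locSize n (4 / 3) β ε =
    ⌊T.loc * cbrt n ^ 8 * β ^ 2 * Real.log n / ε ^ 2⌋₊ := by
  rw [Tuning.locSize, cbrt_pow]; norm_num

theorem numRounds_eq : T.numRounds n (4 / 3) = ⌈T.rounds * cbrt n ^ 2⌉₊ := by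
  rw [Tuning.numRounds, cbrt_pow]; norm_num

theorem learnSize_eq : T.learnSize n (4 / 3) β ε = ⌊T.learn * cbrt n ^ 8 * β ^ 2 / ε ^ 2⌋₊ := by
  rw [Tuning.learnSize, cbrt_pow]; norm_num

theorem testSize_eq (hT : T.logExp = 0) :
    T.testSize n (4 / 3) β ε = ⌊T.test * cbrt n ^ 10 * β ^ 2 / ε ^ 2⌋₊ := by
  have h : (n : ℝ) ^ (4 - 2 * (4 / 3) : ℝ) = cbrt n ^ 4 := by rw [cbrt_pow]; norm_num
  rw [Tuning.testSize, Tuning.sigmaSq, hT, h, ← cbrt_pow_three]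
  ring_nf

theorem delta_eq : T.delta n (4 / 3) = T.fail / cbrt n ^ 2 := by
  rw [Tuning.delta, cbrt_pow]; norm_num

theorem exp_neg_numRuns_le (hT : T.boost = 8) (hn : 0 < n) :
    Real.exp (-(T.numRuns n (4 / 3) / 8)) ≤ T.fail / cbrt n ^ 2 := by
  have hu := one_le_cbrt hn
  have hf := T.fail_pos
  have hδ : 0 < T.fail / cbrt n ^ 2 := by positivity
  rw [← Real.le_log_iff_exp_le hδ]
  have h := Nat.le_ceil (T.boost * Real.log (1 / T.delta n (4 / 3)))
  change _ ≤ (T.numRuns n (4 / 3) : ℝ) at h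
  rw [hT, delta_eq, one_div, Real.log_inv] at h
  linarith

end Sizes

theorem numSamples_le {η : ℝ} (hη : 0 < η) :
    ∃ C : ℝ, 0 ≤ C ∧ ∀ (n : ℕ) (β ε : ℝ), 0 ≤ β → 0 < ε →
      ((tuning hη).numSamples n (4 / 3) β ε : ℝ) ≤
        C * (1 + Real.log n) * ((n : ℝ) ^ (10 / 3 : ℝ) * β ^ 2 / ε ^ 2) := by
  set T := tuning hη with hT
  have hloc := T.loc_pos
  have hlearn := T.learn_pos
  have hrounds := T.rounds_pos
  have htest := T.test_pos
  have hfail := T.fail_pos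
  have hfail1 : T.fail ≤ 1 := by
    have := thresholdConst_pos hη
    change 1 / (20 * (16 / thresholdConst η + 1)) ≤ 1
    rw [div_le_one (by positivity)]
    have : 0 < 16 / thresholdConst η := by positivity
    linarith
  have hlf : 0 ≤ Real.log (1 / T.fail) := Real.log_nonneg (by rwa [le_div_iff₀ hfail, one_mul])
  refine ⟨T.loc + (T.rounds + 1) * (T.learn * 2) + (9 + 8 * Real.log (1 / T.fail)) * (T.test * 2),
    by positivity, fun n β ε hβ hε => ?_⟩
  have hcard : (T.numSamples n (4 / 3) β ε : ℝ) = T.locSize n (4 / 3) β ε +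
      (T.numRounds n (4 / 3) * (T.learnSize n (4 / 3) β ε * 2) +
        T.numRuns n (4 / 3) * (T.testSize n (4 / 3) β ε * 2)) := by
    simp [Tuning.numSamples]
  have h10 : (n : ℝ) ^ (10 / 3 : ℝ) = cbrt n ^ 10 := by rw [cbrt_pow]; norm_num
  rw [hcard, h10, locSize_eq, numRounds_eq, learnSize_eq, testSize_eq T n β ε rfl]
  rcases Nat.eq_zero_or_pos n with rfl | hn
  · simp [cbrt]
  have hu := one_le_cbrt hn
  have hl : 0 ≤ Real.log n := Real.log_natCast_nonneg n
  set u := cbrt n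
  have b1 : (⌊T.loc * u ^ 8 * β ^ 2 * Real.log n / ε ^ 2⌋₊ : ℝ) ≤
      T.loc * (1 + Real.log n) * (u ^ 10 * β ^ 2 / ε ^ 2) := by
    refine (Nat.floor_le (by positivity)).trans ?_
    calc T.loc * u ^ 8 * β ^ 2 * Real.log n / ε ^ 2 =
          T.loc * Real.log n * (u ^ 8 * β ^ 2 / ε ^ 2) := by ring
      _ ≤ _ := by gcongr <;> linarith
  have b2 : (⌈T.rounds * u ^ 2⌉₊ : ℝ) ≤ (T.rounds + 1) * u ^ 2 := by
    refine (Nat.ceil_lt_add_one (by positivity)).le.trans ?_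
    nlinarith [one_le_pow₀ hu (n := 2)]
  have b3 : (⌊T.learn * u ^ 8 * β ^ 2 / ε ^ 2⌋₊ : ℝ) ≤ T.learn * u ^ 8 * β ^ 2 / ε ^ 2 :=
    Nat.floor_le (by positivity)
  have b4 : (⌊T.test * u ^ 10 * β ^ 2 / ε ^ 2⌋₊ : ℝ) ≤ T.test * u ^ 10 * β ^ 2 / ε ^ 2 :=
    Nat.floor_le (by positivity)
  have b5 : (T.numRuns n (4 / 3) : ℝ) ≤ (9 + 8 * Real.log (1 / T.fail)) * (1 + Real.log n) := by
    have e : Real.log (1 / T.delta n (4 / 3)) = 2 / 3 * Real.log n + Real.log (1 / T.fail) := by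
      have hn' : (0 : ℝ) < n := by exact_mod_cast hn
      have h2 : cbrt n ^ 2 = (n : ℝ) ^ (2 / 3 : ℝ) := by rw [cbrt_pow]; norm_num
      rw [delta_eq, one_div_div, div_eq_mul_one_div, Real.log_mul (by positivity) (by positivity),
        h2, Real.log_rpow hn']
    have h := (Nat.ceil_lt_add_one (a := T.boost * Real.log (1 / T.delta n (4 / 3)))
      (by rw [e]; have := T.boost_pos; positivity)).le
    change (T.numRuns n (4 / 3) : ℝ) ≤ _ at h
    have h8 : T.boost = 8 := rfl
    rw [e, h8] at h
    nlinarith [mul_nonneg hlf hl]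
  calc _ ≤ T.loc * (1 + Real.log n) * (u ^ 10 * β ^ 2 / ε ^ 2) +
        ((T.rounds + 1) * u ^ 2 * (T.learn * u ^ 8 * β ^ 2 / ε ^ 2 * 2) +
        (9 + 8 * Real.log (1 / T.fail)) * (1 + Real.log n) *
          (T.test * u ^ 10 * β ^ 2 / ε ^ 2 * 2)) := by gcongr
    _ = (T.loc * (1 + Real.log n) + (T.rounds + 1) * (T.learn * 2) * 1 +
        (9 + 8 * Real.log (1 / T.fail)) * (T.test * 2) * (1 + Real.log n)) *
          (u ^ 10 * β ^ 2 / ε ^ 2) := by ring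
    _ ≤ (T.loc * (1 + Real.log n) + (T.rounds + 1) * (T.learn * 2) * (1 + Real.log n) +
        (9 + 8 * Real.log (1 / T.fail)) * (T.test * 2) * (1 + Real.log n)) *
          (u ^ 10 * β ^ 2 / ε ^ 2) := by gcongr; linarith
    _ = _ := by ring

/-! ### Accuracy of localization and testing; product laws -/

section Analysis

variable {η : ℝ} (hη : 0 < η) {n : ℕ} {β ε : ℝ}

/-- With t = ε/(24 β n^{4/3}) the localization threshold is 6t and every covariance is estimated
within 3t. So zero covariances are never flagged, and covariances above 9t always are, on this
event. -/
theorem localization_close (hη1 : η ≤ 1) (hn : 0 < n) (hβ : 0 < β) (hε : 0 < ε)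
    (p : Measure (Config n)) [IsProbabilityMeasure p]
    (hk : 0 < (tuning hη).locSize n (4 / 3) β ε) :
    (Measure.pi fun _ : Fin ((tuning hη).locSize n (4 / 3) β ε) => p).real
      {X | ∃ e : Pair n, 3 * (ε / (24 * β * cbrt n ^ 4)) <
        |sampleCov X e - spinCov p e.1.1 e.1.2|} ≤ 1 / 100 := by
  have hu := one_le_cbrt hn
  have hloc : 27648 ≤ (tuning hη).loc := by
    change (27648 : ℝ) ≤ 27648 / η ^ 2
    rw [le_div_iff₀ (by positivity)]
    nlinarith
  -- For n = 1 the factor log n is 0 and no sample is taken. From n ≥ 2 on, the failure probability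
  -- 6/n^{10} is small.
  have hn2 : 2 ≤ n := by
    by_contra h
    obtain rfl : n = 1 := by omega
    simp [locSize_eq] at hk
  have hn2' : (2 : ℝ) ≤ n := by exact_mod_cast hn2
  have hl : 0 ≤ Real.log n := Real.log_natCast_nonneg n
  refine (measure_sampleCov_far_le hk p (by positivity)).trans ?_
  have hsize : (tuning hη).loc * cbrt n ^ 8 * β ^ 2 * Real.log n / ε ^ 2 / 2 ≤
      (tuning hη).locSize n (4 / 3) β ε := by
    rw [locSize_eq] at hk ⊢
    exact half_le_floor_of_pos hk
  have hexp : 12 * Real.log n ≤ (tuning hη).locSize n (4 / 3) β ε *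
      (ε / (24 * β * cbrt n ^ 4)) ^ 2 / 2 := by
    calc 12 * Real.log n ≤ (tuning hη).loc / 2304 * Real.log n := by gcongr; linarith
      _ = (tuning hη).loc * cbrt n ^ 8 * β ^ 2 * Real.log n / ε ^ 2 / 2 *
          (ε / (24 * β * cbrt n ^ 4)) ^ 2 / 2 := by field_simp; ring
      _ ≤ _ := by gcongr
  calc _ ≤ 6 * (n : ℝ) ^ 2 * Real.exp (-(12 * Real.log n)) := by gcongr
    _ = 6 / (n : ℝ) ^ 10 := by
        rw [Real.exp_neg, show 12 * Real.log n = ((12 : ℕ) : ℝ) * Real.log n by norm_num,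
          Real.exp_nat_mul, Real.exp_log (by linarith)]
        field_simp
    _ ≤ 6 / 2 ^ 10 := by gcongr
    _ ≤ 1 / 100 := by norm_num

theorem variance_le_test (hη1 : η ≤ 1) (hn : 0 < n) (hβ : 0 < β) (hε : 0 < ε)
    {θ : IsingParams n} (hθ : θ.HighTemperature η) {Γ : Pair n → ℝ} (hΓ : ∀ e, |Γ e| ≤ 1)
    (hk : 0 < (tuning hη).testSize n (4 / 3) β ε) :
    4 * variance (fun z : Config n × Config n => centeredStatistic Γ z.1 z.2)
      (θ.law.prod θ.law) ≤ (tuning hη).testSize n (4 / 3) β ε *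
        ((tuning hη).thr * ε / (4 * β * cbrt n ^ 2)) ^ 2 := by
  have hu := one_le_cbrt hn
  have hκ := (tuning hη).thr_pos
  have hsize : (tuning hη).test * cbrt n ^ 10 * β ^ 2 / ε ^ 2 / 2 ≤
      (tuning hη).testSize n (4 / 3) β ε := by
    rw [testSize_eq _ _ _ _ rfl] at hk ⊢
    exact half_le_floor_of_pos hk
  have htest : 8192 / η ^ 2 ≤ (tuning hη).test * (tuning hη).thr ^ 2 := by
    change _ ≤ 8192 * (1 + 1 / (tuning hη).thr ^ 2) / η ^ 2 * (tuning hη).thr ^ 2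
    have : 8192 * (1 + 1 / (tuning hη).thr ^ 2) / η ^ 2 * (tuning hη).thr ^ 2 =
        8192 * ((tuning hη).thr ^ 2 + 1) / η ^ 2 := by field_simp
    rw [this]
    gcongr
    nlinarith
  calc _ ≤ 4 * (64 * (n : ℝ) ^ 2 / η ^ 2) := by
        gcongr; exact θ.variance_centeredStatistic_le hη hη1 hθ Γ hΓ
    _ = 8192 / η ^ 2 * cbrt n ^ 6 / 32 := by rw [← cbrt_pow_three]; ring
    _ ≤ (tuning hη).test * (tuning hη).thr ^ 2 * cbrt n ^ 6 / 32 := by gcongr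
    _ = (tuning hη).test * cbrt n ^ 10 * β ^ 2 / ε ^ 2 / 2 *
        ((tuning hη).thr * ε / (4 * β * cbrt n ^ 2)) ^ 2 := by field_simp; ring
    _ ≤ _ := by gcongr

theorem not_saysFar_of_trivial (T : Tuning) (hε : 0 < ε) (h : n = 0 ∨ β = 0)
    (X : T.SampleIdx n (4 / 3) β ε → Config n) (ω : T.CoinIdx n (4 / 3) β ε → ℤˣ) :
    ¬ T.SaysFar (4 / 3) β ε X ω := by
  have hthr := T.thr_pos
  rintro (⟨e, he⟩ | ⟨l, hl⟩)
  · have hn : 0 < n := e.1.1.pos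
    have hn' : (0 : ℝ) < n := by exact_mod_cast hn
    rcases h with rfl | rfl
    · exact absurd hn (lt_irrefl 0)
    · simp only [mul_zero, zero_mul] at he
      have : 0 < ε / (n : ℝ) ^ (4 / 3 : ℝ) := by positivity
      linarith
  · have hno : ∀ Γ k (Y : Fin k → Fin 2 → Config n),
        ¬ ChebyshevRejects T.thr β ε ((n : ℝ) ^ (2 - 4 / 3 : ℝ)) Γ Y := by
      intro Γ k Y hY
      have hpos : 0 < T.thr * ε := by positivity
      rcases h with rfl | rfl
      · have : ∀ x y : Config 0, centeredStatistic Γ x y = 0 := fun x y => by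
          have : IsEmpty (Pair 0) := ⟨fun e => e.1.1.elim0⟩
          simp [centeredStatistic]
        simp [ChebyshevRejects, this, sampleMean] at hY
        linarith
      · simp [ChebyshevRejects] at hY
        linarith
    simp only [MajorityRejects, hno] at hl
    simp at hl

theorem saysFar_le_of_product (hη1 : η ≤ 1) (hβ : 0 ≤ β) (hε : 0 < ε) {θ : IsingParams n}
    (hθ : θ.HighTemperature η) (hp : θ.law ∈ productLaws n) :
    ((tuning hη).runLaw (4 / 3) β ε θ.law).real
      {run | (tuning hη).SaysFar (4 / 3) β ε run.1 run.2} ≤ 1 / 10 := by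
  -- In these cases the cleared inequalities reject nothing, whereas the thresholds divided by β
  -- below would be meaningless.
  by_cases htriv : n = 0 ∨ β = 0
  · have : {run : ((tuning hη).SampleIdx n (4 / 3) β ε → Config n) ×
        ((tuning hη).CoinIdx n (4 / 3) β ε → ℤˣ) |
        (tuning hη).SaysFar (4 / 3) β ε run.1 run.2} = ∅ := by
      ext run
      simp [not_saysFar_of_trivial (tuning hη) hε htriv]
    rw [this]; simp
  push Not at htriv
  have hn : 0 < n := Nat.pos_of_ne_zero htriv.1
  have hβ : 0 < β := hβ.lt_of_ne' htriv.2
  have hu := one_le_cbrt hn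
  have hcov : ∀ e : Pair n, spinCov θ.law e.1.1 e.1.2 = 0 := fun e =>
    spinCov_eq_zero_of_mem_productLaws hp e.2.ne
  have h4 : (n : ℝ) ^ (4 / 3 : ℝ) = cbrt n ^ 4 := by rw [cbrt_pow]; norm_num
  have h2 : (n : ℝ) ^ (2 - 4 / 3 : ℝ) = cbrt n ^ 2 := by rw [cbrt_pow]; norm_num
  have hloc : (Measure.pi fun _ : Fin ((tuning hη).locSize n (4 / 3) β ε) => θ.law).real
      {X | LocalizationFinds β (ε / (n : ℝ) ^ (4 / 3 : ℝ)) X} ≤ 1 / 100 := by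
    rcases Nat.eq_zero_or_pos ((tuning hη).locSize n (4 / 3) β ε) with h0 | hk
    · have : {X : Fin ((tuning hη).locSize n (4 / 3) β ε) → Config n |
          LocalizationFinds β (ε / (n : ℝ) ^ (4 / 3 : ℝ)) X} = ∅ := by
        ext X
        have hpos : 0 < ε / (n : ℝ) ^ (4 / 3 : ℝ) := by rw [h4]; positivity
        simp [LocalizationFinds, sampleCov, sampleMean, h0, hpos]
      rw [this]; simp
    · refine (measureReal_mono fun X hX => ?_).trans (localization_close hη hη1 hn hβ hε θ.law hk)
      obtain ⟨e, he⟩ := hX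
      refine ⟨e, ?_⟩
      rw [hcov, sub_zero]
      rw [h4] at he
      have h1 : ε / (4 * β * cbrt n ^ 4) ≤ |sampleCov X e| := by
        rw [div_le_iff₀ (by positivity)] at he ⊢
        linarith
      refine lt_of_lt_of_le ?_ h1
      have : 3 * (ε / (24 * β * cbrt n ^ 4)) = ε / (4 * β * cbrt n ^ 4) / 2 := by
        field_simp; norm_num
      rw [this]
      exact half_lt_self (by positivity)
  have htest : ∀ Γ : Pair n → ℝ, (∀ e, |Γ e| ≤ 1) →
      (testLaw θ.law ((tuning hη).numRuns n (4 / 3)) ((tuning hη).testSize n (4 / 3) β ε)).real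
        {X | MajorityRejects (tuning hη).thr β ε ((n : ℝ) ^ (2 - 4 / 3 : ℝ)) Γ X} ≤
        (tuning hη).fail / cbrt n ^ 2 := by
    intro Γ hΓ
    rw [h2]
    refine (measure_majorityRejects_le ?_).trans (exp_neg_numRuns_le _ _ rfl hn)
    refine measure_chebyshevRejects_le hβ (by positivity) (tuning hη).thr_pos hε (by simp [hcov]) ?_
    exact fun hk => variance_le_test hη hη1 hn hβ hε hθ hΓ hk
  refine (runLaw_saysFar_le _ _ _ _ _ hloc htest).trans ?_
  have hκ := thresholdConst_pos hη
  have hr : ((tuning hη).numRounds n (4 / 3) : ℝ) ≤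
      (16 / thresholdConst η + 1) * cbrt n ^ 2 := by
    rw [numRounds_eq]
    refine (Nat.ceil_lt_add_one (by have := (tuning hη).rounds_pos; positivity)).le.trans ?_
    change 16 / thresholdConst η * cbrt n ^ 2 + 1 ≤ _
    nlinarith [one_le_pow₀ hu (n := 2)]
  have hf := (tuning hη).fail_pos
  -- The number of rounds times the failure probability of one boosted test: the powers of n cancel.
  calc _ ≤ 1 / 100 + (16 / thresholdConst η + 1) * cbrt n ^ 2 *
        ((tuning hη).fail / cbrt n ^ 2) := by gcongr
    _ = 1 / 100 + (16 / thresholdConst η + 1) * (tuning hη).fail := by field_simp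
    _ = 1 / 100 + 1 / 20 := by
        change 1 / 100 + (16 / thresholdConst η + 1) *
          (1 / (20 * (16 / thresholdConst η + 1))) = _
        have : 0 < 16 / thresholdConst η + 1 := by positivity
        field_simp
    _ ≤ _ := by norm_num

end Analysis

/-- Used for the exponents 8 and 10 to show that the sample sizes survive rounding down; the sixth
power of the cube root is n², which already suffices. -/
theorem one_le_scaled {η : ℝ} (hη : 0 < η) {n : ℕ} {β ε : ℝ} (hn : 0 < n) (hβ : 0 < β)
    (hε : 0 < ε) (h : η / 2 ≤ n * β / ε) {m : ℕ} (hm : 6 ≤ m) : 1 ≤ 4 / η ^ 2 * (cbrt n ^ m * β ^ 2 / ε ^ 2) := by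
  have hu := one_le_cbrt hn
  calc 1 = 4 / η ^ 2 * (η / 2) ^ 2 := by field_simp; norm_num
    _ ≤ 4 / η ^ 2 * (n * β / ε) ^ 2 := by gcongr
    _ = 4 / η ^ 2 * (cbrt n ^ 6 * β ^ 2 / ε ^ 2) := by rw [← cbrt_pow_three]; ring
    _ ≤ _ := by gcongr

/-! ### Models far from independence -/

section Far

variable {η : ℝ} (hη : 0 < η) {n : ℕ} {β ε : ℝ}

theorem not_saysFar_le_of_large_cov (hη1 : η ≤ 1) (hn : 0 < n) (hβ : 0 < β) (hε : 0 < ε)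
    (hscale : η / 2 ≤ n * β / ε) (p : Measure (Config n)) [IsProbabilityMeasure p] (e : Pair n)
    (he : 9 * (ε / (24 * β * cbrt n ^ 4)) < |spinCov p e.1.1 e.1.2|) :
    ((tuning hη).runLaw (4 / 3) β ε p).real
      {run | ¬ (tuning hη).SaysFar (4 / 3) β ε run.1 run.2} ≤ 1 / 10 := by
  have hu := one_le_cbrt hn
  have h4 : (n : ℝ) ^ (4 / 3 : ℝ) = cbrt n ^ 4 := by rw [cbrt_pow]; norm_num
  have hn2 : (2 : ℝ) ≤ n := by
    have h1 := Fin.lt_def.1 e.2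
    have h2 := e.1.2.isLt
    exact_mod_cast (by omega : 2 ≤ n)
  have hlog : 1 / 2 ≤ Real.log n := by
    have h1 := Real.log_two_gt_d9
    have h2 := Real.log_le_log (by norm_num) hn2
    linarith
  have hk : 0 < (tuning hη).locSize n (4 / 3) β ε := by
    rw [locSize_eq, Nat.floor_pos]
    have h8 := one_le_scaled hη hn hβ hε hscale (m := 8) (by norm_num)
    change 1 ≤ 27648 / η ^ 2 * cbrt n ^ 8 * β ^ 2 * Real.log n / ε ^ 2
    have : 27648 / η ^ 2 * cbrt n ^ 8 * β ^ 2 * Real.log n / ε ^ 2 =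
        6912 * (4 / η ^ 2 * (cbrt n ^ 8 * β ^ 2 / ε ^ 2)) * Real.log n := by ring
    rw [this]
    nlinarith
  refine (runLaw_not_saysFar_le_localization _ _ _ _ _).trans ?_
  refine le_trans ?_ ((localization_close hη hη1 hn hβ hε p hk).trans (by norm_num))
  refine measureReal_mono fun X hX => ⟨e, ?_⟩
  by_contra hcon
  rw [not_lt] at hcon
  refine hX ⟨e, ?_⟩
  rw [h4]
  have h1 := abs_sub_abs_le_abs_sub (spinCov p e.1.1 e.1.2) (sampleCov X e)
  rw [abs_sub_comm] at h1
  have h2 : 6 * (ε / (24 * β * cbrt n ^ 4)) ≤ |sampleCov X e| := by linarith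
  calc ε / cbrt n ^ 4 = 4 * β * (6 * (ε / (24 * β * cbrt n ^ 4))) := by field_simp; norm_num
    _ ≤ _ := by gcongr

/-- The lower bound, with the factor 2 lost to the floor giving √2 in place of 2, drives the
advantage of the learner. The upper bound keeps the bias √k |λ_e| within the range of `advantage`.
-/
theorem learnSize_bounds (hn : 0 < n) (hβ : 0 < β) (hε : 0 < ε)
    (hscale : η / 2 ≤ n * β / ε) :
    0 < (tuning hη).learnSize n (4 / 3) β ε ∧
    √2 / η * (cbrt n ^ 4 * β / ε) ≤ √((tuning hη).learnSize n (4 / 3) β ε) ∧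
    √((tuning hη).learnSize n (4 / 3) β ε) ≤ 2 / η * (cbrt n ^ 4 * β / ε) := by
  have hu := one_le_cbrt hn
  have h8 := one_le_scaled hη hn hβ hε hscale (m := 8) (by norm_num)
  have e : (tuning hη).learn * cbrt n ^ 8 * β ^ 2 / ε ^ 2 =
      4 / η ^ 2 * (cbrt n ^ 8 * β ^ 2 / ε ^ 2) := by
    change 4 / η ^ 2 * cbrt n ^ 8 * β ^ 2 / ε ^ 2 = _
    ring
  rw [learnSize_eq, e]
  refine ⟨Nat.floor_pos.2 h8, Real.le_sqrt_of_sq_le ?_, Real.sqrt_le_iff.2 ⟨by positivity, ?_⟩⟩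
  · refine le_trans (le_of_eq ?_) (half_le_floor h8)
    rw [mul_pow, div_pow, Real.sq_sqrt (by norm_num)]
    ring
  · refine (Nat.floor_le (by positivity)).trans_eq ?_
    ring

theorem sq_sum_abs_le (l : Pair n → ℝ) : (∑ e, |l e|) ^ 2 ≤ n ^ 2 * ∑ e, l e ^ 2 := by
  have h := sq_sum_le_card_mul_sum_sq (s := Finset.univ) (f := fun e => |l e|)
  simp only [sq_abs, Finset.card_univ] at h
  refine h.trans ?_
  gcongr
  exact card_pair_le n

/-- With probability of order `n ^ (-2/3)`, a run of the weak learner finds a sign vector for which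
the statistic has mean well above the threshold. -/
theorem learned_good_ge (hn : 0 < n) (hβ : 0 < β) (hε : 0 < ε) (hscale : η / 2 ≤ n * β / ε)
    (p : Measure (Config n)) [IsProbabilityMeasure p]
    (hsmall : ∀ e : Pair n, |spinCov p e.1.1 e.1.2| ≤ 9 * (ε / (24 * β * cbrt n ^ 4)))
    (hlarge : ε / β ≤ ∑ e : Pair n, |spinCov p e.1.1 e.1.2|) :
    thresholdConst η / (4 * cbrt n ^ 2) ≤
      (learnLaw p ((tuning hη).learnSize n (4 / 3) β ε)).real
        {z | learned z ∈ {Γ : Pair n → ℝ | 2 * (thresholdConst η * ε / (4 * β * cbrt n ^ 2)) ≤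
          2 * ∑ e, Γ e * spinCov p e.1.1 e.1.2}} := by
  obtain ⟨hk, hk1, hk2⟩ := learnSize_bounds hη hn hβ hε hscale
  set k := (tuning hη).learnSize n (4 / 3) β ε
  have hu := one_le_cbrt hn
  set Λ := ∑ e : Pair n, |spinCov p e.1.1 e.1.2|
  have hΛ : 0 < Λ := lt_of_lt_of_le (by positivity) hlarge
  set A := advantage (3 / (4 * η))
  have hA : 0 < A := advantage_pos (by positivity)
  have hn' : (0 : ℝ) < n := by exact_mod_cast hn
  -- The lower bounds on √k and Λ multiply so that β and ε cancel; this product defines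
  -- `thresholdConst`.
  have hadv : thresholdConst η * cbrt n ^ 4 ≤ A * √k * Λ := by
    calc thresholdConst η * cbrt n ^ 4 = A * (√2 / η * (cbrt n ^ 4 * β / ε)) * (ε / β) := by
          rw [thresholdConst]; field_simp; rfl
      _ ≤ _ := by gcongr
  -- Each pair contributes in proportion to λ_e², and Cauchy–Schwarz over at most n² pairs turns the
  -- sum of squares into Λ²/n².
  have hmean : A * √k * (Λ ^ 2 / n ^ 2) ≤
      ∫ z, 2 * ∑ e, learned z e * spinCov p e.1.1 e.1.2 ∂(learnLaw p k) := by
    rw [integral_const_mul, integral_finsetSum _ fun _ _ => .of_finite]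
    calc A * √k * (Λ ^ 2 / n ^ 2) ≤ A * √k * ∑ e : Pair n, spinCov p e.1.1 e.1.2 ^ 2 := by
          gcongr
          rw [div_le_iff₀ (by positivity), mul_comm]
          exact sq_sum_abs_le _
      _ = 2 * ∑ e : Pair n, A * √k * spinCov p e.1.1 e.1.2 ^ 2 / 2 := by
          rw [Finset.mul_sum, Finset.mul_sum]
          exact Finset.sum_congr rfl fun e _ => by ring
      _ ≤ _ := by
          gcongr with e
          rw [integral_mul_const, mul_comm (∫ z, learned z e ∂(learnLaw p k))]
          refine spinCov_mul_integral_learned_ge hk p e ?_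
          calc √k * |spinCov p e.1.1 e.1.2| ≤
                2 / η * (cbrt n ^ 4 * β / ε) * (9 * (ε / (24 * β * cbrt n ^ 4))) := by
                gcongr; exact hsmall e
            _ = 3 / (4 * η) := by field_simp; norm_num
  have hbound : ∀ z : (Fin k → Fin 2 → Config n) × (Pair n × Option (Fin k) → ℤˣ),
      2 * ∑ e, learned z e * spinCov p e.1.1 e.1.2 ≤ 2 * Λ := by
    intro z
    refine mul_le_mul_of_nonneg_left (Finset.sum_le_sum fun e _ => ?_) two_pos.le
    refine (le_abs_self _).trans_eq ?_
    rw [abs_mul, abs_learned, one_mul]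
  -- Half of the mean is attained with probability at least mean/(2 · 2Λ). One factor Λ cancels,
  -- leaving a probability of order at least n^{4/3}/n².
  have h := le_measureReal_half_le (learnLaw p k)
    (fun z => 2 * ∑ e, learned z e * spinCov p e.1.1 e.1.2) (by positivity) hbound
    (by positivity) hmean
  refine le_trans ?_ (h.trans (measureReal_mono fun z hz => ?_))
  · calc thresholdConst η / (4 * cbrt n ^ 2) =
          thresholdConst η * cbrt n ^ 4 / (4 * n ^ 2) := by
          rw [← cbrt_pow_three]; field_simp
      _ ≤ A * √k * Λ / (4 * n ^ 2) := by gcongr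
      _ = _ := by field_simp; norm_num
  · refine le_trans ?_ (Set.mem_ofPred.1 hz)
    calc 2 * (thresholdConst η * ε / (4 * β * cbrt n ^ 2)) =
          thresholdConst η * cbrt n ^ 4 * (ε / β) / (2 * n ^ 2) := by
          rw [← cbrt_pow_three]; field_simp; ring
      _ ≤ A * √k * Λ * Λ / (2 * n ^ 2) := by gcongr
      _ = _ := by ring

theorem not_saysFar_le_of_small_cov (hη1 : η ≤ 1) (hn : 0 < n) (hβ : 0 < β) (hε : 0 < ε)
    (hscale : η / 2 ≤ n * β / ε) {θ : IsingParams n} (hθ : θ.HighTemperature η)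
    (hsmall : ∀ e : Pair n, |spinCov θ.law e.1.1 e.1.2| ≤ 9 * (ε / (24 * β * cbrt n ^ 4)))
    (hlarge : ε / β ≤ ∑ e : Pair n, |spinCov θ.law e.1.1 e.1.2|) :
    ((tuning hη).runLaw (4 / 3) β ε θ.law).real
      {run | ¬ (tuning hη).SaysFar (4 / 3) β ε run.1 run.2} ≤ 1 / 10 := by
  have hu := one_le_cbrt hn
  have hκ := thresholdConst_pos hη
  have h2 : (n : ℝ) ^ (2 - 4 / 3 : ℝ) = cbrt n ^ 2 := by rw [cbrt_pow]; norm_num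
  have hgood := learned_good_ge hη hn hβ hε hscale θ.law hsmall hlarge
  set G := {Γ : Pair n → ℝ | 2 * (thresholdConst η * ε / (4 * β * cbrt n ^ 2)) ≤
    2 * ∑ e, Γ e * spinCov θ.law e.1.1 e.1.2}
  have hk : 0 < (tuning hη).testSize n (4 / 3) β ε := by
    rw [testSize_eq _ _ _ _ rfl, Nat.floor_pos]
    have h10 := one_le_scaled hη hn hβ hε hscale (m := 10) (by norm_num)
    change 1 ≤ 8192 * (1 + 1 / thresholdConst η ^ 2) / η ^ 2 * cbrt n ^ 10 * β ^ 2 / ε ^ 2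
    have : 8192 * (1 + 1 / thresholdConst η ^ 2) / η ^ 2 * cbrt n ^ 10 * β ^ 2 / ε ^ 2 =
        2048 * (1 + 1 / thresholdConst η ^ 2) * (4 / η ^ 2 * (cbrt n ^ 10 * β ^ 2 / ε ^ 2)) := by
      ring
    rw [this]
    have : 0 ≤ 1 / thresholdConst η ^ 2 := by positivity
    nlinarith
  have htest : ∀ Γ ∈ G, (∀ e, |Γ e| ≤ 1) →
      (testLaw θ.law ((tuning hη).numRuns n (4 / 3)) ((tuning hη).testSize n (4 / 3) β ε)).real
        {X | ¬ MajorityRejects (tuning hη).thr β ε ((n : ℝ) ^ (2 - 4 / 3 : ℝ)) Γ X} ≤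
        (tuning hη).fail / cbrt n ^ 2 := by
    intro Γ hΓG hΓ
    rw [h2]
    refine (measure_not_majorityRejects_le ?_).trans (exp_neg_numRuns_le _ _ rfl hn)
    exact measure_not_chebyshevRejects_le hβ (by positivity) (tuning hη).thr_pos hε hk hΓG
      (variance_le_test hη hη1 hn hβ hε hθ hΓ hk)
  have hf := (tuning hη).fail_pos
  refine (runLaw_not_saysFar_le _ _ _ _ _ G htest (by positivity)).trans ?_
  -- From 1 - q ≤ exp(-q), so that independent rounds multiply to an exponential.
  have hq : (learnLaw θ.law ((tuning hη).learnSize n (4 / 3) β ε)).real {z | learned z ∈ G}ᶜ ≤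
      Real.exp (-(thresholdConst η / (4 * cbrt n ^ 2))) := by
    rw [probReal_compl_eq_one_sub (Set.toFinite _).measurableSet]
    have := Real.add_one_le_exp (-(thresholdConst η / (4 * cbrt n ^ 2)))
    linarith
  have hL : 16 / thresholdConst η * cbrt n ^ 2 ≤ (tuning hη).numRounds n (4 / 3) := by
    rw [numRounds_eq]; exact Nat.le_ceil _
  have hpow : (learnLaw θ.law ((tuning hη).learnSize n (4 / 3) β ε)).real
      {z | learned z ∈ G}ᶜ ^ (tuning hη).numRounds n (4 / 3) ≤ Real.exp (-4) := by
    refine (pow_le_pow_left₀ measureReal_nonneg hq _).trans ?_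
    rw [← Real.exp_nat_mul, Real.exp_le_exp, mul_neg, neg_le_neg_iff]
    calc (4 : ℝ) = 16 / thresholdConst η * cbrt n ^ 2 * (thresholdConst η / (4 * cbrt n ^ 2)) := by
          field_simp; norm_num
      _ ≤ _ := by gcongr
  have hexp : Real.exp (-4) ≤ 1 / 20 := by
    have h1 := Real.exp_one_gt_d9
    rw [Real.exp_neg, show (4 : ℝ) = ((4 : ℕ) : ℝ) * 1 by norm_num, Real.exp_nat_mul, one_div]
    refine inv_anti₀ (by norm_num) ?_
    calc (20 : ℝ) ≤ 2.7 ^ 4 := by norm_num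
      _ ≤ _ := by gcongr; linarith
  have hfail : (tuning hη).fail / cbrt n ^ 2 ≤ 1 / 20 := by
    refine (div_le_self hf.le (one_le_pow₀ hu)).trans ?_
    change 1 / (20 * (16 / thresholdConst η + 1)) ≤ 1 / 20
    have : 0 < 16 / thresholdConst η := by positivity
    gcongr
    linarith
  linarith

/-- The two upper bounds on the divergence, by β Λ and by 2nβ/η, supply the hypotheses of both
cases; the dichotomy is whether some covariance exceeds what localization is sure to detect. -/
theorem not_saysFar_le_of_far (hη1 : η ≤ 1) (hβ : 0 ≤ β) (hε : 0 < ε) {θ : IsingParams n}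
    (hθ : θ.HighTemperature η) (hθβ : θ.CouplingsBoundedBy β)
    (hfar : ENNReal.ofReal ε ≤ dSKLProduct θ.law) :
    ((tuning hη).runLaw (4 / 3) β ε θ.law).real
      {run | ¬ (tuning hη).SaysFar (4 / 3) β ε run.1 run.2} ≤ 1 / 10 := by
  have h1 := θ.le_mul_sum_abs_spinCov hθβ hε hfar
  have h2 := θ.sum_pair_abs_spinCov_le hη hη1 hθ
  have h3 : ε ≤ β * (2 * n / η) := h1.trans (by gcongr)
  have hβ : 0 < β := hβ.lt_of_ne' fun h => by rw [h, zero_mul] at h3; linarith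
  have hn : 0 < n := Nat.pos_of_ne_zero fun h => by
    rw [h] at h3; simp at h3; linarith
  have hscale : η / 2 ≤ n * β / ε := by
    rw [le_div_iff₀ hε]
    calc η / 2 * ε ≤ η / 2 * (β * (2 * n / η)) := by gcongr
      _ = _ := by field_simp
  by_cases hsmall : ∀ e : Pair n,
      |spinCov θ.law e.1.1 e.1.2| ≤ 9 * (ε / (24 * β * cbrt n ^ 4))
  · refine not_saysFar_le_of_small_cov hη hη1 hn hβ hε hscale hθ hsmall ?_
    rw [div_le_iff₀ hβ, mul_comm]
    exact h1
  · push Not at hsmall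
    obtain ⟨e, he⟩ := hsmall
    exact not_saysFar_le_of_large_cov hη hη1 hn hβ hε hscale θ.law e he

end Far

theorem runLaw_real_compl (T : Tuning) {n : ℕ} (β ε : ℝ) (p : Measure (Config n))
    [IsProbabilityMeasure p] (S : Set ((T.SampleIdx n (4 / 3) β ε → Config n) ×
      (T.CoinIdx n (4 / 3) β ε → ℤˣ))) (h : (T.runLaw (4 / 3) β ε p).real Sᶜ ≤ 1 / 10) :
    9 / 10 ≤ (T.runLaw (4 / 3) β ε p).real S := by
  have : IsProbabilityMeasure (T.runLaw (4 / 3) β ε p) := by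
    unfold Tuning.runLaw; infer_instance
  rw [probReal_compl_eq_one_sub (Set.toFinite _).measurableSet] at h
  linarith

end IsingTesting

end

theorem mainTheorem10 (η : ℝ) (hη : 0 < η) :
    ∃ (T : IsingTesting.Tuning) (C : ℝ) (a : ℕ),
      -- the number of samples is `Õ(n^{10/3} β² / ε²)`
      (∀ (n : ℕ) (β ε : ℝ), 0 ≤ β → 0 < ε →
        (T.numSamples n (4 / 3) β ε : ℝ) ≤
          C * (1 + Real.log n) ^ a * ((n : ℝ) ^ (10 / 3 : ℝ) * β ^ 2 / ε ^ 2)) ∧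
      -- the algorithm distinguishes the two cases with probability at least `9/10`
      (∀ (n : ℕ) (β ε : ℝ), 0 ≤ β → 0 < ε →
        ∀ θ : IsingTesting.IsingParams n, θ.HighTemperature η → θ.CouplingsBoundedBy β →
          (θ.law ∈ IsingTesting.productLaws n →
            9 / 10 ≤ (T.runLaw (4 / 3) β ε θ.law).real
              {run | ¬ T.SaysFar (4 / 3) β ε run.1 run.2}) ∧
          (ENNReal.ofReal ε ≤ IsingTesting.dSKLProduct θ.law →
            9 / 10 ≤ (T.runLaw (4 / 3) β ε θ.law).real
              {run | T.SaysFar (4 / 3) β ε run.1 run.2})) ∧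
      -- the two-sample centered statistic has variance `Õ(n²)`
      (∀ (n : ℕ) (θ : IsingTesting.IsingParams n), θ.HighTemperature η →
        ∀ c : IsingTesting.Pair n → ℝ, (∀ e, |c e| ≤ 1) →
          ProbabilityTheory.variance
              (fun xy : IsingTesting.Config n × IsingTesting.Config n =>
                IsingTesting.centeredStatistic c xy.1 xy.2)
              (θ.law.prod θ.law) ≤
            C * (1 + Real.log n) ^ a * (n : ℝ) ^ 2) := by
  -- A larger margin is a stronger hypothesis, so η may be replaced by min η 1; the estimates need η
  -- ≤ 1 for 1 - η/n to be nonnegative.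
  have hη0 : 0 < min η 1 := lt_min hη one_pos
  have hη1 : min η 1 ≤ 1 := min_le_right _ _
  have hmono : ∀ (n : ℕ) (θ : IsingTesting.IsingParams n), θ.HighTemperature η →
      θ.HighTemperature (min η 1) := fun n θ hθ v =>
    (hθ v).trans (by linarith [min_le_left η 1])
  obtain ⟨C, hC, hsamples⟩ := IsingTesting.numSamples_le hη0
  refine ⟨IsingTesting.tuning hη0, C + 64 / (min η 1) ^ 2, 1, ?_, ?_, ?_⟩
  · intro n β ε hβ hε
    have hl : 0 ≤ Real.log n := Real.log_natCast_nonneg n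
    refine (hsamples n β ε hβ hε).trans ?_
    rw [pow_one]
    gcongr
    exact le_add_of_nonneg_right (by positivity)
  · intro n β ε hβ hε θ hθ hθβ
    refine ⟨fun hp => IsingTesting.runLaw_real_compl _ _ _ _ _ ?_,
      fun hfar => IsingTesting.runLaw_real_compl _ _ _ _ _ ?_⟩
    · have h := IsingTesting.saysFar_le_of_product hη0 hη1 hβ hε (hmono n θ hθ) hp
      simpa only [Set.compl_ofPred, not_not] using h
    · exact IsingTesting.not_saysFar_le_of_far hη0 hη1 hβ hε (hmono n θ hθ) hθβ hfar
  · intro n θ hθ c hc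
    have hl : 0 ≤ Real.log n := Real.log_natCast_nonneg n
    refine (θ.variance_centeredStatistic_le hη0 hη1 (hmono n θ hθ) c hc).trans ?_
    rw [pow_one, mul_div_right_comm]
    gcongr
    nlinarith [mul_nonneg hC hl, mul_nonneg (by positivity : 0 ≤ 64 / (min η 1) ^ 2) hl]
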